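/- **Setting.** Let $N\in\mathbb N$, $T>0$, $\mathcal H_B=\ell^2(\mathbb Z^2)\otimes\mathbb C^N$, $\mathcal H_E=\ell^2(\mathbb N\times\mathbb Z)\otimes\mathbb C^N$ (with $0\in\mathbb N$), and let $\iota:\mathcal H_E\to\mathcal H_B$ be extension by zero. For an operator $K$ and sites $m,n$ write $K_{m,n}=\langle m|K|n\rangle$, an $N\times N$ matrix, and $|m|=|m_1|+|m_2|$. A bulk Hamiltonian of period $T$ is a family $H_B(t)$, $t\in\mathbb R$, of bounded self-adjoint operators on $\mathcal H_B$ such that: $H_B(t+T)=H_B(t)$ for all $t$; there are $\mu,C>0$ with $\|H_B(t)_{m,n}\|\le Ce^{-\mu|m-n|}$ for all $t\in[0,T]$ and $m,n\in\mathbb Z^2$; and $t\mapsto H_B(t)$ is strongly continuous except possibly for jump discontinuities, of which there are finitely many in each bounded interval. The edge Hamiltonian is $H_E(t)=\iota^*H_B(t)\iota$. Let $U_B(t,s)$ and $U_E(t,s)$ be the unitary propagators generated by $H_B$ and $H_E$: the strongly continuous families of unitary operators with $U(t,t)=I$, $U(t,r)U(r,s)=U(t,s)$ and $i\,\frac{d}{dt}U(t,s)\psi=H(t)U(t,s)\psi$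 at all times $t$ at which $H$ is strongly continuous. Write $U(t)=U(t,0)$. A switch function is a function $\Lambda:\mathbb Z\to\mathbb R$ with $\Lambda(n)=1$ for all sufficiently large $n$ and $\Lambda(n)=0$ for all sufficiently negative $n$; $\Lambda_i$ denotes multiplication by a switch function of the coordinate $n_i$. **Proposition.** Let $H_B$ be a bulk Hamiltonian of period $T$ that is translation invariant, $H_B(t)_{m,n}=H_B(t)_{0,n-m}$ for all $t$ and all $m,n\in\mathbb Z^2$, and suppose that $U_B(T)=I$. Define the Fourier transforms $$\widehat U_B(t,k_1,k_2)=\sum_{n\in\mathbb Z^2}e^{-ik\cdot n}\,U_B(t)_{n,0},\qquad \big(\widehat U_E(T,k_2)\big)_{m_1,n_1}=\sum_{j\in\mathbb Z}e^{-ik_2j}\,U_E(T)_{(m_1,j),(n_1,0)}\quad(m_1,n_1\in\mathbb N),$$ which are $N\times N$ matrices and bounded operators on $\ell^2(\mathbb N)\otimes\mathbb C^N$, respectively; the series converge absolutely in operator norm. 1. $\widehat U_E(T,k_2)$ is differentiable in $k_2$ in operator norm, and $\widehat U_E^*\,\partial_{k_2}\widehat U_E(T,k_2)$ is trace class for every $k_2$,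 with a trace that is integrable over $[0,2\pi]$. For every switch function $\Lambda_2$ in direction 2 the operator $U_E^*(T)[\Lambda_2,U_E(T)]$ is trace class, and the edge index $\mathcal I_E=\mathrm{Tr}_{\mathcal H_E}\big(U_E^*(T)[\Lambda_2,U_E(T)]\big)$ is the winding number $$\mathcal I_E=\frac{i}{2\pi}\int_0^{2\pi}dk_2\,\mathrm{Tr}_{\ell^2(\mathbb N)\otimes\mathbb C^N}\big(\widehat U_E^*(T,k_2)\,\partial_{k_2}\widehat U_E(T,k_2)\big).$$ 2. $\widehat U_B$ is differentiable in $k_1$ and in $k_2$, and in $t$ at every time where $H_B$ is strongly continuous. For all switch functions $\Lambda_1,\Lambda_2$ in directions 1 and 2, with $\partial_tU_B$ the strong derivative (set to $0$ at times where it does not exist), the operator $U_B^*\partial_tU_B\big[U_B^*[\Lambda_1,U_B],U_B^*[\Lambda_2,U_B]\big]$ is trace class for every $t$, its trace is integrable over $[0,T]$, and the bulk index $$\mathcal I_B=\frac12\int_0^Tdt\,\mathrm{Tr}_{\mathcal H_B}\Big(U_B^*\partial_tU_B\big[U_B^*[\Lambda_1,U_B],\,U_B^*[\Lambda_2,U_B]\big]\Big)$$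 is the three-dimensional winding number $$\mathcal I_B=-\frac1{8\pi^2}\int_{[0,T]\times[0,2\pi]^2}dt\,dk_1\,dk_2\;\mathrm{tr}_{\mathbb C^N}\Big(\widehat U_B^*\partial_t\widehat U_B\big[\widehat U_B^*\partial_{k_1}\widehat U_B,\ \widehat U_B^*\partial_{k_2}\widehat U_B\big]\Big),$$ where the integrand is integrable. -/

import Mathlib

open scoped ENNReal Topology

noncomputable section

namespace Floquet

/-! ### Hilbert spaces, kernels, traces -/

/-- The space `ℂ^N` of internal degrees of freedom. -/
abbrev Fiber (N : ℕ) : Type := EuclideanSpace ℂ (Fin N)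

/-- The Hilbert space `ℓ²(X) ⊗ ℂ^N = ℓ²(X; ℂ^N)`. -/
abbrev Hil (X : Type) (N : ℕ) : Type := lp (fun _ : X => Fiber N) 2

/-- Bounded operators on `ℓ²(X) ⊗ ℂ^N`; `star A` is the adjoint of `A`. -/
abbrev Op (X : Type) (N : ℕ) : Type := Hil X N →L[ℂ] Hil X N

/-- The kernel `K_{m,n} = ⟨m|K|n⟩`, an operator on `ℂ^N`; its norm is the operator norm. -/
def kernel {X : Type} [DecidableEq X] {N : ℕ} (K : Op X N) (m n : X) :
    Fiber N →L[ℂ] Fiber N :=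
  (lp.evalCLM ℂ (fun _ : X => Fiber N) 2 m).comp
    (K.comp (lp.singleContinuousLinearMap ℂ (fun _ : X => Fiber N) 2 n))

theorem kernel_apply {X : Type} [DecidableEq X] {N : ℕ} (K : Op X N) (m n : X) (v : Fiber N) :
    kernel K m n v = K (lp.single 2 n v) m := rfl

/-- The canonical orthonormal basis `|x⟩ ⊗ e_i` of `ℓ²(X) ⊗ ℂ^N`. -/
def basisVec {X : Type} [DecidableEq X] {N : ℕ} (p : X × Fin N) : Hil X N :=
  lp.single 2 p.1 (EuclideanSpace.single p.2 (1 : ℂ))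

/-- The absolute value `|A| = (A^* A)^{1/2}` of a bounded operator on a Hilbert space. -/
def absOp {E : Type} [NormedAddCommGroup E] [InnerProductSpace ℂ E] [CompleteSpace E]
    (A : E →L[ℂ] E) : E →L[ℂ] E :=
  CFC.abs A

/-- `A` is trace class: `Tr |A| < ∞` where `|A| = (A^* A)^{1/2}`. -/
def IsTraceClass {X : Type} [DecidableEq X] {N : ℕ} (A : Op X N) : Prop :=
  Summable fun p : X × Fin N => inner ℂ (basisVec p) (absOp A (basisVec p))

/-- The trace of a (trace class) operator on `ℓ²(X) ⊗ ℂ^N`, computed in the canonical basis. -/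
def trace {X : Type} [DecidableEq X] {N : ℕ} (A : Op X N) : ℂ :=
  ∑' p : X × Fin N, inner ℂ (basisVec p) (A (basisVec p))

/-- The trace of matrices of size `N`. -/
def tr {N : ℕ} (A : Fiber N →L[ℂ] Fiber N) : ℂ :=
  LinearMap.trace ℂ (Fiber N) (A : Fiber N →ₗ[ℂ] Fiber N)

/-! ### Truncation and injection -/

theorem pullback_aux {X Y : Type} {N : ℕ} (f : X ↪ Y) (ψ : Hil Y N) :
    Summable (fun x => ‖ψ (f x)‖ ^ (2 : ℝ≥0∞).toReal) ∧
      ∑' x, ‖ψ (f x)‖ ^ (2 : ℝ≥0∞).toReal ≤ ‖ψ‖ ^ (2 : ℝ≥0∞).toReal := by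
  have hs := (lp.memℓp ψ).summable (p := 2) (by norm_num)
  have h1 := hs.comp_injective f.injective
  refine ⟨h1, ?_⟩
  rw [lp.norm_rpow_eq_tsum (by norm_num)]
  exact h1.tsum_le_tsum_of_inj f f.injective (fun c _ => by positivity) (fun _ => le_rfl) hs

/-- For an injection `f : X → Y`, the truncation `ℓ²(Y) ⊗ ℂ^N → ℓ²(X) ⊗ ℂ^N`, `ψ ↦ ψ ∘ f`. -/
def truncation {X Y : Type} {N : ℕ} (f : X ↪ Y) : Hil Y N →L[ℂ] Hil X N :=
  LinearMap.mkContinuous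
    { toFun := fun ψ => ⟨fun x => ψ (f x), memℓp_gen (pullback_aux f ψ).1⟩
      map_add' := fun _ _ => rfl
      map_smul' := fun _ _ => rfl } 1 (by
    intro ψ
    rw [one_mul]
    exact lp.norm_le_of_tsum_le (by norm_num) (norm_nonneg _) (pullback_aux f ψ).2)

@[simp] theorem truncation_apply {X Y : Type} {N : ℕ} (f : X ↪ Y) (ψ : Hil Y N) (x : X) :
    truncation f ψ x = ψ (f x) := rfl

/-- The isometric injection `ℓ²(X) ⊗ ℂ^N → ℓ²(Y) ⊗ ℂ^N` given by extension by zero. -/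
def injection {X Y : Type} {N : ℕ} (f : X ↪ Y) : Hil X N →L[ℂ] Hil Y N :=
  ContinuousLinearMap.adjoint (truncation f)

theorem injection_single {X Y : Type} [DecidableEq X] [DecidableEq Y] {N : ℕ} (f : X ↪ Y)
    (x : X) (v : Fiber N) :
    injection f (lp.single 2 x v : Hil X N) = lp.single 2 (f x) v := by
  refine ext_inner_right ℂ fun φ => ?_
  rw [injection, ContinuousLinearMap.adjoint_inner_left, lp.inner_single_left,
    lp.inner_single_left, truncation_apply]

/-! ### Switch functions -/

/-- Switch functions `Λ : ℤ → ℝ`. -/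
def IsSwitch (Λ : ℤ → ℝ) : Prop :=
  ∃ a b : ℤ, (∀ n, b ≤ n → Λ n = 1) ∧ (∀ n, n ≤ a → Λ n = 0)

theorem IsSwitch.bounded {Λ : ℤ → ℝ} (h : IsSwitch Λ) : ∃ C : ℝ, ∀ n, |Λ n| ≤ C := by
  obtain ⟨a, b, hb, ha⟩ := h
  refine ⟨1 + ∑ n ∈ Finset.Icc a b, |Λ n|, fun n => ?_⟩
  have h0 : 0 ≤ ∑ n ∈ Finset.Icc a b, |Λ n| := Finset.sum_nonneg fun _ _ => abs_nonneg _
  rcases le_total b n with h1 | h1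
  · rw [hb n h1, abs_one]; linarith
  rcases le_total n a with h2 | h2
  · rw [ha n h2, abs_zero]; linarith
  · have := Finset.single_le_sum (f := fun n => |Λ n|) (fun i _ => abs_nonneg (Λ i))
      (Finset.mem_Icc.2 ⟨h2, h1⟩)
    linarith

theorem mulOp_aux {X : Type} {N : ℕ} (g : X → ℝ) {C : ℝ} (hC : ∀ x, |g x| ≤ C) (ψ : Hil X N) :
    Memℓp (fun x => (g x : ℂ) • ψ x) 2 := by
  refine memℓp_gen ?_
  have hs := (lp.memℓp ψ).summable (p := 2) (by norm_num)
  refine Summable.of_nonneg_of_le (fun x => by positivity) (fun x => ?_)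
    (hs.mul_left (C ^ (2 : ℝ≥0∞).toReal))
  rw [norm_smul, Complex.norm_real, Real.norm_eq_abs,
    Real.mul_rpow (abs_nonneg _) (norm_nonneg _)]
  gcongr
  exact hC x

/-- Multiplication by a bounded real function `g` on `ℓ²(X) ⊗ ℂ^N`. -/
def mulOp {X : Type} {N : ℕ} (g : X → ℝ) (hg : ∃ C : ℝ, ∀ x, |g x| ≤ C) : Op X N :=
  LinearMap.mkContinuous
    { toFun := fun ψ => ⟨fun x => (g x : ℂ) • ψ x, mulOp_aux g hg.choose_spec ψ⟩
      map_add' := fun φ ψ => by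
        apply lp.ext
        funext x
        exact smul_add _ _ _
      map_smul' := fun c ψ => by
        apply lp.ext
        funext x
        exact smul_comm (g x : ℂ) c (ψ x) } (max hg.choose 0) (by
    intro ψ
    have hb : ∀ x, |g x| ≤ max hg.choose 0 := fun x => (hg.choose_spec x).trans (le_max_left _ _)
    have h0 : (0 : ℝ) ≤ max hg.choose 0 := le_max_right _ _
    refine lp.norm_le_of_forall_sum_le (by norm_num) (by positivity) fun s => ?_
    rw [Real.mul_rpow h0 (norm_nonneg _)]
    refine le_trans ?_ (mul_le_mul_of_nonneg_left
      (lp.sum_rpow_le_norm_rpow (p := 2) (by norm_num) ψ s) (by positivity))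
    rw [Finset.mul_sum]
    refine Finset.sum_le_sum fun x _ => ?_
    change ‖(g x : ℂ) • ψ x‖ ^ _ ≤ _
    rw [norm_smul, Complex.norm_real, Real.norm_eq_abs,
      Real.mul_rpow (abs_nonneg _) (norm_nonneg _)]
    gcongr
    exact hb x)

@[simp] theorem mulOp_apply {X : Type} {N : ℕ} (g : X → ℝ) (hg : ∃ C : ℝ, ∀ x, |g x| ≤ C)
    (ψ : Hil X N) (x : X) : mulOp g hg ψ x = (g x : ℂ) • ψ x := rfl

/-- The switch function `Λ₁(n) = Λ(n₁)` as an operator on the bulk space. -/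
def switch₁ {N : ℕ} (Λ : ℤ → ℝ) (h : IsSwitch Λ) : Op (ℤ × ℤ) N :=
  mulOp (fun n : ℤ × ℤ => Λ n.1) ⟨h.bounded.choose, fun n => h.bounded.choose_spec n.1⟩

/-- The switch function `Λ₂(n) = Λ(n₂)` as an operator on the bulk space. -/
def switch₂ {N : ℕ} (Λ : ℤ → ℝ) (h : IsSwitch Λ) : Op (ℤ × ℤ) N :=
  mulOp (fun n : ℤ × ℤ => Λ n.2) ⟨h.bounded.choose, fun n => h.bounded.choose_spec n.2⟩

/-- The switch function `Λ₂(n) = Λ(n₂)` as an operator on the edge space. -/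
def edgeSwitch₂ {N : ℕ} (Λ : ℤ → ℝ) (h : IsSwitch Λ) : Op (ℕ × ℤ) N :=
  mulOp (fun n : ℕ × ℤ => Λ n.2) ⟨h.bounded.choose, fun n => h.bounded.choose_spec n.2⟩

/-! ### Hamiltonians and propagators -/

/-- `H` is strongly continuous at the time `t`. -/
def StronglyContinuousAt {X : Type} {N : ℕ} (H : ℝ → Op X N) (t : ℝ) : Prop :=
  ∀ ψ : Hil X N, ContinuousAt (fun r => H r ψ) t

/-- Bulk Hamiltonians on `ℓ²(ℤ²) ⊗ ℂ^N` with time period `T`. -/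
structure IsBulkHamiltonian {N : ℕ} (T : ℝ) (H : ℝ → Op (ℤ × ℤ) N) : Prop where
  selfAdjoint : ∀ t, IsSelfAdjoint (H t)
  periodic : ∀ t, H (t + T) = H t
  isLocal : ∃ μ > (0 : ℝ), ∃ C > (0 : ℝ), ∀ t ∈ Set.Icc 0 T, ∀ m n : ℤ × ℤ,
    ‖kernel (H t) m n‖ ≤
      C * Real.exp (-μ * (|(m.1 : ℝ) - (n.1 : ℝ)| + |(m.2 : ℝ) - (n.2 : ℝ)|))
  /-- Piecewise strong continuity: away from a locally finite set `S` of times, `H` is strongly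
  continuous, and at the times in `S` the two one-sided strong limits exist. -/
  piecewise : ∃ S : Set ℝ, (∀ a b : ℝ, (S ∩ Set.Icc a b).Finite) ∧
    (∀ t, t ∉ S → StronglyContinuousAt H t) ∧
    (∀ t ∈ S, ∀ ψ : Hil (ℤ × ℤ) N,
      (∃ l, Filter.Tendsto (fun r => H r ψ) (𝓝[<] t) (𝓝 l)) ∧
      (∃ l, Filter.Tendsto (fun r => H r ψ) (𝓝[>] t) (𝓝 l)))

/-- Translation invariance in space: `H(t)_{m,n} = H(t)_{0,n-m}`. -/
def IsTranslationInvariant {N : ℕ} (H : ℝ → Op (ℤ × ℤ) N) : Prop :=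
  ∀ t, ∀ m n : ℤ × ℤ, kernel (H t) m n = kernel (H t) 0 (n - m)

/-- The inclusion of the half-plane `ℕ × ℤ` in `ℤ²`. -/
def halfPlane : (ℕ × ℤ) ↪ (ℤ × ℤ) :=
  ⟨fun n => ((n.1 : ℤ), n.2), fun m n h => by
    simp only [Prod.mk.injEq, Nat.cast_inj] at h
    exact Prod.ext h.1 h.2⟩

/-- The edge Hamiltonian `H_E(t) = ι^* H_B(t) ι`. -/
def edgeHamiltonian {N : ℕ} (H : ℝ → Op (ℤ × ℤ) N) (t : ℝ) : Op (ℕ × ℤ) N :=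
  (truncation halfPlane).comp ((H t).comp (injection halfPlane))

/-- `U(t,s)` is the unitary propagator generated by `H(t)`. The Schrödinger equation holds at all
times where `H` is strongly continuous; `U` is strongly continuous everywhere, in particular
across the jumps of `H`. For a piecewise strongly continuous `H` this determines `U`. -/
structure IsPropagator {X : Type} {N : ℕ} (H : ℝ → Op X N) (U : ℝ → ℝ → Op X N) : Prop where
  unitary : ∀ t s, U t s ∈ unitary (Op X N)
  stronglyContinuous : ∀ ψ : Hil X N, Continuous fun p : ℝ × ℝ => U p.1 p.2 ψ
  self : ∀ t, U t t = 1
  cocycle : ∀ t r s, U t r * U r s = U t s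
  schrodinger : ∀ (s : ℝ) (ψ : Hil X N) (t : ℝ), StronglyContinuousAt H t →
    HasDerivAt (fun r => U r s ψ) (-Complex.I • H t (U t s ψ)) t

open Classical in
/-- The strong derivative `(∂_t U)(t)`: the bounded operator `D` with
`d/dt (U(t) ψ) = D ψ` for every `ψ` (and `0` if there is none, which for a propagator happens at
most at the jump times of its generator). -/
def strongDeriv {X : Type} {N : ℕ} (U : ℝ → Op X N) (t : ℝ) : Op X N :=
  if h : ∃ D : Op X N, ∀ ψ : Hil X N, HasDerivAt (fun r => U r ψ) (D ψ) t then h.choose else 0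

/-! ### Indices

In this part `U` stands for the one-parameter family `U(t) = U(t,0)`, and `⁅A, B⁆ = A B - B A`. -/

/-- The operator `U_E^*(T) [Λ₂, U_E(T)]` whose trace is the edge index. -/
def edgeIndexOp {N : ℕ} (UT : Op (ℕ × ℤ) N) (Λ : ℤ → ℝ) (h : IsSwitch Λ) : Op (ℕ × ℤ) N :=
  star UT * ⁅(edgeSwitch₂ Λ h : Op (ℕ × ℤ) N), UT⁆

/-- The edge index. -/
def edgeIndex {N : ℕ} (UT : Op (ℕ × ℤ) N) (Λ : ℤ → ℝ) (h : IsSwitch Λ) : ℂ :=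
  trace (edgeIndexOp UT Λ h)

/-- The operator `U^* ∂_t U [U^* [Λ₁, U], U^* [Λ₂, U]]` at time `t`. -/
def bulkIndexOp {N : ℕ} (U : ℝ → Op (ℤ × ℤ) N) (Λ Λ' : ℤ → ℝ) (h : IsSwitch Λ)
    (h' : IsSwitch Λ') (t : ℝ) : Op (ℤ × ℤ) N :=
  star (U t) * strongDeriv U t *
    ⁅star (U t) * ⁅(switch₁ Λ h : Op (ℤ × ℤ) N), U t⁆, star (U t) * ⁅(switch₂ Λ' h' : Op (ℤ × ℤ) N), U t⁆⁆

/-- The bulk index. -/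
def bulkIndex {N : ℕ} (T : ℝ) (U : ℝ → Op (ℤ × ℤ) N) (Λ Λ' : ℤ → ℝ) (h : IsSwitch Λ)
    (h' : IsSwitch Λ') : ℂ :=
  (1 / 2 : ℂ) * ∫ t in (0 : ℝ)..T, trace (bulkIndexOp U Λ Λ' h h' t)

/-! ### Fourier transforms

The transform on `ℓ²(ℤ^d)` is `ψ ↦ ∑ₙ e^{-ik·n} ψ(n)`, under which an operator with a translation
invariant kernel `K_{m,n}` becomes multiplication by `∑ₙ e^{-ik·n} K_{n,0}`. -/

/-- The summand `e^{-ik·n} K_{n,0}` of the bulk Fourier transform. -/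
def bulkFourierTerm {N : ℕ} (K : Op (ℤ × ℤ) N) (k₁ k₂ : ℝ) (n : ℤ × ℤ) :
    Fiber N →L[ℂ] Fiber N :=
  Complex.exp (-Complex.I * ((k₁ : ℂ) * (n.1 : ℂ) + (k₂ : ℂ) * (n.2 : ℂ))) • kernel K n 0

/-- The Fourier transform of a translation invariant operator on `ℓ²(ℤ²) ⊗ ℂ^N`. -/
def bulkFourier {N : ℕ} (K : Op (ℤ × ℤ) N) (k₁ k₂ : ℝ) : Fiber N →L[ℂ] Fiber N :=
  ∑' n : ℤ × ℤ, bulkFourierTerm K k₁ k₂ n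

/-- The row `n₂ = j` of the half-plane `ℕ × ℤ`. -/
def row (j : ℤ) : ℕ ↪ (ℕ × ℤ) :=
  ⟨fun n => (n, j), fun _ _ h => (Prod.mk.inj h).1⟩

/-- The operator on `ℓ²(ℕ) ⊗ ℂ^N` with kernel `(m₁, n₁) ↦ K_{(m₁,j),(n₁,0)}`. -/
def rowBlock {N : ℕ} (K : Op (ℕ × ℤ) N) (j : ℤ) : Op ℕ N :=
  (truncation (row j)).comp (K.comp (injection (row 0)))

/-- The summand `e^{-ik₂j} K_{(·,j),(·,0)}` of the edge Fourier transform. -/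
def edgeFourierTerm {N : ℕ} (K : Op (ℕ × ℤ) N) (k₂ : ℝ) (j : ℤ) : Op ℕ N :=
  Complex.exp (-Complex.I * ((k₂ : ℂ) * (j : ℂ))) • rowBlock K j

/-- The Fourier transform in direction 2 of an operator on `ℓ²(ℕ × ℤ) ⊗ ℂ^N` that is translation
invariant in direction 2, as an operator on `ℓ²(ℕ) ⊗ ℂ^N`; the series is taken in operator norm. -/
def edgeFourier {N : ℕ} (K : Op (ℕ × ℤ) N) (k₂ : ℝ) : Op ℕ N :=
  ∑' j : ℤ, edgeFourierTerm K k₂ j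

/-- The operator `Û_E^*(T,k₂) ∂_{k₂} Û_E(T,k₂)` on `ℓ²(ℕ) ⊗ ℂ^N`. -/
def edgeWindingOp {N : ℕ} (UT : Op (ℕ × ℤ) N) (k₂ : ℝ) : Op ℕ N :=
  star (edgeFourier UT k₂) * deriv (fun k => edgeFourier UT k) k₂

/-- The integrand `tr (Û^* ∂_t Û [Û^* ∂_{k₁} Û, Û^* ∂_{k₂} Û])` at the point `p = (t, k₁, k₂)`. -/
def bulkWindingDensity {N : ℕ} (U : ℝ → Op (ℤ × ℤ) N) (p : ℝ × ℝ × ℝ) : ℂ :=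
  tr (star (bulkFourier (U p.1) p.2.1 p.2.2) *
      deriv (fun t => bulkFourier (U t) p.2.1 p.2.2) p.1 *
    ⁅star (bulkFourier (U p.1) p.2.1 p.2.2) *
        deriv (fun k => bulkFourier (U p.1) k p.2.2) p.2.1,
      star (bulkFourier (U p.1) p.2.1 p.2.2) *
        deriv (fun k => bulkFourier (U p.1) p.2.1 k) p.2.2⁆)

/-- The fundamental domain `[0,T] × [0,2π]²` of the torus `𝕋³`. -/
def torus (T : ℝ) : Set (ℝ × ℝ × ℝ) :=
  Set.Icc 0 T ×ˢ (Set.Icc 0 (2 * Real.pi) ×ˢ Set.Icc 0 (2 * Real.pi))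

end Floquet

end

open Floquet

namespace Floquet

set_option linter.unusedSectionVars false

/-! ### Extended-norm sums and matrix kernels -/

section

variable {X : Type} {N : ℕ}

/-! Both formulas rest on one identity: a switch function satisfies ∑_s (Λ(m+s) − Λ(n+s)) = m − n.
By translation invariance, a diagonal entry at a translated site of an operator built from [Λ, U]
equals the entry at the origin with Λ translated. The trace over sites is thus a sum over translates
of Λ, in which [Λ, U] turns into the commutator of U with the position operator, whatever the
profile of Λ (`tsum_lie_switchAt_apply`, `hasSum_commVec`). Under the Fourier transform that
commutator is i∂_k, and the entry at the origin is the mean over momenta.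

Convergence comes from locality. Conjugation with bounded exponential weights and Grönwall's
inequality give exponential decay of the propagator kernels (`IsPropagator.norm_kernel_le`). At the
edge, U_E is compared with the truncated U_B by a Duhamel argument: the source term only involves
bulk sites beyond the edge, so the difference decays away from the edge
(`exists_norm_kernel_edge_sub_le`). Since U_B(T) = I, the entries of U_E(T) weighted by |m₂ − n₂|
then decay in m₁, n₁ and |m₂ − n₂|.

Trace class is always obtained from ∑_p ‖A e_p‖ < ∞, which suffices because ⟨e, |A| e⟩ ≤ ‖A e‖ for a
unit vector e. The condition survives multiplication by bounded operators on the left. The estimates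
are made in ℓ¹ with extended norms, where Tonelli needs no side conditions.

For the edge, the remaining sum ∑_j j ‖(U e)(·, j)‖² is evaluated by Parseval (`edgeIndex_eq`). For
the bulk, two commutators in independent directions use up both translations, and the trace is the
matrix trace of one kernel entry at the origin, hence an average over the Brillouin zone
(`IsPropagator.trace_bulkIndexOp`). The sign is (−i)² and the constant is ½ · 1/(4π²). The jump
times in [0,T] form a finite, hence null, set. -/

theorem summable_norm_iff_tsum_enorm_ne_top {ι E : Type*} [SeminormedAddCommGroup E] {f : ι → E} :
    Summable (fun i => ‖f i‖) ↔ ∑' i, ‖f i‖ₑ ≠ ⊤ := by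
  exact (NNReal.summable_coe (f := fun i => ‖f i‖₊)).trans
    ENNReal.tsum_coe_ne_top_iff_summable.symm

theorem enorm_sq_eq_tsum (φ : Hil X N) : ‖φ‖ₑ ^ 2 = ∑' x, ‖φ x‖ₑ ^ 2 := by
  have h := lp.hasSum_norm (p := 2) (by norm_num) φ
  simp only [ENNReal.toReal_ofNat, Real.rpow_ofNat] at h
  have h2 := ENNReal.ofReal_tsum_of_nonneg (fun x => sq_nonneg ‖φ x‖) h.summable
  rw [h.tsum_eq] at h2
  simpa [ENNReal.ofReal_pow] using h2

theorem memℓp_two_of_tsum_ne_top {f : X → Fiber N} (h : ∑' x, ‖f x‖ₑ ^ 2 ≠ ⊤) : Memℓp f 2 := by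
  refine memℓp_gen ?_
  simp only [ENNReal.toReal_ofNat, Real.rpow_ofNat]
  have : ∑' x, ‖(‖f x‖ ^ 2 : ℝ)‖ₑ ≠ ⊤ := by simpa [enorm_pow] using h
  exact (summable_norm_iff_tsum_enorm_ne_top.2 this).of_norm

theorem enorm_apply_le (φ : Hil X N) (x : X) : ‖φ x‖ₑ ≤ ‖φ‖ₑ := by
  have := lp.norm_apply_le_norm (p := 2) (by norm_num) φ x
  simpa [enorm_eq_nnnorm] using (show ‖φ x‖₊ ≤ ‖φ‖₊ from this)

/-- Cauchy–Schwarz in each row with weight ‖k m n‖ uses up one row sum; exchanging the order of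
summation then brings in the column sums. -/
theorem schur_aux (k : X → X → Fiber N →L[ℂ] Fiber N) (S : ℝ≥0∞)
    (hr : ∀ m, ∑' n, ‖k m n‖ₑ ≤ S) (hc : ∀ n, ∑' m, ‖k m n‖ₑ ≤ S) (φ : Hil X N) :
    ∑' m, (∑' n, ‖k m n‖ₑ * ‖φ n‖ₑ) ^ 2 ≤ S ^ 2 * ‖φ‖ₑ ^ 2 := by
  have key : ∀ m, (∑' n, ‖k m n‖ₑ * ‖φ n‖ₑ) ^ 2 ≤ S * ∑' n, ‖k m n‖ₑ * ‖φ n‖ₑ ^ 2 := by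
    intro m
    have h1 : ∑' n, ‖k m n‖ₑ * ‖φ n‖ₑ ≤
        S ^ (1 / 2 : ℝ) * (∑' n, ‖k m n‖ₑ * ‖φ n‖ₑ ^ 2) ^ (1 / 2 : ℝ) := by
      -- The weighted Hölder inequality is applied to finite sums, and the bound passes to the
      -- supremum.
      rw [ENNReal.tsum_eq_iSup_sum]
      refine iSup_le fun s => ?_
      have := ENNReal.inner_le_weight_mul_Lp_of_nonneg s (p := 2) (by norm_num)
        (fun n => ‖k m n‖ₑ) (fun n => ‖φ n‖ₑ)
      refine this.trans ?_
      norm_num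
      gcongr
      · exact (ENNReal.sum_le_tsum s).trans (hr m)
      · exact ENNReal.sum_le_tsum s
    calc _ ≤ (S ^ (1 / 2 : ℝ) * (∑' n, ‖k m n‖ₑ * ‖φ n‖ₑ ^ 2) ^ (1 / 2 : ℝ)) ^ 2 := by gcongr
      _ = _ := by
        rw [mul_pow, ← ENNReal.rpow_natCast, ← ENNReal.rpow_natCast, ← ENNReal.rpow_mul,
          ← ENNReal.rpow_mul]
        norm_num
  calc _ ≤ ∑' m, S * ∑' n, ‖k m n‖ₑ * ‖φ n‖ₑ ^ 2 := ENNReal.tsum_le_tsum key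
    _ = S * ∑' n, (∑' m, ‖k m n‖ₑ) * ‖φ n‖ₑ ^ 2 := by
      rw [ENNReal.tsum_mul_left, ENNReal.tsum_comm]
      simp_rw [ENNReal.tsum_mul_right]
    _ ≤ S * ∑' n, S * ‖φ n‖ₑ ^ 2 := by
      gcongr with n
      exact hc n
    _ = _ := by rw [ENNReal.tsum_mul_left, ← enorm_sq_eq_tsum, ← mul_assoc, sq S]

/-! ### Calculus of operator kernels -/

variable [DecidableEq X]

theorem hasSum_single (φ : Hil X N) :
    HasSum (fun x => (lp.single 2 x (φ x) : Hil X N)) φ :=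
  lp.hasSum_single (by norm_num) φ

theorem hasSum_op_single (K : Op X N) (φ : Hil X N) :
    HasSum (fun x => K (lp.single 2 x (φ x))) (K φ) :=
  (hasSum_single φ).mapL K

theorem hasSum_kernel (K : Op X N) (φ : Hil X N) (m : X) :
    HasSum (fun n => kernel K m n (φ n)) (K φ m) :=
  (hasSum_op_single K φ).mapL (lp.evalCLM ℂ (fun _ : X => Fiber N) 2 m)

theorem op_ext_kernel {K L : Op X N} (h : ∀ m n, kernel K m n = kernel L m n) : K = L := by
  ext1 φ
  apply lp.ext
  funext m
  refine (hasSum_kernel K φ m).unique ?_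
  simpa only [h] using hasSum_kernel L φ m

theorem kernel_star (K : Op X N) (m n : X) : kernel (star K) m n = star (kernel K n m) := by
  ext1 v
  refine ext_inner_right ℂ fun w => ?_
  rw [ContinuousLinearMap.star_eq_adjoint, ContinuousLinearMap.star_eq_adjoint,
    ContinuousLinearMap.adjoint_inner_left, kernel_apply, kernel_apply]
  rw [← lp.inner_single_right, ContinuousLinearMap.adjoint_inner_left, lp.inner_single_left]

theorem kernel_mulOp_mul (g : X → ℝ) (hg) (K : Op X N) (m n : X) :
    kernel (mulOp g hg * K) m n = (g m : ℂ) • kernel K m n := rfl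

theorem mulOp_single (g : X → ℝ) (hg) (x : X) (v : Fiber N) :
    mulOp g hg (lp.single 2 x v : Hil X N) = (g x : ℂ) • lp.single 2 x v := by
  apply lp.ext
  funext y
  rw [mulOp_apply, lp.coeFn_smul, Pi.smul_apply]
  by_cases h : y = x
  · subst h; rfl
  · rw [lp.single_apply_ne _ _ _ h, smul_zero, smul_zero]

theorem kernel_mul_mulOp (g : X → ℝ) (hg) (K : Op X N) (m n : X) :
    kernel (K * mulOp g hg) m n = (g n : ℂ) • kernel K m n := by
  ext1 v
  rw [kernel_apply, mul_apply_eq_comp, mulOp_single, map_smul]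
  rfl

theorem kernel_sub (K L : Op X N) (m n : X) : kernel (K - L) m n = kernel K m n - kernel L m n :=
  rfl

theorem kernel_smul (c : ℂ) (K : Op X N) (m n : X) : kernel (c • K) m n = c • kernel K m n := rfl

theorem kernel_one (m n : X) : kernel (1 : Op X N) m n = if m = n then 1 else 0 := by
  ext1 v
  rw [kernel_apply, one_apply_eq_self]
  split_ifs with h
  · subst h; rw [lp.single_apply_self]; rfl
  · rw [lp.single_apply_ne _ _ _ h]; rfl

/-- All estimates on [Λ, U] are read off from this: the commutator only reweights the kernel by a
difference of values of the multiplier. -/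
theorem kernel_lie_mulOp (g : X → ℝ) (hg) (K : Op X N) (m n : X) :
    kernel ⁅(mulOp g hg : Op X N), K⁆ m n = ((g m - g n : ℝ) : ℂ) • kernel K m n := by
  rw [Ring.lie_def, kernel_sub, kernel_mulOp_mul, kernel_mul_mulOp, Complex.ofReal_sub]
  exact (sub_smul _ _ _).symm

theorem hasSum_kernel_mul (K L : Op X N) (m n : X) (v : Fiber N) :
    HasSum (fun x => kernel K m x (kernel L x n v)) (kernel (K * L) m n v) :=
  hasSum_kernel K (L (lp.single 2 n v)) m

/-! ### The `ℓ¹` norm -/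

/-- The `ℓ¹` norm of an element of `ℓ²(X) ⊗ ℂ^N`. -/
noncomputable def l1norm (φ : Hil X N) : ℝ≥0∞ := ∑' x, ‖φ x‖ₑ

theorem enorm_single (x : X) (v : Fiber N) : ‖(lp.single 2 x v : Hil X N)‖ₑ = ‖v‖ₑ := by
  have := lp.norm_single (E := fun _ : X => Fiber N) (p := 2) (by norm_num) x v
  rw [← ofReal_norm, this, ofReal_norm]

theorem enorm_le_l1norm (φ : Hil X N) : ‖φ‖ₑ ≤ l1norm φ := by
  calc ‖φ‖ₑ = ‖∑' x, (lp.single 2 x (φ x) : Hil X N)‖ₑ := by rw [(hasSum_single φ).tsum_eq]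
    _ ≤ ∑' x, ‖(lp.single 2 x (φ x) : Hil X N)‖ₑ := enorm_tsum_le_tsum_enorm
    _ = _ := by simp_rw [enorm_single]; rfl

theorem enorm_clm_apply_le (K : Fiber N →L[ℂ] Fiber N) (v : Fiber N) : ‖K v‖ₑ ≤ ‖K‖ₑ * ‖v‖ₑ :=
  K.le_opENorm v

theorem enorm_op_apply_le (K : Op X N) (φ : Hil X N) (m : X) :
    ‖K φ m‖ₑ ≤ ∑' n, ‖kernel K m n‖ₑ * ‖φ n‖ₑ := by
  rw [← (hasSum_kernel K φ m).tsum_eq]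
  exact enorm_tsum_le_tsum_enorm.trans (ENNReal.tsum_le_tsum fun n => enorm_clm_apply_le _ _)

/-- In ℓ¹ only column sums matter and the bound is linear in φ, so it can be summed over translates
of a switch function; an ℓ² bound would not be additive in this way. -/
theorem l1norm_op_apply_le (K : Op X N) (φ : Hil X N) :
    l1norm (K φ) ≤ ∑' n, (∑' m, ‖kernel K m n‖ₑ) * ‖φ n‖ₑ := by
  refine (ENNReal.tsum_le_tsum fun m => enorm_op_apply_le K φ m).trans ?_
  rw [ENNReal.tsum_comm]
  simp_rw [ENNReal.tsum_mul_right]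
  rfl

/-! ### The Schur test -/

theorem enorm_apply_le_of_schur (K : Op X N) (S : ℝ≥0∞) (hr : ∀ m, ∑' n, ‖kernel K m n‖ₑ ≤ S)
    (hc : ∀ n, ∑' m, ‖kernel K m n‖ₑ ≤ S) (φ : Hil X N) : ‖K φ‖ₑ ≤ S * ‖φ‖ₑ := by
  have h := schur_aux (kernel K) S hr hc φ
  rw [← mul_pow] at h
  refine (ENNReal.pow_le_pow_left_iff two_ne_zero).1 (le_trans ?_ h)
  rw [enorm_sq_eq_tsum]
  gcongr with m
  exact enorm_op_apply_le K φ m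

theorem norm_apply_le_of_schur (K : Op X N) {S : ℝ} (hS : 0 ≤ S)
    (hr : ∀ m, ∑' n, ‖kernel K m n‖ₑ ≤ ENNReal.ofReal S)
    (hc : ∀ n, ∑' m, ‖kernel K m n‖ₑ ≤ ENNReal.ofReal S) (φ : Hil X N) : ‖K φ‖ ≤ S * ‖φ‖ := by
  have h := enorm_apply_le_of_schur K _ hr hc φ
  rw [← ofReal_norm, ← ofReal_norm, ← ENNReal.ofReal_mul hS] at h
  exact (ENNReal.ofReal_le_ofReal_iff (by positivity)).1 h

/-- Needed to realise the commutator with the unbounded position operator as a bounded operator,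
given only its kernel. -/
theorem exists_op_of_schur (k : X → X → Fiber N →L[ℂ] Fiber N) {S : ℝ≥0∞} (hS : S ≠ ⊤)
    (hr : ∀ m, ∑' n, ‖k m n‖ₑ ≤ S) (hc : ∀ n, ∑' m, ‖k m n‖ₑ ≤ S) :
    ∃ K : Op X N, ∀ m n, kernel K m n = k m n := by
  have hfin : ∀ (φ : Hil X N) m, ∑' n, ‖k m n‖ₑ * ‖φ n‖ₑ ≠ ⊤ := fun φ m => by
    refine ne_top_of_le_ne_top (b := S * ‖φ‖ₑ) (ENNReal.mul_ne_top hS enorm_ne_top) ?_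
    calc _ ≤ ∑' n, ‖k m n‖ₑ * ‖φ‖ₑ := by gcongr with n; exact enorm_apply_le φ n
      _ ≤ _ := by rw [ENNReal.tsum_mul_right]; gcongr; exact hr m
  have hsum : ∀ (φ : Hil X N) m, Summable fun n => k m n (φ n) := fun φ m =>
    (summable_norm_iff_tsum_enorm_ne_top.2 (ne_top_of_le_ne_top (hfin φ m)
      (ENNReal.tsum_le_tsum fun n => enorm_clm_apply_le _ _))).of_norm
  have hle : ∀ (φ : Hil X N), ∑' m, ‖∑' n, k m n (φ n)‖ₑ ^ 2 ≤ S ^ 2 * ‖φ‖ₑ ^ 2 := fun φ => by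
    refine le_trans ?_ (schur_aux k S hr hc φ)
    gcongr with m
    exact enorm_tsum_le_tsum_enorm.trans (ENNReal.tsum_le_tsum fun n => enorm_clm_apply_le _ _)
  let L : Hil X N →ₗ[ℂ] Hil X N :=
    { toFun := fun φ => ⟨fun m => ∑' n, k m n (φ n), memℓp_two_of_tsum_ne_top
        (ne_top_of_le_ne_top (by finiteness) (hle φ))⟩
      map_add' := fun φ ψ => by
        apply lp.ext
        funext m
        change ∑' n, k m n (φ n + ψ n) = _
        simp_rw [map_add]
        exact (hsum φ m).tsum_add (hsum ψ m)
      map_smul' := fun c φ => by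
        apply lp.ext
        funext m
        change ∑' n, k m n (c • φ n) = _
        simp_rw [map_smul]
        exact (hsum φ m).tsum_const_smul c }
  refine ⟨L.mkContinuous S.toReal fun φ => ?_, fun m n => ?_⟩
  · have h : ‖L φ‖ₑ ≤ S * ‖φ‖ₑ := by
      refine (ENNReal.pow_le_pow_left_iff two_ne_zero).1 ?_
      rw [mul_pow, enorm_sq_eq_tsum]
      exact hle φ
    have := ENNReal.toReal_mono (by finiteness) h
    simpa using this
  · ext1 v
    rw [kernel_apply]
    change ∑' x, k m x ((lp.single 2 n v : Hil X N) x) = _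
    rw [tsum_eq_single n, lp.single_apply_self]
    intro y hy
    rw [lp.single_apply_ne _ _ _ hy, map_zero]

/-! ### A criterion for trace class operators -/

/-- Since |A| is self-adjoint with |A|² = A*A, both squared norms equal ⟨φ, A*A φ⟩. -/
theorem norm_absOp_apply {E : Type} [NormedAddCommGroup E] [InnerProductSpace ℂ E]
    [CompleteSpace E] (A : E →L[ℂ] E) (φ : E) : ‖absOp A φ‖ = ‖A φ‖ := by
  have hsa : IsSelfAdjoint (absOp A) := (CFC.abs_nonneg A).isSelfAdjoint
  have h : absOp A * absOp A = star A * A := CFC.abs_mul_abs A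
  have h2 : inner ℂ (absOp A φ) (absOp A φ) = inner ℂ (A φ) (A φ) := by
    rw [← ContinuousLinearMap.adjoint_inner_right, ← ContinuousLinearMap.adjoint_inner_right A,
      ← ContinuousLinearMap.star_eq_adjoint, ← ContinuousLinearMap.star_eq_adjoint, hsa.star_eq,
      ← mul_apply_eq_comp, h, mul_apply_eq_comp]
  rw [inner_self_eq_norm_sq_to_K, inner_self_eq_norm_sq_to_K] at h2
  have h3 : ‖absOp A φ‖ ^ 2 = ‖A φ‖ ^ 2 := by exact_mod_cast h2
  exact (pow_left_inj₀ (norm_nonneg _) (norm_nonneg _) two_ne_zero).1 h3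

theorem norm_basisVec (p : X × Fin N) : ‖(basisVec p : Hil X N)‖ = 1 := by
  rw [basisVec, lp.norm_single (by norm_num)]
  simp

/-- Cauchy–Schwarz and ‖|A| e‖ = ‖A e‖. The same hypothesis also makes the trace series absolutely
convergent. -/
theorem isTraceClass_of_summable_norm {A : Op X N}
    (h : Summable fun p : X × Fin N => ‖A (basisVec p)‖) : IsTraceClass A := by
  refine Summable.of_norm_bounded h fun p => ?_
  refine (norm_inner_le_norm _ _).trans ?_
  rw [norm_basisVec, one_mul, norm_absOp_apply]

theorem summable_trace {A : Op X N} (h : Summable fun p : X × Fin N => ‖A (basisVec p)‖) :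
    Summable fun p : X × Fin N => inner ℂ (basisVec p) (A (basisVec p)) := by
  refine Summable.of_norm_bounded h fun p => ?_
  refine (norm_inner_le_norm _ _).trans ?_
  rw [norm_basisVec, one_mul]

end

section

/-! ### Sums of translated switch functions -/

/-- A telescoping sum from the region where Λ = 0 to the region where Λ = 1; only finitely many
terms are nonzero. -/
theorem IsSwitch.hasSum_succ_sub {Λ : ℤ → ℝ} (h : IsSwitch Λ) :
    HasSum (fun s => Λ (s + 1) - Λ s) 1 := by
  obtain ⟨a, b, hb, ha⟩ := h
  -- Otherwise Λ(a) would be both 1 and 0.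
  have hab : a < b := by
    by_contra hle
    have h1 := hb a (by omega)
    rw [ha a le_rfl] at h1
    norm_num at h1
  obtain ⟨k, rfl⟩ : ∃ k : ℕ, b = a + k := ⟨(b - a).toNat, by omega⟩
  let e : ℕ ↪ ℤ := ⟨fun i => a + i, fun i j hij => by simpa using hij⟩
  have hs : HasSum (fun s => Λ (s + 1) - Λ s)
      (∑ s ∈ (Finset.range k).map e, (Λ (s + 1) - Λ s)) := by
    refine hasSum_sum_of_ne_finset_zero fun s hs => ?_
    by_cases h1 : a + k ≤ s
    · rw [hb s h1, hb (s + 1) (by omega), sub_self]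
    by_cases h2 : s + 1 ≤ a
    · rw [ha s (by omega), ha (s + 1) h2, sub_self]
    · exact absurd (Finset.mem_map.2 ⟨(s - a).toNat, Finset.mem_range.2 (by omega),
        show a + ((s - a).toNat : ℤ) = s by omega⟩) hs
  rw [Finset.sum_map] at hs
  have h2 := Finset.sum_range_sub (fun i : ℕ => Λ (a + i)) k
  have h3 : ∑ x ∈ Finset.range k, (Λ (e x + 1) - Λ (e x)) = 1 := by
    simp only [Nat.cast_zero, add_zero, hb _ le_rfl, ha _ le_rfl, sub_zero] at h2
    rw [← h2]
    refine Finset.sum_congr rfl fun i _ => ?_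
    change Λ (a + i + 1) - Λ (a + i) = _
    push_cast
    rw [add_assoc]
  rwa [h3] at hs

/-- Each unit step contributes one telescoping sum, equal to 1. The result does not depend on Λ, and
this is how a switch function becomes a coordinate. -/
theorem IsSwitch.hasSum_sub {Λ : ℤ → ℝ} (h : IsSwitch Λ) (m n : ℤ) :
    HasSum (fun s => Λ (m + s) - Λ (n + s)) ((m - n : ℤ) : ℝ) := by
  have key : ∀ (j : ℕ) (n : ℤ), HasSum (fun s => Λ (n + j + s) - Λ (n + s)) (j : ℝ) := by
    intro j n
    induction j with
    | zero => simp
    | succ j ih =>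
      have h1 := ((Equiv.addLeft (n + j)).hasSum_iff).2 h.hasSum_succ_sub
      have h2 := h1.add ih
      rw [add_comm (1 : ℝ)] at h2
      push_cast
      refine h2.congr_fun fun s => ?_
      simp only [Function.comp_apply, Equiv.coe_addLeft]
      rw [show n + (j + 1 : ℤ) + s = n + j + s + 1 by ring]
      ring
  rcases le_total n m with hle | hle
  · obtain ⟨j, rfl⟩ : ∃ j : ℕ, m = n + j := ⟨(m - n).toNat, by omega⟩
    simpa using key j n
  · obtain ⟨j, rfl⟩ : ∃ j : ℕ, n = m + j := ⟨(n - m).toNat, by omega⟩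
    simpa using (key j m).neg

/-- The constant is the total variation of Λ, and the triangle inequality over unit steps gives
linear growth. This is the absolute-convergence companion of `IsSwitch.hasSum_sub`. -/
theorem IsSwitch.exists_tsum_enorm_le {Λ : ℤ → ℝ} (h : IsSwitch Λ) :
    ∃ C : ℝ≥0∞, C ≠ ⊤ ∧ ∀ m n : ℤ,
      ∑' s, ‖Λ (m + s) - Λ (n + s)‖ₑ ≤ C * ‖((m - n : ℤ) : ℝ)‖ₑ := by
  refine ⟨∑' s, ‖Λ (s + 1) - Λ s‖ₑ,
    summable_norm_iff_tsum_enorm_ne_top.1 h.hasSum_succ_sub.summable.norm, ?_⟩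
  set C := ∑' s, ‖Λ (s + 1) - Λ s‖ₑ with hC
  have key : ∀ (j : ℕ) (n : ℤ), ∑' s, ‖Λ (n + j + s) - Λ (n + s)‖ₑ ≤ C * (j : ℝ≥0∞) := by
    intro j n
    induction j with
    | zero => simp
    | succ j ih =>
      have h1 : ∑' s, ‖Λ (n + j + s + 1) - Λ (n + j + s)‖ₑ = C :=
        (Equiv.addLeft (n + j)).tsum_eq (fun s => ‖Λ (s + 1) - Λ s‖ₑ)
      calc _ ≤ ∑' s, (‖Λ (n + j + s + 1) - Λ (n + j + s)‖ₑ + ‖Λ (n + j + s) - Λ (n + s)‖ₑ) := by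
            refine ENNReal.tsum_le_tsum fun s => ?_
            refine le_trans (le_of_eq ?_) (enorm_add_le _ _)
            push_cast
            rw [show n + (j + 1 : ℤ) + s = n + j + s + 1 by ring, sub_add_sub_cancel]
        _ ≤ C + C * j := by rw [ENNReal.tsum_add, h1]; gcongr
        _ = _ := by push_cast; ring
  intro m n
  rcases le_total n m with hle | hle
  · obtain ⟨j, rfl⟩ : ∃ j : ℕ, m = n + j := ⟨(m - n).toNat, by omega⟩
    refine (key j n).trans (le_of_eq ?_)
    simp
  · obtain ⟨j, rfl⟩ : ∃ j : ℕ, n = m + j := ⟨(n - m).toNat, by omega⟩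
    simp_rw [enorm_sub_rev (Λ (m + _))]
    refine (key j m).trans (le_of_eq ?_)
    simp

/-! ### Commutators with translated switch functions -/

variable {X : Type} {N : ℕ}

/-- Multiplication by the switch function `Λ` of the coordinate `c`, translated by `-s`. -/
noncomputable def switchAt (c : X → ℤ) (Λ : ℤ → ℝ) (h : IsSwitch Λ) (s : ℤ) : Op X N :=
  mulOp (fun x => Λ (c x + s)) ⟨h.bounded.choose, fun x => h.bounded.choose_spec (c x + s)⟩

variable [DecidableEq X]

/-- The sum over `m` of `|c m - c x| ‖V_{m,x}‖`. -/
noncomputable def dispNorm (c : X → ℤ) (V : Op X N) (x : X) : ℝ≥0∞ :=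
  ∑' m, ‖((c m - c x : ℤ) : ℝ)‖ₑ * ‖kernel V m x‖ₑ

theorem kernel_lie_switchAt (c : X → ℤ) {Λ : ℤ → ℝ} (h : IsSwitch Λ) (s : ℤ) (V : Op X N)
    (m n : X) : kernel ⁅(switchAt c Λ h s : Op X N), V⁆ m n =
      ((Λ (c m + s) - Λ (c n + s) : ℝ) : ℂ) • kernel V m n :=
  kernel_lie_mulOp _ _ V m n

theorem enorm_ofReal_smul {E : Type*} [NormedAddCommGroup E] [NormedSpace ℂ E] (r : ℝ) (v : E) :
    ‖(r : ℂ) • v‖ₑ = ‖r‖ₑ * ‖v‖ₑ := by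
  rw [enorm_smul]
  congr 1
  simp [enorm_eq_nnnorm]

/-- Tonelli moves the sum over translates inside, where the total variation of Λ converts it into
the displacement |c m − c x|. The constant depends on Λ only, which permits iteration for products
of commutators. -/
theorem exists_tsum_l1norm_lie_le (c : X → ℤ) {Λ : ℤ → ℝ} (h : IsSwitch Λ) :
    ∃ C : ℝ≥0∞, C ≠ ⊤ ∧ ∀ (V : Op X N) (φ : Hil X N),
      ∑' s, l1norm (⁅(switchAt c Λ h s : Op X N), V⁆ φ) ≤
        C * ∑' x, dispNorm c V x * ‖φ x‖ₑ := by
  obtain ⟨C, hC, hle⟩ := h.exists_tsum_enorm_le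
  refine ⟨C, hC, fun V φ => ?_⟩
  calc _ ≤ ∑' s, ∑' x, (∑' m, ‖Λ (c m + s) - Λ (c x + s)‖ₑ * ‖kernel V m x‖ₑ) * ‖φ x‖ₑ := by
        gcongr with s
        refine (l1norm_op_apply_le _ _).trans (le_of_eq ?_)
        refine tsum_congr fun x => congrArg (· * ‖φ x‖ₑ) (tsum_congr fun m => ?_)
        rw [kernel_lie_switchAt]
        exact enorm_ofReal_smul (E := Fiber N →L[ℂ] Fiber N) _ _
    _ = ∑' x, (∑' m, (∑' s, ‖Λ (c m + s) - Λ (c x + s)‖ₑ) * ‖kernel V m x‖ₑ) * ‖φ x‖ₑ := by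
        rw [ENNReal.tsum_comm]
        refine tsum_congr fun x => ?_
        rw [ENNReal.tsum_mul_right, ENNReal.tsum_comm]
        simp_rw [ENNReal.tsum_mul_right]
    _ ≤ ∑' x, (∑' m, (C * ‖((c m - c x : ℤ) : ℝ)‖ₑ) * ‖kernel V m x‖ₑ) * ‖φ x‖ₑ := by
        gcongr with x m
        exact hle _ _
    _ = _ := by
        simp_rw [mul_assoc C, ENNReal.tsum_mul_left, mul_assoc]
        rw [ENNReal.tsum_mul_left]
        rfl

theorem tsum_ne_top_comm_aux (c : X → ℤ) (V : Op X N) (φ : Hil X N)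
    (hφ : ∑' x, dispNorm c V x * ‖φ x‖ₑ ≠ ⊤) (m : X) :
    ∑' x, ‖((c m - c x : ℤ) : ℝ)‖ₑ * (‖kernel V m x‖ₑ * ‖φ x‖ₑ) ≠ ⊤ := by
  refine ne_top_of_le_ne_top hφ (ENNReal.tsum_le_tsum fun x => ?_)
  rw [← mul_assoc]
  gcongr
  exact ENNReal.le_tsum (f := fun m => ‖((c m - c x : ℤ) : ℝ)‖ₑ * ‖kernel V m x‖ₑ) m

theorem summable_norm_lie_switchAt (c : X → ℤ) {Λ : ℤ → ℝ} (h : IsSwitch Λ) (V : Op X N)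
    (φ : Hil X N) (hφ : ∑' x, dispNorm c V x * ‖φ x‖ₑ ≠ ⊤) :
    Summable fun s => ‖⁅(switchAt c Λ h s : Op X N), V⁆ φ‖ := by
  obtain ⟨C, hC, hle⟩ := exists_tsum_l1norm_lie_le (N := N) c h
  exact summable_norm_iff_tsum_enorm_ne_top.2 (ne_top_of_le_ne_top (ENNReal.mul_ne_top hC hφ)
    ((ENNReal.tsum_le_tsum fun s => enorm_le_l1norm _).trans (hle V φ)))

/-- Fubini: the double family over translates and sites is absolutely summable, and summing over
translates first leaves the factor c m − c x. -/
theorem tsum_lie_switchAt_apply (c : X → ℤ) {Λ : ℤ → ℝ} (h : IsSwitch Λ) (V : Op X N)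
    (φ : Hil X N) (hφ : ∑' x, dispNorm c V x * ‖φ x‖ₑ ≠ ⊤) (m : X) :
    (∑' s, ⁅(switchAt c Λ h s : Op X N), V⁆ φ : Hil X N) m =
      ∑' x, (((c m - c x : ℤ) : ℝ) : ℂ) • kernel V m x (φ x) := by
  obtain ⟨C, hC, hle⟩ := h.exists_tsum_enorm_le
  have hs := (summable_norm_lie_switchAt c h V φ hφ).of_norm.hasSum
  have h1 := hs.mapL (lp.evalCLM ℂ (fun _ : X => Fiber N) 2 m)
  refine HasSum.unique (f := fun s => (⁅(switchAt c Λ h s : Op X N), V⁆ φ) m) h1 ?_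
  have h2 : ∀ s, (⁅(switchAt c Λ h s : Op X N), V⁆ φ) m =
      ∑' x, ((Λ (c m + s) - Λ (c x + s) : ℝ) : ℂ) • kernel V m x (φ x) := fun s => by
    rw [← (hasSum_kernel _ φ m).tsum_eq]
    refine tsum_congr fun x => ?_
    rw [kernel_lie_switchAt]
    rfl
  have hsum : Summable fun p : ℤ × X =>
      ((Λ (c m + p.1) - Λ (c p.2 + p.1) : ℝ) : ℂ) • kernel V m p.2 (φ p.2) := by
    refine (summable_norm_iff_tsum_enorm_ne_top.2 ?_).of_norm
    rw [ENNReal.tsum_prod (f := fun s x =>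
      ‖((Λ (c m + s) - Λ (c x + s) : ℝ) : ℂ) • kernel V m x (φ x)‖ₑ), ENNReal.tsum_comm]
    refine ne_top_of_le_ne_top (ENNReal.mul_ne_top hC (tsum_ne_top_comm_aux c V φ hφ m)) ?_
    rw [← ENNReal.tsum_mul_left]
    refine ENNReal.tsum_le_tsum fun x => ?_
    simp_rw [enorm_ofReal_smul, ENNReal.tsum_mul_right, ← mul_assoc C]
    gcongr
    · exact hle _ _
    · exact enorm_clm_apply_le _ _
  have h3 : HasSum (fun s => ∑' x, ((Λ (c m + s) - Λ (c x + s) : ℝ) : ℂ) • kernel V m x (φ x))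
      (∑' p : ℤ × X, ((Λ (c m + p.1) - Λ (c p.2 + p.1) : ℝ) : ℂ) • kernel V m p.2 (φ p.2)) :=
    hsum.hasSum.prod_fiberwise fun s => (hsum.prod_factor s).hasSum
  simp_rw [h2]
  convert h3
  refine Eq.trans ?_ ((Summable.tsum_comm (f := fun (x : X) (s : ℤ) =>
    ((Λ (c m + s) - Λ (c x + s) : ℝ) : ℂ) • kernel V m x (φ x)) hsum.prod_symm).symm.trans
      hsum.tsum_prod.symm)
  refine tsum_congr fun x => ?_
  exact (((Complex.hasSum_ofReal).2 (h.hasSum_sub (c m) (c x))).smul_const _).tsum_eq.symm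

theorem hasSum_lie_switchAt (c : X → ℤ) {Λ : ℤ → ℝ} (h : IsSwitch Λ) (V : Op X N)
    (φ ψ : Hil X N) (hφ : ∑' x, dispNorm c V x * ‖φ x‖ₑ ≠ ⊤)
    (hψ : ∀ m, ψ m = ∑' x, (((c m - c x : ℤ) : ℝ) : ℂ) • kernel V m x (φ x)) :
    HasSum (fun s => ⁅(switchAt c Λ h s : Op X N), V⁆ φ) ψ := by
  convert (summable_norm_lie_switchAt c h V φ hφ).of_norm.hasSum
  apply lp.ext
  funext m
  rw [hψ, tsum_lie_switchAt_apply c h V φ hφ]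

/-! ### Translations -/

/-- The unitary `ψ ↦ ψ ∘ σ` for a permutation `σ` of the sites. -/
noncomputable def shiftOp (σ : X ≃ X) : Op X N := truncation σ.toEmbedding

theorem shiftOp_single (σ : X ≃ X) (x : X) (v : Fiber N) :
    shiftOp σ (lp.single 2 (σ x) v : Hil X N) = lp.single 2 x v := by
  apply lp.ext
  funext y
  change (lp.single 2 (σ x) v : Hil X N) (σ y) = _
  by_cases h : y = x
  · subst h; rw [lp.single_apply_self, lp.single_apply_self]
  · rw [lp.single_apply_ne _ _ _ h, lp.single_apply_ne _ _ _ (σ.injective.ne h)]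

theorem norm_shiftOp (σ : X ≃ X) (φ : Hil X N) : ‖shiftOp σ φ‖ = ‖φ‖ := by
  have h : ‖shiftOp σ φ‖ₑ ^ 2 = ‖φ‖ₑ ^ 2 := by
    rw [enorm_sq_eq_tsum, enorm_sq_eq_tsum]
    exact σ.tsum_eq (fun x => ‖φ x‖ₑ ^ 2)
  have h2 : ‖shiftOp σ φ‖ₑ = ‖φ‖ₑ := by
    refine le_antisymm ?_ ?_ <;> refine (ENNReal.pow_le_pow_left_iff two_ne_zero).1 ?_
    exacts [h.le, h.ge]
  simpa [← toReal_enorm] using congrArg ENNReal.toReal h2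

theorem inner_shiftOp (σ : X ≃ X) (φ ψ : Hil X N) :
    inner ℂ (shiftOp σ φ) (shiftOp σ ψ) = inner ℂ φ ψ := by
  rw [lp.inner_eq_tsum, lp.inner_eq_tsum]
  exact σ.tsum_eq (fun x => inner ℂ (φ x) (ψ x))

theorem shiftOp_symm_shiftOp (σ : X ≃ X) (φ : Hil X N) : shiftOp σ.symm (shiftOp σ φ) = φ := by
  apply lp.ext
  funext x
  change φ (σ (σ.symm x)) = φ x
  rw [Equiv.apply_symm_apply]

theorem kernel_shiftOp_conj (σ : X ≃ X) (K : Op X N) (m n : X) :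
    kernel (shiftOp σ.symm * K * shiftOp σ) (σ m) (σ n) = kernel K m n := by
  ext1 v
  rw [kernel_apply, kernel_apply, mul_apply_eq_comp, mul_apply_eq_comp, shiftOp_single]
  change (K (lp.single 2 n v)) (σ.symm (σ m)) = _
  rw [Equiv.symm_apply_apply]

/-- The kernel of `K` is invariant under the permutation `σ`. -/
def IsInvariant (σ : X ≃ X) (K : Op X N) : Prop := ∀ m n, kernel K (σ m) (σ n) = kernel K m n

/-- Conjugation by the permutation relabels the kernel, and an operator is determined by its kernel.
-/
theorem IsInvariant.shiftOp_comm {σ : X ≃ X} {K : Op X N} (h : IsInvariant σ K) (φ : Hil X N) :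
    K (shiftOp σ φ) = shiftOp σ (K φ) := by
  have h1 : shiftOp σ.symm * K * shiftOp σ = K := by
    refine op_ext_kernel fun m n => ?_
    rw [← σ.apply_symm_apply m, ← σ.apply_symm_apply n, kernel_shiftOp_conj, h]
  have h2 := congrArg (fun L : Op X N => shiftOp σ (L φ)) h1
  simp only [mul_apply_eq_comp] at h2
  rw [← h2]
  exact (shiftOp_symm_shiftOp σ.symm _).symm

theorem isInvariant_of_shiftOp_comm {σ : X ≃ X} {K : Op X N}
    (h : ∀ φ, K (shiftOp σ φ) = shiftOp σ (K φ)) : IsInvariant σ K := by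
  intro m n
  rw [← kernel_shiftOp_conj σ K m n]
  congr 1
  ext1 φ
  rw [mul_apply_eq_comp, mul_apply_eq_comp, h, shiftOp_symm_shiftOp]

theorem IsInvariant.mul {σ : X ≃ X} {K L : Op X N} (hK : IsInvariant σ K) (hL : IsInvariant σ L) :
    IsInvariant σ (K * L) :=
  isInvariant_of_shiftOp_comm fun φ => by
    rw [mul_apply_eq_comp, mul_apply_eq_comp, hL.shiftOp_comm, hK.shiftOp_comm]

theorem IsInvariant.star {σ : X ≃ X} {K : Op X N} (hK : IsInvariant σ K) :
    IsInvariant σ (star K) := fun m n => by rw [kernel_star, kernel_star, hK]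

theorem switchAt_shiftOp {c : X → ℤ} {Λ : ℤ → ℝ} (h : IsSwitch Λ) {σ : X ≃ X} {j : ℤ}
    (hσ : ∀ x, c (σ x) = c x - j) (s : ℤ) (φ : Hil X N) :
    switchAt c Λ h s (shiftOp σ φ) = shiftOp σ (switchAt c Λ h (s + j) φ) := by
  apply lp.ext
  funext x
  change (Λ (c x + s) : ℂ) • φ (σ x) = (Λ (c (σ x) + (s + j)) : ℂ) • φ (σ x)
  rw [hσ, show c x - j + (s + j) = c x + s by ring]

/-- A translation pulled through the commutator is absorbed by the switch function alone, because V
is invariant. This trades a sum over sites for a sum over translates of Λ. -/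
theorem lie_switchAt_shiftOp {c : X → ℤ} {Λ : ℤ → ℝ} (h : IsSwitch Λ) {σ : X ≃ X} {j : ℤ}
    (hσ : ∀ x, c (σ x) = c x - j) (s : ℤ) {V : Op X N} (hV : IsInvariant σ V) (φ : Hil X N) :
    ⁅(switchAt c Λ h s : Op X N), V⁆ (shiftOp σ φ) =
      shiftOp σ (⁅(switchAt c Λ h (s + j) : Op X N), V⁆ φ) := by
  rw [Ring.lie_def, Ring.lie_def, sub_apply, sub_apply,
    mul_apply_eq_comp, mul_apply_eq_comp, mul_apply_eq_comp, mul_apply_eq_comp, map_sub,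
    hV.shiftOp_comm, switchAt_shiftOp h hσ, switchAt_shiftOp h hσ, hV.shiftOp_comm]

end

section

/-! ### Exponential sums over the lattice -/

theorem summable_exp_neg_mul_abs_int {a : ℝ} (ha : 0 < a) :
    Summable fun j : ℤ => Real.exp (-a * |(j : ℝ)|) := by
  have h : Summable fun n : ℕ => Real.exp (-a) ^ n :=
    summable_geometric_of_lt_one (Real.exp_nonneg _) (Real.exp_lt_one_iff.2 (by linarith))
  have h2 : (fun n : ℕ => Real.exp (-a * |((n : ℤ) : ℝ)|)) = fun n : ℕ => Real.exp (-a) ^ n := by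
    funext n
    rw [← Real.exp_nat_mul, Int.cast_natCast, Nat.abs_cast, mul_comm]
  have h3 : Summable fun n : ℕ => Real.exp (-a * |((n : ℤ) : ℝ)|) := h2 ▸ h
  exact Summable.of_nat_of_neg h3 (h3.congr fun n => by simp)

/-- The `ℓ¹` distance on `ℤ²`. -/
def dist1 (m n : ℤ × ℤ) : ℝ := |(m.1 : ℝ) - (n.1 : ℝ)| + |(m.2 : ℝ) - (n.2 : ℝ)|

theorem dist1_nonneg (m n : ℤ × ℤ) : 0 ≤ dist1 m n := by unfold dist1; positivity

theorem dist1_comm (m n : ℤ × ℤ) : dist1 m n = dist1 n m := by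
  unfold dist1; rw [abs_sub_comm, abs_sub_comm (m.2 : ℝ)]

theorem dist1_self (m : ℤ × ℤ) : dist1 m m = 0 := by simp [dist1]

theorem dist1_triangle (m x n : ℤ × ℤ) : dist1 m n ≤ dist1 m x + dist1 x n := by
  unfold dist1
  have h1 := abs_sub_le (m.1 : ℝ) x.1 n.1
  have h2 := abs_sub_le (m.2 : ℝ) x.2 n.2
  linarith

/-- The sum of `exp (-a |n|)` over `ℤ²`. -/
noncomputable def expSum (a : ℝ) : ℝ := ∑' n : ℤ × ℤ, Real.exp (-a * dist1 n 0)

theorem summable_exp_dist1 {a : ℝ} (ha : 0 < a) :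
    Summable fun n : ℤ × ℤ => Real.exp (-a * dist1 n 0) := by
  have h := (summable_exp_neg_mul_abs_int ha).mul_of_nonneg (summable_exp_neg_mul_abs_int ha)
    (fun _ => Real.exp_nonneg _) (fun _ => Real.exp_nonneg _)
  refine h.congr fun n => ?_
  rw [← Real.exp_add]
  simp [dist1, mul_add]

theorem expSum_nonneg (a : ℝ) : 0 ≤ expSum a := tsum_nonneg fun _ => Real.exp_nonneg _

theorem tsum_exp_dist1 {a : ℝ} (ha : 0 < a) (x : ℤ × ℤ) :
    ∑' y : ℤ × ℤ, ENNReal.ofReal (Real.exp (-a * dist1 y x)) = ENNReal.ofReal (expSum a) := by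
  rw [expSum, ENNReal.ofReal_tsum_of_nonneg (fun _ => Real.exp_nonneg _) (summable_exp_dist1 ha),
    ← (Equiv.subRight x).tsum_eq fun y => ENNReal.ofReal (Real.exp (-a * dist1 y 0))]
  refine tsum_congr fun y => ?_
  simp [dist1]

theorem tsum_exp_dist1_le {X : Type} {e : X → ℤ × ℤ} (he : Function.Injective e) {a : ℝ}
    (ha : 0 < a) (x : ℤ × ℤ) :
    ∑' y, ENNReal.ofReal (Real.exp (-a * dist1 (e y) x)) ≤ ENNReal.ofReal (expSum a) := by
  rw [← tsum_exp_dist1 ha x]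
  exact ENNReal.tsum_comp_le_tsum_of_injective he
    (fun y => ENNReal.ofReal (Real.exp (-a * dist1 y x)))

/-! ### A Grönwall inequality with finitely many exceptional times -/

/-- From e^y − 1 ≤ y e^y; the resulting form has no division by K and behaves well when time
intervals are concatenated. -/
theorem gronwallBound_le {δ K ε x : ℝ} (hK : 0 ≤ K) (hε : 0 ≤ ε) :
    gronwallBound δ K ε x ≤ (δ + ε * x) * Real.exp (K * x) := by
  rcases hK.eq_or_lt with rfl | hK
  · simp [gronwallBound_K0]
  rw [gronwallBound_of_K_ne_0 hK.ne', add_mul]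
  have h1 : Real.exp (K * x) - 1 ≤ K * x * Real.exp (K * x) := by
    have h2 := Real.add_one_le_exp (-(K * x))
    have h3 : Real.exp (-(K * x)) * Real.exp (K * x) = 1 := by rw [← Real.exp_add]; simp
    nlinarith [Real.exp_pos (K * x)]
  have h4 : ε / K * (Real.exp (K * x) - 1) ≤ ε / K * (K * x * Real.exp (K * x)) :=
    mul_le_mul_of_nonneg_left h1 (by positivity)
  have h5 : ε / K * (K * x * Real.exp (K * x)) = ε * x * Real.exp (K * x) := by
    field_simp
  linarith

section Gronwall

variable {E : Type*} [NormedAddCommGroup E] [NormedSpace ℝ E] {f f' : ℝ → E} {K ε : ℝ}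

/-- The derivative is not available at the left endpoint, so Grönwall is started at c > a and c
tends to a by continuity of f. -/
theorem norm_le_of_norm_deriv_le_Ioo (hK : 0 ≤ K) (hε : 0 ≤ ε) {a b : ℝ} (hab : a ≤ b)
    (hf : ContinuousOn f (Set.Icc a b)) (hd : ∀ t ∈ Set.Ioo a b, HasDerivAt f (f' t) t)
    (hb : ∀ t ∈ Set.Ioo a b, ‖f' t‖ ≤ K * ‖f t‖ + ε) :
    ‖f b‖ ≤ (‖f a‖ + ε * (b - a)) * Real.exp (K * (b - a)) := by
  rcases hab.eq_or_lt with rfl | hab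
  · simp
  have h1 : ∀ c ∈ Set.Ioo a b, ‖f b‖ ≤ (‖f c‖ + ε * (b - c)) * Real.exp (K * (b - c)) := by
    intro c hc
    have hsub : Set.Ico c b ⊆ Set.Ioo a b := fun x hx => ⟨hc.1.trans_le hx.1, hx.2⟩
    exact (norm_le_gronwallBound_of_norm_deriv_right_le
      (hf.mono (Set.Icc_subset_Icc_left hc.1.le))
      (fun x hx => (hd x (hsub hx)).hasDerivWithinAt) le_rfl (fun x hx => hb x (hsub hx)) b
      ⟨hc.2.le, le_rfl⟩).trans (gronwallBound_le hK hε)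
  have h2 : Filter.Tendsto (fun c => (‖f c‖ + ε * (b - c)) * Real.exp (K * (b - c))) (𝓝[>] a)
      (𝓝 ((‖f a‖ + ε * (b - a)) * Real.exp (K * (b - a)))) := by
    have hfa : Filter.Tendsto f (𝓝[>] a) (𝓝 (f a)) :=
      (hf a ⟨le_rfl, hab.le⟩).mono_left ((nhdsWithin_mono a Set.Ioo_subset_Icc_self).trans'
        (nhdsWithin_Ioo_eq_nhdsGT hab).ge)
    have hc : ∀ g : ℝ → ℝ, Continuous g → Filter.Tendsto g (𝓝[>] a) (𝓝 (g a)) := fun g hg =>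
      hg.continuousAt.tendsto.mono_left nhdsWithin_le_nhds
    exact (hfa.norm.add (hc (fun c => ε * (b - c)) (by fun_prop))).mul
      (hc (fun c => Real.exp (K * (b - c))) (by fun_prop))
  refine ge_of_tendsto h2 ?_
  filter_upwards [Ioo_mem_nhdsGT hab] with c hc using h1 c hc

/-- Strong induction on the number of exceptional times inside the interval: cut at one of them and
concatenate the two bounds, using continuity of f across the cut. -/
theorem norm_le_of_norm_deriv_le_off_finite (hK : 0 ≤ K) (hε : 0 ≤ ε) {S : Set ℝ}
    (hS : ∀ a b : ℝ, (S ∩ Set.Icc a b).Finite) {a b : ℝ} (hab : a ≤ b)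
    (hf : ContinuousOn f (Set.Icc a b)) (hd : ∀ t ∈ Set.Ioo a b, t ∉ S → HasDerivAt f (f' t) t)
    (hb : ∀ t ∈ Set.Ioo a b, t ∉ S → ‖f' t‖ ≤ K * ‖f t‖ + ε) :
    ‖f b‖ ≤ (‖f a‖ + ε * (b - a)) * Real.exp (K * (b - a)) := by
  have hfin : ∀ a b : ℝ, (S ∩ Set.Ioo a b).Finite := fun a b =>
    (hS a b).subset (Set.inter_subset_inter_right S Set.Ioo_subset_Icc_self)
  induction hn : (S ∩ Set.Ioo a b).ncard using Nat.strong_induction_on generalizing a b with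
  | _ n ih =>
    by_cases hne : (S ∩ Set.Ioo a b).Nonempty
    · obtain ⟨c, hcS, hc⟩ := hne
      have hac : Set.Ioo a c ⊆ Set.Ioo a b := Set.Ioo_subset_Ioo_right hc.2.le
      have hcb : Set.Ioo c b ⊆ Set.Ioo a b := Set.Ioo_subset_Ioo_left hc.1.le
      have h1 := ih _ (hn ▸ Set.ncard_lt_ncard ⟨Set.inter_subset_inter_right S hac,
        fun h => (lt_irrefl c (h ⟨hcS, hc⟩).2.2)⟩ (hfin a b)) hc.1.le
        (hf.mono (Set.Icc_subset_Icc_right hc.2.le)) (fun t ht => hd t (hac ht))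
        (fun t ht => hb t (hac ht)) rfl
      have h2 := ih _ (hn ▸ Set.ncard_lt_ncard ⟨Set.inter_subset_inter_right S hcb,
        fun h => (lt_irrefl c (h ⟨hcS, hc⟩).2.1)⟩ (hfin a b)) hc.2.le
        (hf.mono (Set.Icc_subset_Icc_left hc.1.le)) (fun t ht => hd t (hcb ht))
        (fun t ht => hb t (hcb ht)) rfl
      -- Enlarging the second source term by this factor lets both exponentials be pulled out
      -- together.
      have h3 : 1 ≤ Real.exp (K * (c - a)) :=
        Real.one_le_exp (mul_nonneg hK (sub_nonneg.2 hc.1.le))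
      have h4 : 0 ≤ ε * (b - c) := mul_nonneg hε (sub_nonneg.2 hc.2.le)
      calc ‖f b‖ ≤ (‖f c‖ + ε * (b - c)) * Real.exp (K * (b - c)) := h2
        _ ≤ ((‖f a‖ + ε * (c - a)) * Real.exp (K * (c - a)) +
              ε * (b - c) * Real.exp (K * (c - a))) * Real.exp (K * (b - c)) := by
            refine mul_le_mul_of_nonneg_right ?_ (Real.exp_nonneg _)
            exact add_le_add h1 (le_mul_of_one_le_right h4 h3)
        _ = (‖f a‖ + ε * (b - a)) * (Real.exp (K * (c - a)) * Real.exp (K * (b - c))) := by ring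
        _ = _ := by rw [← Real.exp_add]; ring_nf
    · have hnot : ∀ t ∈ Set.Ioo a b, t ∉ S := fun t ht hS => hne ⟨t, hS, ht⟩
      exact norm_le_of_norm_deriv_le_Ioo hK hε hab hf (fun t ht => hd t ht (hnot t ht))
        (fun t ht => hb t ht (hnot t ht))

end Gronwall

/-! ### Exponentially weighted estimates -/

variable {X : Type} {N : ℕ} [DecidableEq X]

/-- `H` is uniformly exponentially local with respect to the positions `e`, and strongly
continuous outside of the locally finite set `S` of times. -/
structure IsLocalHamiltonian (e : X → ℤ × ℤ) (H : ℝ → Op X N) (μ C : ℝ) (S : Set ℝ) : Prop where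
  inj : Function.Injective e
  rate_pos : 0 < μ
  const_nonneg : 0 ≤ C
  bound : ∀ t m n, ‖kernel (H t) m n‖ ≤ C * Real.exp (-μ * dist1 (e m) (e n))
  finite : ∀ a b : ℝ, (S ∩ Set.Icc a b).Finite
  continuousAt : ∀ t ∉ S, StronglyContinuousAt H t

/-- Multiplication by `exp w` for a bounded weight `w`. -/
noncomputable def expOp (w : X → ℝ) {M : ℝ} (hw : ∀ x, |w x| ≤ M) : Op X N :=
  mulOp (fun x => Real.exp (w x)) ⟨Real.exp M, fun x => by
    rw [abs_of_pos (Real.exp_pos _)]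
    exact Real.exp_le_exp.2 ((le_abs_self _).trans (hw x))⟩

theorem expOp_neg_expOp (w : X → ℝ) {M : ℝ} (hw : ∀ x, |w x| ≤ M) (hw' : ∀ x, |-w x| ≤ M)
    (φ : Hil X N) : expOp (fun x => -w x) hw' (expOp w hw φ) = φ := by
  apply lp.ext
  funext x
  change (Real.exp (-w x) : ℂ) • (Real.exp (w x) : ℂ) • φ x = φ x
  rw [smul_smul, ← Complex.ofReal_mul, ← Real.exp_add]
  simp

/-- The growth constant of the weighted norms. -/
noncomputable def growth (μ C : ℝ) : ℝ := C * expSum (μ / 2)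

/-- The conjugated operator e^w K e^{−w} still decays at rate μ/2, since the weight grows at most at
that rate, and the Schur test applies. The constant does not involve the bound M on the weight, so M
may depend on the sites under study. -/
theorem norm_expOp_apply_le {e : X → ℤ × ℤ} (he : Function.Injective e) {μ C : ℝ} (hμ : 0 < μ)
    (hC : 0 ≤ C) {K : Op X N}
    (hK : ∀ m n, ‖kernel K m n‖ ≤ C * Real.exp (-μ * dist1 (e m) (e n))) {w : X → ℝ} {M : ℝ}
    (hw : ∀ x, |w x| ≤ M) (hlip : ∀ m n, w m - w n ≤ μ / 2 * dist1 (e m) (e n)) (φ : Hil X N) :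
    ‖expOp w hw (K φ)‖ ≤ growth μ C * ‖expOp w hw φ‖ := by
  have hw' : ∀ x, |-w x| ≤ M := fun x => (abs_neg (w x)).trans_le (hw x)
  have hb : ∀ m n, ‖kernel (expOp w hw * (K * expOp (fun x => -w x) hw')) m n‖ₑ ≤
      ENNReal.ofReal C * ENNReal.ofReal (Real.exp (-(μ / 2) * dist1 (e m) (e n))) := by
    intro m n
    rw [expOp, expOp, kernel_mulOp_mul, kernel_mul_mulOp, ← ENNReal.ofReal_mul hC,
      ← ofReal_norm]
    refine ENNReal.ofReal_le_ofReal ?_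
    have hsm : ∀ (c : ℂ) (A : Fiber N →L[ℂ] Fiber N), ‖c • A‖ = ‖c‖ * ‖A‖ := fun c A =>
      norm_smul c A
    rw [hsm, hsm, Complex.norm_real, Complex.norm_real, Real.norm_eq_abs, Real.norm_eq_abs,
      Real.abs_exp,
      Real.abs_exp]
    calc _ ≤ Real.exp (w m) * (Real.exp (-w n) *
          (C * Real.exp (-μ * dist1 (e m) (e n)))) := by gcongr; exact hK m n
      _ = C * Real.exp (w m - w n + -μ * dist1 (e m) (e n)) := by
        rw [Real.exp_add, Real.exp_sub, Real.exp_neg]; field_simp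
      _ ≤ _ := by
        gcongr
        linarith [hlip m n]
  have hrow : ∀ m, ∑' n, ENNReal.ofReal C * ENNReal.ofReal
      (Real.exp (-(μ / 2) * dist1 (e m) (e n))) ≤ ENNReal.ofReal (growth μ C) := fun m => by
    rw [ENNReal.tsum_mul_left, growth, ENNReal.ofReal_mul hC]
    gcongr
    simp_rw [dist1_comm (e m)]
    exact tsum_exp_dist1_le he (by positivity) (e m)
  have h := norm_apply_le_of_schur (expOp w hw * (K * expOp (fun x => -w x) hw'))
    (S := growth μ C) (mul_nonneg hC (expSum_nonneg _))
    (fun m => (ENNReal.tsum_le_tsum fun n => hb m n).trans (hrow m))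
    (fun n => (ENNReal.tsum_le_tsum fun m => hb m n).trans (by
      simp_rw [dist1_comm _ (e n)]; exact hrow n)) (expOp w hw φ)
  rwa [mul_apply_eq_comp, mul_apply_eq_comp, expOp_neg_expOp] at h

theorem norm_apply_le_of_local {e : X → ℤ × ℤ} (he : Function.Injective e) {μ C : ℝ} (hμ : 0 < μ)
    (hC : 0 ≤ C) {K : Op X N}
    (hK : ∀ m n, ‖kernel K m n‖ ≤ C * Real.exp (-μ * dist1 (e m) (e n))) (φ : Hil X N) :
    ‖K φ‖ ≤ growth μ C * ‖φ‖ := by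
  have h := norm_expOp_apply_le he hμ hC hK (w := fun _ => 0) (M := 0) (by simp)
    (fun m n => by rw [sub_zero]; exact mul_nonneg (by positivity) (dist1_nonneg _ _)) φ
  have h1 : ∀ ψ : Hil X N, expOp (fun _ => 0) (M := 0) (by simp) ψ = ψ := fun ψ => by
    apply lp.ext
    funext x
    change ((Real.exp 0 : ℝ) : ℂ) • ψ x = ψ x
    simp
  rwa [h1, h1] at h

namespace IsLocalHamiltonian

variable {e : X → ℤ × ℤ} {H : ℝ → Op X N} {μ C : ℝ} {S : Set ℝ}

theorem growth_nonneg (h : IsLocalHamiltonian e H μ C S) : 0 ≤ growth μ C :=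
  mul_nonneg h.const_nonneg (expSum_nonneg _)

theorem norm_apply_le (h : IsLocalHamiltonian e H μ C S) (t : ℝ) (φ : Hil X N) :
    ‖H t φ‖ ≤ growth μ C * ‖φ‖ :=
  norm_apply_le_of_local h.inj h.rate_pos h.const_nonneg (h.bound t) φ

theorem norm_expOp_solution_le (h : IsLocalHamiltonian e H μ C S) {w : X → ℝ} {M : ℝ}
    (hw : ∀ x, |w x| ≤ M) (hlip : ∀ m n, w m - w n ≤ μ / 2 * dist1 (e m) (e n))
    {f r : ℝ → Hil X N} {a b ε : ℝ} (hab : a ≤ b) (hε : 0 ≤ ε) (hf : Continuous f)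
    (hd : ∀ t, t ∉ S → HasDerivAt f (-Complex.I • H t (f t) + r t) t)
    (hr : ∀ t ∈ Set.Icc a b, ‖expOp w hw (r t)‖ ≤ ε) :
    ‖expOp w hw (f b)‖ ≤
      (‖expOp w hw (f a)‖ + ε * (b - a)) * Real.exp (growth μ C * (b - a)) := by
  refine norm_le_of_norm_deriv_le_off_finite (f := fun t => expOp w hw (f t))
    (f' := fun t => expOp w hw (-Complex.I • H t (f t) + r t)) h.growth_nonneg hε h.finite hab
    ((expOp w hw).continuous.comp hf).continuousOn (fun t _ ht => ?_) (fun t ht _ => ?_)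
  · exact ((expOp w hw).restrictScalars ℝ).hasFDerivAt.comp_hasDerivAt t (hd t ht)
  · rw [map_add, map_smul]
    refine (norm_add_le _ _).trans (add_le_add ?_ (hr t (Set.Ioo_subset_Icc_self ht)))
    rw [norm_smul, norm_neg, Complex.norm_I, one_mul]
    exact norm_expOp_apply_le h.inj h.rate_pos h.const_nonneg (h.bound t) hw hlip (f t)

end IsLocalHamiltonian

/-! ### Propagation bounds and invariance of propagators -/

theorem IsPropagator.eq_star {H : ℝ → Op X N} {U : ℝ → ℝ → Op X N} (hU : IsPropagator H U)
    (t s : ℝ) : U t s = star (U s t) := by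
  have h1 : U t s * U s t = 1 := by rw [hU.cocycle, hU.self]
  have h2 : U s t * star (U s t) = 1 := (Unitary.mem_iff.1 (hU.unitary s t)).2
  calc U t s = U t s * (U s t * star (U s t)) := by rw [h2, mul_one]
    _ = _ := by rw [← mul_assoc, h1, one_mul]

theorem expOp_apply_apply_le (w : X → ℝ) {M : ℝ} (hw : ∀ x, |w x| ≤ M) (φ : Hil X N) (x : X) :
    ‖φ x‖ ≤ Real.exp (-w x) * ‖expOp w hw φ‖ := by
  have h := lp.norm_apply_le_norm (p := 2) (by norm_num) (expOp w hw φ) x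
  have h2 : (expOp w hw φ) x = (Real.exp (w x) : ℂ) • φ x := rfl
  rw [h2, norm_smul, Complex.norm_real, Real.norm_eq_abs, Real.abs_exp] at h
  rw [Real.exp_neg, inv_mul_eq_div, le_div_iff₀ (Real.exp_pos _), mul_comm]
  exact h

theorem norm_kernel_star (K : Op X N) (m n : X) : ‖kernel (star K) m n‖ = ‖kernel K n m‖ := by
  rw [kernel_star]
  exact norm_star (kernel K n m)

/-- A weight growing with the distance from n equals 1 (after exponentiation) on the initial vector
and is large at m; since the weighted norm grows only by a fixed exponential in time, the amplitude
at m must be small. -/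
theorem IsPropagator.norm_kernel_le_of_le {e : X → ℤ × ℤ} {H : ℝ → Op X N} {μ C : ℝ} {S : Set ℝ}
    (h : IsLocalHamiltonian e H μ C S) {U : ℝ → ℝ → Op X N} (hU : IsPropagator H U) {s t : ℝ}
    (hst : s ≤ t) (m n : X) : ‖kernel (U t s) m n‖ ≤
      Real.exp (growth μ C * (t - s)) * Real.exp (-(μ / 2) * dist1 (e m) (e n)) := by
  refine ContinuousLinearMap.opNorm_le_bound _ (by positivity) fun v => ?_
  have hμ := h.rate_pos
  let R := μ / 2 * dist1 (e m) (e n)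
  have hR : 0 ≤ R := mul_nonneg (by positivity) (dist1_nonneg _ _)
  -- The cap at the value for m keeps the weight bounded without reducing its value at m.
  let w : X → ℝ := fun x => min (μ / 2 * dist1 (e x) (e n)) R
  have hw : ∀ x, |w x| ≤ R := fun x => by
    rw [abs_of_nonneg (le_min (mul_nonneg (by positivity) (dist1_nonneg _ _)) hR)]
    exact min_le_right _ _
  have hlip : ∀ x y, w x - w y ≤ μ / 2 * dist1 (e x) (e y) := fun x y => by
    rw [sub_le_iff_le_add', ← min_add_add_right]
    refine min_le_min ?_ (by linarith [mul_nonneg hμ.le (dist1_nonneg (e x) (e y))])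
    nlinarith [dist1_triangle (e x) (e y) (e n)]
  have hc : Continuous fun r => U r s (lp.single 2 n v) :=
    (hU.stronglyContinuous _).comp (continuous_id.prodMk continuous_const)
  have key := h.norm_expOp_solution_le hw hlip hst le_rfl hc (r := fun _ => 0)
    (fun r hr => by
      rw [add_zero]
      exact hU.schrodinger s _ r (h.continuousAt r hr)) (fun r _ => by simp)
  have hwn : w n = 0 := by
    change min (μ / 2 * dist1 (e n) (e n)) R = 0
    rw [dist1_self, mul_zero, min_eq_left hR]
  have hwm : w m = R := min_self R
  have hsn : expOp w hw (lp.single 2 n v : Hil X N) = (Real.exp (w n) : ℂ) • lp.single 2 n v :=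
    mulOp_single _ _ n v
  rw [hU.self, one_apply_eq_self, hsn, hwn, Real.exp_zero,
    Complex.ofReal_one, one_smul, lp.norm_single (by norm_num), zero_mul, add_zero] at key
  calc _ ≤ Real.exp (-w m) * ‖expOp w hw (U t s (lp.single 2 n v))‖ :=
        expOp_apply_apply_le w hw _ m
    _ ≤ Real.exp (-w m) * (‖v‖ * Real.exp (growth μ C * (t - s))) := by gcongr
    _ = _ := by rw [hwm]; simp only [R, neg_mul]; ring

theorem IsPropagator.norm_kernel_le {e : X → ℤ × ℤ} {H : ℝ → Op X N} {μ C : ℝ} {S : Set ℝ}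
    (h : IsLocalHamiltonian e H μ C S) {U : ℝ → ℝ → Op X N} (hU : IsPropagator H U) (s t : ℝ)
    (m n : X) : ‖kernel (U t s) m n‖ ≤
      Real.exp (growth μ C * |t - s|) * Real.exp (-(μ / 2) * dist1 (e m) (e n)) := by
  rcases le_total s t with hst | hst
  · rw [abs_of_nonneg (sub_nonneg.2 hst)]
    exact hU.norm_kernel_le_of_le h hst m n
  · rw [abs_of_nonpos (sub_nonpos.2 hst), neg_sub, hU.eq_star t s, norm_kernel_star, dist1_comm]
    exact hU.norm_kernel_le_of_le h hst n m

/-- Propagating the translated vector and translating the propagated one solve the same equation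
with the same initial value, so Grönwall makes their difference vanish. Negative times follow by
taking adjoints. -/
theorem IsPropagator.isInvariant {e : X → ℤ × ℤ} {H : ℝ → Op X N} {μ C : ℝ} {S : Set ℝ}
    (h : IsLocalHamiltonian e H μ C S) {U : ℝ → ℝ → Op X N} (hU : IsPropagator H U) {σ : X ≃ X}
    (hσ : ∀ t, IsInvariant σ (H t)) (t s : ℝ) : IsInvariant σ (U t s) := by
  have key : ∀ s t, s ≤ t → IsInvariant σ (U t s) := by
    intro s t hst
    refine isInvariant_of_shiftOp_comm fun φ => ?_
    have hc : ∀ ψ, Continuous fun r => U r s ψ := fun ψ =>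
      (hU.stronglyContinuous ψ).comp (continuous_id.prodMk continuous_const)
    have h1 := norm_le_of_norm_deriv_le_off_finite
      (f := fun r => U r s (shiftOp σ φ) - shiftOp σ (U r s φ))
      (f' := fun r => -Complex.I • H r (U r s (shiftOp σ φ) - shiftOp σ (U r s φ)))
      h.growth_nonneg le_rfl h.finite hst
      ((hc _).sub ((shiftOp σ).continuous.comp (hc φ))).continuousOn
      (fun r _ hr => by
        have hr' := h.continuousAt r hr
        have h2 := (hU.schrodinger s (shiftOp σ φ) r hr').sub
          (((shiftOp σ : Op X N).restrictScalars ℝ).hasFDerivAt.comp_hasDerivAt r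
            (hU.schrodinger s φ r hr'))
        refine h2.congr_deriv ?_
        rw [ContinuousLinearMap.coe_restrictScalars', map_smul, ← (hσ r).shiftOp_comm, map_sub,
          smul_sub])
      (fun r _ _ => by
        rw [norm_smul, norm_neg, Complex.norm_I, one_mul, add_zero]
        exact h.norm_apply_le r _)
    simp only [hU.self, one_apply_eq_self, sub_self, norm_zero, zero_mul, add_zero] at h1
    exact sub_eq_zero.1 (norm_le_zero_iff.1 h1)
  rcases le_total s t with hst | hst
  · exact key s t hst
  · rw [hU.eq_star t s]
    exact (key t s hst).star

end

section

variable {N : ℕ}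

/-! ### Locality of bulk and edge Hamiltonians -/

theorem kernel_edge (K : Op (ℤ × ℤ) N) (m n : ℕ × ℤ) :
    kernel ((truncation halfPlane).comp (K.comp (injection halfPlane))) m n =
      kernel K (halfPlane m) (halfPlane n) := by
  ext1 v
  rw [kernel_apply, kernel_apply, ContinuousLinearMap.comp_apply, ContinuousLinearMap.comp_apply,
    injection_single, truncation_apply]

theorem IsBulkHamiltonian.exists_isLocalHamiltonian {T : ℝ} (hT : 0 < T)
    {H : ℝ → Op (ℤ × ℤ) N} (hH : IsBulkHamiltonian T H) :
    ∃ μ C S, IsLocalHamiltonian id H μ C S := by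
  obtain ⟨μ, hμ, C, hC, hb⟩ := hH.isLocal
  obtain ⟨S, hfin, hS, -⟩ := hH.piecewise
  refine ⟨μ, C, S, Function.injective_id, hμ, hC.le, fun t m n => ?_, hfin, hS⟩
  obtain ⟨s, hs, hts⟩ := Function.Periodic.exists_mem_Ico₀ (f := H) hH.periodic hT t
  rw [hts]
  exact hb s (Set.Ico_subset_Icc_self hs) m n

theorem StronglyContinuousAt.edge {H : ℝ → Op (ℤ × ℤ) N} {t : ℝ}
    (h : StronglyContinuousAt H t) : StronglyContinuousAt (edgeHamiltonian H) t := fun ψ =>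
  (truncation halfPlane).continuous.continuousAt.comp (h (injection halfPlane ψ))

theorem IsLocalHamiltonian.edge {H : ℝ → Op (ℤ × ℤ) N} {μ C : ℝ} {S : Set ℝ}
    (h : IsLocalHamiltonian id H μ C S) :
    IsLocalHamiltonian halfPlane (edgeHamiltonian H) μ C S where
  inj := halfPlane.injective
  rate_pos := h.rate_pos
  const_nonneg := h.const_nonneg
  bound t m n := by
    rw [edgeHamiltonian, kernel_edge]
    exact h.bound t _ _
  finite := h.finite
  continuousAt t ht := (h.continuousAt t ht).edge

/-- The projection of `ψ` onto the half-plane complementary to `ℕ × ℤ`. -/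
noncomputable def leftPart (ψ : Hil (ℤ × ℤ) N) : Hil (ℤ × ℤ) N :=
  ψ - injection halfPlane (truncation halfPlane ψ)

theorem injection_halfPlane_apply (φ : Hil (ℕ × ℤ) N) (m : ℕ × ℤ) :
    injection halfPlane φ (halfPlane m) = φ m := by
  refine ext_inner_left ℂ fun v => ?_
  refine (lp.inner_single_left (𝕜 := ℂ) (halfPlane m) v (injection halfPlane φ)).symm.trans
    (Eq.trans ?_ (lp.inner_single_left (𝕜 := ℂ) m v φ))
  rw [injection, ContinuousLinearMap.adjoint_inner_right]
  congr 1
  apply lp.ext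
  funext y
  rw [truncation_apply]
  by_cases h : y = m
  · subst h; rw [lp.single_apply_self, lp.single_apply_self]
  · rw [lp.single_apply_ne _ _ _ h, lp.single_apply_ne _ _ _ (halfPlane.injective.ne h)]

theorem injection_halfPlane_apply_of_neg (φ : Hil (ℕ × ℤ) N) {x : ℤ × ℤ} (hx : x.1 < 0) :
    injection halfPlane φ x = 0 := by
  refine ext_inner_left ℂ fun v => ?_
  refine (lp.inner_single_left (𝕜 := ℂ) x v (injection halfPlane φ)).symm.trans ?_
  rw [injection, ContinuousLinearMap.adjoint_inner_right, inner_zero_right]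
  have : truncation halfPlane (lp.single 2 x v : Hil (ℤ × ℤ) N) = 0 := by
    apply lp.ext
    funext y
    rw [truncation_apply]
    refine lp.single_apply_ne _ _ _ fun h => ?_
    have h2 : ((y.1 : ℤ)) = x.1 := congrArg Prod.fst h
    omega
  rw [this, inner_zero_left]

theorem leftPart_apply_of_nonneg (ψ : Hil (ℤ × ℤ) N) {x : ℤ × ℤ} (hx : 0 ≤ x.1) :
    leftPart ψ x = 0 := by
  obtain ⟨m, rfl⟩ : ∃ m, halfPlane m = x :=
    ⟨(x.1.toNat, x.2), Prod.ext (Int.toNat_of_nonneg hx) rfl⟩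
  change ψ _ - injection halfPlane (truncation halfPlane ψ) _ = 0
  rw [injection_halfPlane_apply, truncation_apply, sub_self]

theorem leftPart_apply_of_neg (ψ : Hil (ℤ × ℤ) N) {x : ℤ × ℤ} (hx : x.1 < 0) :
    leftPart ψ x = ψ x := by
  change ψ _ - injection halfPlane (truncation halfPlane ψ) _ = ψ x
  rw [injection_halfPlane_apply_of_neg _ hx, sub_zero]

/-- A path from m to n through a site beyond the edge crosses at least m₁ and then n₁ columns. -/
theorem dist1_add_dist1_ge_of_neg (m n : ℕ × ℤ) {x : ℤ × ℤ} (hx : x.1 < 0) :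
    (m.1 : ℝ) + n.1 + |(m.2 : ℝ) - n.2| ≤ dist1 (halfPlane m) x + dist1 x (halfPlane n) := by
  have hx' : (x.1 : ℝ) < 0 := by exact_mod_cast hx
  have h1 := le_abs_self (((m.1 : ℤ) : ℝ) - x.1)
  have h2 := neg_abs_le ((x.1 : ℝ) - ((n.1 : ℤ) : ℝ))
  have h3 := abs_sub_le (m.2 : ℝ) x.2 n.2
  change _ ≤ (|((m.1 : ℤ) : ℝ) - x.1| + |(m.2 : ℝ) - x.2|) +
    (|(x.1 : ℝ) - ((n.1 : ℤ) : ℝ)| + |(x.2 : ℝ) - n.2|)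
  push_cast at *
  linarith

/-- Half of the decay rate of K, together with that of ψ, pays for the detour beyond the edge; the
other half of the rate of K makes the sum over x converge. -/
theorem enorm_op_leftPart_le {μ C C' : ℝ} (hμ : 0 < μ) (hC : 0 ≤ C) (hC' : 0 ≤ C')
    {K : Op (ℤ × ℤ) N} (hK : ∀ m n, ‖kernel K m n‖ ≤ C * Real.exp (-μ * dist1 m n))
    {ψ : Hil (ℤ × ℤ) N} {n : ℕ × ℤ}
    (hψ : ∀ x, ‖ψ x‖ ≤ C' * Real.exp (-(μ / 2) * dist1 x (halfPlane n))) (m : ℕ × ℤ) :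
    ‖(K (leftPart ψ)) (halfPlane m)‖ₑ ≤ ENNReal.ofReal (C * C' * expSum (μ / 2) *
      Real.exp (-(μ / 2) * ((m.1 : ℝ) + n.1 + |(m.2 : ℝ) - n.2|))) := by
  set R := (m.1 : ℝ) + n.1 + |(m.2 : ℝ) - n.2| with hR
  have hterm : ∀ x, ‖kernel K (halfPlane m) x‖ₑ * ‖leftPart ψ x‖ₑ ≤
      ENNReal.ofReal (C * C' * Real.exp (-(μ / 2) * R)) *
        ENNReal.ofReal (Real.exp (-(μ / 2) * dist1 x (halfPlane m))) := by
    intro x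
    rcases le_or_gt 0 x.1 with hx | hx
    · rw [leftPart_apply_of_nonneg ψ hx, enorm_zero, mul_zero]
      exact zero_le
    rw [leftPart_apply_of_neg ψ hx, ← ofReal_norm, ← ofReal_norm,
      ← ENNReal.ofReal_mul (norm_nonneg _), ← ENNReal.ofReal_mul (by positivity)]
    refine ENNReal.ofReal_le_ofReal ?_
    calc _ ≤ (C * Real.exp (-μ * dist1 (halfPlane m) x)) *
          (C' * Real.exp (-(μ / 2) * dist1 x (halfPlane n))) :=
          mul_le_mul (hK _ _) (hψ x) (norm_nonneg _) (by positivity)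
      _ = C * C' * Real.exp (-μ * dist1 (halfPlane m) x +
          -(μ / 2) * dist1 x (halfPlane n)) := by rw [Real.exp_add]; ring
      _ ≤ C * C' * Real.exp (-(μ / 2) * R + -(μ / 2) * dist1 x (halfPlane m)) := by
        refine mul_le_mul_of_nonneg_left (Real.exp_le_exp.2 ?_) (by positivity)
        rw [dist1_comm x (halfPlane m)]
        nlinarith [dist1_add_dist1_ge_of_neg m n hx]
      _ = _ := by rw [Real.exp_add]; ring
  refine (enorm_op_apply_le K _ _).trans ((ENNReal.tsum_le_tsum hterm).trans ?_)
  rw [ENNReal.tsum_mul_left, tsum_exp_dist1 (by positivity), ← ENNReal.ofReal_mul (by positivity)]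
  refine le_of_eq (congrArg _ (by ring))

/-- Duhamel comparison: U_E δ_n − ι* U_B δ_n starts at 0 and solves the edge equation with source i
ι* H_B applied to the part of U_B δ_n beyond the edge. By locality of H_B and U_B that source is
small far from the edge, and the weighted Grönwall bound propagates the smallness to time T. -/
theorem exists_norm_kernel_edge_sub_le {H : ℝ → Op (ℤ × ℤ) N} {μ C : ℝ} {S : Set ℝ}
    (h : IsLocalHamiltonian id H μ C S) {UB : ℝ → ℝ → Op (ℤ × ℤ) N} (hUB : IsPropagator H UB)
    {UE : ℝ → ℝ → Op (ℕ × ℤ) N} (hUE : IsPropagator (edgeHamiltonian H) UE) {T : ℝ}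
    (hT : 0 ≤ T) :
    ∃ γ > 0, ∃ A ≥ 0, ∀ m n : ℕ × ℤ,
      ‖kernel (UE T 0) m n - kernel (UB T 0) (halfPlane m) (halfPlane n)‖ ≤
        A * Real.exp (-γ * ((m.1 : ℝ) + n.1 + |(m.2 : ℝ) - n.2|)) := by
  have hμ := h.rate_pos
  have hC := h.const_nonneg
  set G := growth μ C with hG
  have hG0 : 0 ≤ G := h.growth_nonneg
  set B := C * Real.exp (G * T) * expSum (μ / 2) * expSum (μ / 4) with hB
  have hB0 : 0 ≤ B := by
    have := expSum_nonneg (μ / 2); have := expSum_nonneg (μ / 4); positivity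
  refine ⟨μ / 4, by positivity, B * T * Real.exp (G * T), by positivity, fun m n => ?_⟩
  refine ContinuousLinearMap.opNorm_le_bound _ (by positivity) fun v => ?_
  -- The weight is centred at the edge point (0, n₂), where the source is concentrated; decay in n₁
  -- comes from the size of the source. Rate μ/4 leaves another μ/4 for summing the source over x.
  let d : ℕ × ℤ → ℝ := fun x => μ / 4 * ((x.1 : ℝ) + |(x.2 : ℝ) - n.2|)
  have hd0 : ∀ x, 0 ≤ d x := fun x => by positivity
  let w : ℕ × ℤ → ℝ := fun x => min (d x) (d m)
  have hw : ∀ x, |w x| ≤ d m := fun x => by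
    rw [abs_of_nonneg (le_min (hd0 x) (hd0 m))]
    exact min_le_right _ _
  have hlip : ∀ x y, w x - w y ≤ μ / 2 * dist1 (halfPlane x) (halfPlane y) := fun x y => by
    have h0 := mul_nonneg hμ.le (dist1_nonneg (halfPlane x) (halfPlane y))
    rw [sub_le_iff_le_add', ← min_add_add_right]
    refine min_le_min ?_ (by linarith)
    have h1 := le_abs_self (((x.1 : ℤ) : ℝ) - ((y.1 : ℤ) : ℝ))
    have h2 := abs_sub_le (x.2 : ℝ) y.2 n.2
    have h3 : (x.1 : ℝ) + |(x.2 : ℝ) - n.2| ≤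
        (y.1 : ℝ) + |(y.2 : ℝ) - n.2| + dist1 (halfPlane x) (halfPlane y) := by
      change _ ≤ _ + (|((x.1 : ℤ) : ℝ) - ((y.1 : ℤ) : ℝ)| + |(x.2 : ℝ) - y.2|)
      push_cast at *
      linarith
    have h4 := mul_le_mul_of_nonneg_left h3 (show 0 ≤ μ / 4 by positivity)
    change μ / 4 * _ ≤ μ / 4 * _ + _
    linarith
  have hcB : Continuous fun r => UB r 0 (lp.single 2 (halfPlane n) v) :=
    (hUB.stronglyContinuous _).comp (continuous_id.prodMk continuous_const)
  have hcE : Continuous fun r => UE r 0 (lp.single 2 n v) :=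
    (hUE.stronglyContinuous _).comp (continuous_id.prodMk continuous_const)
  let r : ℝ → Hil (ℕ × ℤ) N := fun t => Complex.I •
    truncation halfPlane (H t (leftPart (UB t 0 (lp.single 2 (halfPlane n) v))))
  have hr : ∀ t ∈ Set.Icc 0 T, ‖expOp w hw (r t)‖ ≤
      B * ‖v‖ * Real.exp (-(μ / 2) * n.1) := by
    intro t ht
    have hψ : ∀ x, ‖(UB t 0 (lp.single 2 (halfPlane n) v)) x‖ ≤
        (Real.exp (G * T) * ‖v‖) * Real.exp (-(μ / 2) * dist1 x (halfPlane n)) := fun x => by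
      have h1 := hUB.norm_kernel_le_of_le h ht.1 x (halfPlane n)
      refine ((kernel (UB t 0) x (halfPlane n)).le_opNorm v).trans ?_
      refine (mul_le_mul_of_nonneg_right h1 (norm_nonneg v)).trans ?_
      rw [id, id, sub_zero]
      have h2 : Real.exp (G * t) ≤ Real.exp (G * T) := by gcongr; exact ht.2
      calc _ ≤ Real.exp (G * T) * Real.exp (-(μ / 2) * dist1 x (halfPlane n)) * ‖v‖ := by gcongr
        _ = _ := by ring
    have hterm : ∀ x, ‖(expOp w hw (r t)) x‖ₑ ≤
        ENNReal.ofReal (C * (Real.exp (G * T) * ‖v‖) * expSum (μ / 2) *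
          Real.exp (-(μ / 2) * n.1)) *
          ENNReal.ofReal (Real.exp (-(μ / 4) * dist1 (halfPlane x) (0, n.2))) := by
      intro x
      have h1 := enorm_op_leftPart_le hμ hC (by positivity) (h.bound t) hψ x
      have h2 : (expOp w hw (r t)) x = (Real.exp (w x) : ℂ) • Complex.I •
        (H t (leftPart (UB t 0 (lp.single 2 (halfPlane n) v)))) (halfPlane x) := rfl
      have h3 : ‖(expOp w hw (r t)) x‖ₑ = ENNReal.ofReal (Real.exp (w x)) *
          ‖(H t (leftPart (UB t 0 (lp.single 2 (halfPlane n) v)))) (halfPlane x)‖ₑ := by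
        rw [h2, enorm_ofReal_smul, enorm_smul, ← ofReal_norm Complex.I, Complex.norm_I,
          ENNReal.ofReal_one, one_mul, Real.enorm_eq_ofReal (Real.exp_nonneg _)]
      rw [h3]
      refine (mul_le_mul_right h1 _).trans ?_
      have hE := expSum_nonneg (μ / 2)
      rw [← ENNReal.ofReal_mul (Real.exp_nonneg _), ← ENNReal.ofReal_mul (by positivity)]
      refine ENNReal.ofReal_le_ofReal ?_
      have h5 : dist1 (halfPlane x) (0, n.2) = (x.1 : ℝ) + |(x.2 : ℝ) - n.2| := by
        change |((x.1 : ℤ) : ℝ) - ((0 : ℤ) : ℝ)| + |(x.2 : ℝ) - n.2| = _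
        rw [Int.cast_zero, sub_zero, Int.cast_natCast, Nat.abs_cast]
      have h4 : Real.exp (w x) * Real.exp (-(μ / 2) * ((x.1 : ℝ) + n.1 + |(x.2 : ℝ) - n.2|)) ≤
          Real.exp (-(μ / 2) * n.1) *
            Real.exp (-(μ / 4) * dist1 (halfPlane x) (0, n.2)) := by
        rw [← Real.exp_add, ← Real.exp_add, h5]
        refine Real.exp_le_exp.2 ?_
        have h6 : w x ≤ μ / 4 * ((x.1 : ℝ) + |(x.2 : ℝ) - n.2|) := min_le_left _ _
        linarith
      calc _ = C * (Real.exp (G * T) * ‖v‖) * expSum (μ / 2) * (Real.exp (w x) *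
            Real.exp (-(μ / 2) * ((x.1 : ℝ) + n.1 + |(x.2 : ℝ) - n.2|))) := by ring
        _ ≤ C * (Real.exp (G * T) * ‖v‖) * expSum (μ / 2) * _ :=
            mul_le_mul_of_nonneg_left h4 (by positivity)
        _ = _ := by ring
    have hE := expSum_nonneg (μ / 2)
    have hE' := expSum_nonneg (μ / 4)
    have h7 : ‖expOp w hw (r t)‖ₑ ≤ ENNReal.ofReal (B * ‖v‖ * Real.exp (-(μ / 2) * n.1)) := by
      refine (enorm_le_l1norm _).trans ((ENNReal.tsum_le_tsum hterm).trans ?_)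
      rw [ENNReal.tsum_mul_left]
      refine (mul_le_mul_right (tsum_exp_dist1_le halfPlane.injective (by positivity) _) _).trans ?_
      rw [← ENNReal.ofReal_mul (by positivity)]
      exact le_of_eq (congrArg _ (by rw [hB]; ring))
    rw [← ofReal_norm] at h7
    exact (ENNReal.ofReal_le_ofReal_iff (by positivity)).1 h7
  have key := h.edge.norm_expOp_solution_le hw hlip (a := 0) (b := T)
    (f := fun t => UE t 0 (lp.single 2 n v) -
      truncation halfPlane (UB t 0 (lp.single 2 (halfPlane n) v))) (r := r) hT
    (by positivity) (hcE.sub ((truncation halfPlane).continuous.comp hcB)) (fun t ht => by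
      have hct := h.continuousAt t ht
      have h1 := (hUE.schrodinger 0 (lp.single 2 n v) t hct.edge).sub
        (((truncation halfPlane : Hil (ℤ × ℤ) N →L[ℂ] Hil (ℕ × ℤ) N).restrictScalars
          ℝ).hasFDerivAt.comp_hasDerivAt t
          (hUB.schrodinger 0 (lp.single 2 (halfPlane n) v) t hct))
      refine h1.congr_deriv ?_
      simp only [r, leftPart, edgeHamiltonian, ContinuousLinearMap.coe_restrictScalars',
        ContinuousLinearMap.comp_apply, map_sub, map_neg, map_smul, smul_sub, neg_smul]
      abel) hr
  -- Both propagators start at the identity, so only the source contributes.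
  have h0 : UE 0 0 (lp.single 2 n v) -
      truncation halfPlane (UB 0 0 (lp.single 2 (halfPlane n) v)) = 0 := by
    rw [hUE.self, hUB.self, one_apply_eq_self, one_apply_eq_self]
    apply lp.ext
    funext y
    change (lp.single 2 n v : Hil (ℕ × ℤ) N) y -
      (lp.single 2 (halfPlane n) v : Hil (ℤ × ℤ) N) (halfPlane y) = 0
    by_cases hy : y = n
    · subst hy; rw [lp.single_apply_self, lp.single_apply_self, sub_self]
    · rw [lp.single_apply_ne _ _ _ hy, lp.single_apply_ne _ _ _ (halfPlane.injective.ne hy),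
        sub_self]
  simp only [h0, map_zero, norm_zero, zero_add, sub_zero] at key
  have hfin := (expOp_apply_apply_le w hw _ m).trans
    (mul_le_mul_of_nonneg_left key (Real.exp_nonneg (-w m)))
  refine hfin.trans ?_
  have hwm : w m = d m := min_self _
  rw [hwm, ← hG]
  have h8 : Real.exp (-d m) * Real.exp (-(μ / 2) * n.1) ≤
      Real.exp (-(μ / 4) * ((m.1 : ℝ) + n.1 + |(m.2 : ℝ) - n.2|)) := by
    rw [← Real.exp_add]
    refine Real.exp_le_exp.2 ?_
    have h9 : 0 ≤ μ * (n.1 : ℝ) := by positivity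
    change -(μ / 4 * ((m.1 : ℝ) + |(m.2 : ℝ) - n.2|)) + _ ≤ _
    linarith
  calc _ = B * T * Real.exp (G * T) * ‖v‖ *
        (Real.exp (-d m) * Real.exp (-(μ / 2) * n.1)) := by ring
    _ ≤ B * T * Real.exp (G * T) * ‖v‖ * _ := mul_le_mul_of_nonneg_left h8 (by positivity)
    _ = _ := by ring

/-- A linear factor is absorbed by giving up half of the rate. -/
theorem abs_mul_exp_neg_le {a : ℝ} (ha : 0 < a) (x : ℝ) :
    |x| * Real.exp (-a * |x|) ≤ 2 / a * Real.exp (-(a / 2) * |x|) := by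
  have h1 := Real.add_one_le_exp (a / 2 * |x|)
  have h2 : Real.exp (-a * |x|) =
      Real.exp (-(a / 2) * |x|) * Real.exp (-(a / 2) * |x|) := by rw [← Real.exp_add]; ring_nf
  have h3 : Real.exp (a / 2 * |x|) * Real.exp (-(a / 2) * |x|) = 1 := by
    rw [← Real.exp_add]; ring_nf; exact Real.exp_zero
  have h4 : |x| * Real.exp (-(a / 2) * |x|) ≤ 2 / a := by
    rw [le_div_iff₀ ha]
    nlinarith [Real.exp_pos (-(a / 2) * |x|)]
  rw [h2, ← mul_assoc]
  gcongr

/-- Where U_B(T) = I enters: off the diagonal the bulk entry vanishes, so the comparison bounds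
U_E(T) itself, and on the diagonal the weight |m₂ − n₂| is zero. -/
theorem exists_abs_mul_norm_kernel_edge_le {H : ℝ → Op (ℤ × ℤ) N} {μ C : ℝ} {S : Set ℝ}
    (h : IsLocalHamiltonian id H μ C S) {UB : ℝ → ℝ → Op (ℤ × ℤ) N} (hUB : IsPropagator H UB)
    {UE : ℝ → ℝ → Op (ℕ × ℤ) N} (hUE : IsPropagator (edgeHamiltonian H) UE) {T : ℝ}
    (hT : 0 ≤ T) (hper : UB T 0 = 1) :
    ∃ γ > 0, ∃ A ≥ 0, ∀ m n : ℕ × ℤ, |(m.2 : ℝ) - n.2| * ‖kernel (UE T 0) m n‖ ≤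
        A * Real.exp (-γ * ((m.1 : ℝ) + n.1 + |(m.2 : ℝ) - n.2|)) := by
  obtain ⟨γ, hγ, A, hA, hle⟩ := exists_norm_kernel_edge_sub_le h hUB hUE hT
  refine ⟨γ / 2, by positivity, A * (2 / γ), by positivity, fun m n => ?_⟩
  by_cases hmn : m = n
  · subst hmn
    rw [sub_self, abs_zero, zero_mul]
    positivity
  have h1 := hle m n
  rw [hper, kernel_one, if_neg (halfPlane.injective.ne hmn), sub_zero] at h1
  set x := |(m.2 : ℝ) - n.2| with hx
  calc x * ‖kernel (UE T 0) m n‖ ≤ x * (A * Real.exp (-γ * ((m.1 : ℝ) + n.1 + x))) := by gcongr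
    _ = A * Real.exp (-γ * ((m.1 : ℝ) + n.1)) * (x * Real.exp (-γ * x)) := by
      rw [mul_add (-γ), Real.exp_add]; ring
    _ ≤ A * Real.exp (-(γ / 2) * ((m.1 : ℝ) + n.1)) *
          (2 / γ * Real.exp (-(γ / 2) * x)) := by
      refine mul_le_mul ?_ (abs_mul_exp_neg_le hγ _) (by positivity) (by positivity)
      gcongr
      linarith
    _ = _ := by rw [mul_add (-(γ / 2)) _ x, Real.exp_add]; ring

end

section

/-! ### Fourier series -/

/-- The phase `exp (-i θ)`. -/
noncomputable def phase (θ : ℝ) : ℂ := Complex.exp (-Complex.I * θ)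

theorem norm_phase (θ : ℝ) : ‖phase θ‖ = 1 := by
  rw [phase, show -Complex.I * θ = ((-θ : ℝ) : ℂ) * Complex.I by push_cast; ring,
    Complex.norm_exp_ofReal_mul_I]

theorem phase_add (θ θ' : ℝ) : phase (θ + θ') = phase θ * phase θ' := by
  rw [phase, phase, phase, ← Complex.exp_add]
  push_cast
  ring_nf

theorem phase_zero : phase 0 = 1 := by simp [phase]

theorem star_phase (θ : ℝ) : star (phase θ) = phase (-θ) := by
  rw [phase, phase, Complex.star_def, ← Complex.exp_conj]
  simp

@[fun_prop]
theorem continuous_phase : Continuous phase := by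
  unfold phase
  fun_prop

theorem hasDerivAt_phase (ω k : ℝ) :
    HasDerivAt (fun k : ℝ => phase (k * ω)) (phase (k * ω) * (-Complex.I * ω)) k := by
  have h1 : HasDerivAt (fun k : ℝ => -Complex.I * ((k * ω : ℝ) : ℂ)) (-Complex.I * ω) k := by
    have := (((hasDerivAt_id k).mul_const ω).ofReal_comp).const_mul (-Complex.I)
    simpa using this
  exact h1.cexp

theorem integral_phase (n : ℤ) :
    ∫ k in (0 : ℝ)..(2 * Real.pi), phase (k * n) = if n = 0 then (2 * Real.pi : ℂ) else 0 := by
  split_ifs with h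
  · subst h
    simp [phase_zero]
  · have hc : (-Complex.I * n : ℂ) ≠ 0 := by simp [h]
    have h1 := integral_exp_mul_complex (a := 0) (b := 2 * Real.pi) hc
    have h2 : Complex.exp (-Complex.I * n * ((2 * Real.pi : ℝ) : ℂ)) = 1 := by
      rw [show -Complex.I * n * ((2 * Real.pi : ℝ) : ℂ) =
        ((-n : ℤ) : ℂ) * (2 * Real.pi * Complex.I) by push_cast; ring,
        Complex.exp_int_mul_two_pi_mul_I]
    rw [h2] at h1
    simp only [Complex.ofReal_zero, mul_zero, Complex.exp_zero, sub_self, zero_div] at h1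
    rw [← h1]
    refine intervalIntegral.integral_congr (E := ℂ) fun k _ => ?_
    simp only [phase]
    congr 1
    push_cast
    ring

section Series

variable {ι : Type*} {E : Type*} [NormedAddCommGroup E] [NormedSpace ℂ E]

theorem norm_phase_smul (θ : ℝ) (v : E) : ‖phase θ • v‖ = ‖v‖ := by
  rw [norm_smul, norm_phase, one_mul]

variable [CompleteSpace E]

/-- Termwise differentiation: the phases have modulus one, so the derivatives are dominated by |ω i|
‖a i‖ uniformly in k. -/
theorem hasDerivAt_tsum_phase {ω : ι → ℝ} {a : ι → E} (ha : Summable fun i => ‖a i‖)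
    (hb : Summable fun i => |ω i| * ‖a i‖) (k : ℝ) :
    HasDerivAt (fun k : ℝ => ∑' i, phase (k * ω i) • a i)
      (∑' i, phase (k * ω i) • ((-Complex.I * ω i : ℂ) • a i)) k := by
  refine hasDerivAt_tsum (𝕜 := ℝ) (F := E) (y₀ := 0)
    (g := fun i (k : ℝ) => phase (k * ω i) • a i)
    (g' := fun i (k : ℝ) => phase (k * ω i) • ((-Complex.I * ω i : ℂ) • a i)) hb
    (fun i y => ?_) (fun i y => ?_) ?_ k
  · rw [smul_smul]
    exact (hasDerivAt_phase (ω i) y).smul_const (a i)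
  · rw [norm_phase_smul, norm_smul, norm_mul, norm_neg, Complex.norm_I, one_mul,
      Complex.norm_real, Real.norm_eq_abs]
  · exact (ha.congr fun i => (norm_phase_smul _ _).symm).of_norm

theorem continuous_tsum_phase {ω : ι → ℝ} {a : ι → E} (ha : Summable fun i => ‖a i‖) :
    Continuous fun k : ℝ => ∑' i, phase (k * ω i) • a i :=
  continuous_tsum (fun i => by fun_prop) ha fun i k => (norm_phase_smul _ _).le

theorem hasSum_intervalIntegral [Countable ι] {F : ι → ℝ → E} {u : ι → ℝ}
    (hF : ∀ i, Continuous (F i)) (hu : Summable u) (hle : ∀ i k, ‖F i k‖ ≤ u i) (a b : ℝ) :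
    HasSum (fun i => ∫ k in a..b, F i k) (∫ k in a..b, ∑' i, F i k) :=
  intervalIntegral.hasSum_integral_of_dominated_convergence (fun i _ => u i)
    (fun i => (hF i).aestronglyMeasurable) (fun i => .of_forall fun k _ => hle i k)
    (.of_forall fun _ _ => hu) (by simp)
    (.of_forall fun k _ => (Summable.of_norm_bounded hu fun i => hle i k).hasSum)

end Series

/-- Parseval in an arbitrary Hilbert space, by two dominated interchanges: orthogonality of the
phases first collapses the sum over u against one fixed frequency l, then l is summed. -/
theorem integral_inner_tsum_phase {E : Type*} [NormedAddCommGroup E] [InnerProductSpace ℂ E]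
    [CompleteSpace E] {u v : ℤ → E} (hu : Summable fun j => ‖u j‖) (hv : Summable fun j => ‖v j‖) :
    HasSum (fun j => 2 * Real.pi * inner ℂ (u j) (v j))
      (∫ k in (0 : ℝ)..(2 * Real.pi),
        inner ℂ (∑' j : ℤ, phase (k * j) • u j) (∑' j : ℤ, phase (k * j) • v j)) := by
  have hsum : ∀ {w : ℤ → E}, (Summable fun j => ‖w j‖) → ∀ k : ℝ,
      Summable fun j : ℤ => phase (k * j) • w j := fun hw k =>
    (hw.congr fun i => (norm_phase_smul _ _).symm).of_norm
  have hcont := continuous_tsum_phase (ω := fun j : ℤ => (j : ℝ)) hu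
  have h1 : ∀ (l : ℤ) (w : E), ∫ k in (0 : ℝ)..(2 * Real.pi),
      inner ℂ (∑' j : ℤ, phase (k * j) • u j) (phase (k * l) • w) =
        2 * Real.pi * inner ℂ (u l) w := by
    intro l w
    have h2 : ∀ k : ℝ, inner ℂ (∑' j : ℤ, phase (k * j) • u j) (phase (k * l) • w) =
        ∑' j : ℤ, phase (k * (l - j : ℤ)) * inner ℂ (u j) w := fun k => by
      have h3 := (hsum hu k).hasSum.map (innerSLFlip ℂ (phase (k * l) • w)).toAddMonoidHom
        (innerSLFlip ℂ (phase (k * l) • w)).continuous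
      refine h3.tsum_eq.symm.trans (tsum_congr fun j => ?_)
      change inner ℂ (phase (k * j) • u j) (phase (k * l) • w) = _
      rw [inner_smul_left, inner_smul_right, ← mul_assoc]
      congr 1
      rw [← Complex.star_def, star_phase, ← phase_add]
      congr 1
      push_cast
      ring
    have h4 := hasSum_intervalIntegral
      (F := fun (j : ℤ) (k : ℝ) => phase (k * (l - j : ℤ)) * inner ℂ (u j) w)
      (fun j => by fun_prop) (hu.mul_right ‖w‖) (fun j k => by
        rw [norm_mul, norm_phase, one_mul]; exact norm_inner_le_norm _ _) 0 (2 * Real.pi)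
    simp_rw [h2]
    rw [← h4.tsum_eq, tsum_eq_single l]
    · rw [intervalIntegral.integral_mul_const, integral_phase, sub_self, if_pos rfl]
    · intro j hj
      rw [intervalIntegral.integral_mul_const, integral_phase,
        if_neg (sub_ne_zero.2 hj.symm), zero_mul]
  have h5 := hasSum_intervalIntegral
    (F := fun (l : ℤ) (k : ℝ) => inner ℂ (∑' j : ℤ, phase (k * j) • u j) (phase (k * l) • v l))
    (fun l => hcont.inner (by fun_prop)) (hv.mul_left (∑' j, ‖u j‖)) (fun l k => by
      refine (norm_inner_le_norm _ _).trans ?_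
      rw [norm_phase_smul]
      gcongr
      refine (norm_tsum_le_tsum_norm (hu.congr fun i => (norm_phase_smul _ _).symm)).trans ?_
      simp_rw [norm_phase_smul]
      exact le_rfl) 0 (2 * Real.pi)
  simp_rw [h1] at h5
  have h6 : ∀ k : ℝ, inner ℂ (∑' j : ℤ, phase (k * j) • u j) (∑' j : ℤ, phase (k * j) • v j) =
      ∑' l : ℤ, inner ℂ (∑' j : ℤ, phase (k * j) • u j) (phase (k * l) • v l) := fun k =>
    (innerSL ℂ (∑' j : ℤ, phase (k * j) • u j)).map_tsum (hsum hv k)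
  simp_rw [h6]
  exact h5

/-! ### The edge winding number -/

variable {N : ℕ}

theorem kernel_rowBlock (K : Op (ℕ × ℤ) N) (j : ℤ) (m n : ℕ) :
    kernel (rowBlock K j) m n = kernel K (m, j) (n, 0) := by
  ext1 v
  rw [kernel_apply, kernel_apply, rowBlock, ContinuousLinearMap.comp_apply,
    ContinuousLinearMap.comp_apply, injection_single, truncation_apply]
  rfl

theorem rowBlock_single_apply (K : Op (ℕ × ℤ) N) (j : ℤ) (n m : ℕ) (v : Fiber N) :
    (rowBlock K j (lp.single 2 n v)) m = (K (lp.single 2 (n, 0) v)) (m, j) := by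
  rw [rowBlock, ContinuousLinearMap.comp_apply, ContinuousLinearMap.comp_apply, injection_single,
    truncation_apply]
  rfl

/-- The entries of `K` decay exponentially in the distance to the edge and off the rows, with the
off-row weight `|m₂ - n₂|`. -/
def IsEdgeLocalized (K : Op (ℕ × ℤ) N) (γ A : ℝ) : Prop :=
  ∀ m n : ℕ × ℤ, |(m.2 : ℝ) - n.2| * ‖kernel K m n‖ ≤
    A * Real.exp (-γ * ((m.1 : ℝ) + n.1 + |(m.2 : ℝ) - n.2|))

/-- The summand of `∂_{k₂} Û`, without its phase. -/
noncomputable def rowDeriv (K : Op (ℕ × ℤ) N) (j : ℤ) : Op ℕ N :=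
  (-Complex.I * (j : ℝ) : ℂ) • rowBlock K j

theorem norm_neg_I_mul_smul {E : Type*} [NormedAddCommGroup E] [NormedSpace ℂ E] (x : ℝ) (v : E) :
    ‖(-Complex.I * x : ℂ) • v‖ = |x| * ‖v‖ := by
  rw [norm_smul, norm_mul, norm_neg, Complex.norm_I, one_mul, Complex.norm_real, Real.norm_eq_abs]

section Edge

variable {K : Op (ℕ × ℤ) N} {γ A : ℝ}

theorem tsum_exp_neg_mul_nat_le (hγ : 0 < γ) :
    ∑' n : ℕ, ENNReal.ofReal (Real.exp (-γ * n)) ≤ ENNReal.ofReal (expSum γ) := by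
  have h := tsum_exp_dist1_le (e := fun n : ℕ => ((n : ℤ), (0 : ℤ)))
    (fun m n h => by simpa using h) hγ 0
  simpa [dist1] using h

theorem norm_kernel_rowDeriv_le (hK : IsEdgeLocalized K γ A) (j : ℤ) (m n : ℕ) :
    ‖kernel (rowDeriv K j) m n‖ ≤
      A * Real.exp (-γ * |(j : ℝ)|) * Real.exp (-γ * n) * Real.exp (-γ * m) := by
  have h := hK (m, j) (n, 0)
  rw [rowDeriv, kernel_smul, kernel_rowBlock]
  refine (norm_neg_I_mul_smul (E := Fiber N →L[ℂ] Fiber N) (j : ℝ) _).trans_le ?_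
  simp only [Int.cast_zero, sub_zero] at h
  refine h.trans (le_of_eq ?_)
  rw [mul_assoc A, mul_assoc A, ← Real.exp_add, ← Real.exp_add]
  ring_nf

/-- Schur test: one of the factors e^{−γm}, e^{−γn} is summed and the other is bounded by 1. -/
theorem norm_rowDeriv_le (hγ : 0 < γ) (hA : 0 ≤ A) (hK : IsEdgeLocalized K γ A) (j : ℤ) :
    ‖rowDeriv K j‖ ≤ A * expSum γ * Real.exp (-γ * |(j : ℝ)|) := by
  have hE := expSum_nonneg γ
  have hexp : ∀ n : ℕ, Real.exp (-γ * n) ≤ 1 := fun n =>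
    Real.exp_le_one_iff.2 (by have : (0 : ℝ) ≤ n := n.cast_nonneg; nlinarith)
  have hsum : ∑' n : ℕ, ENNReal.ofReal (A * Real.exp (-γ * |(j : ℝ)|)) *
      ENNReal.ofReal (Real.exp (-γ * n)) ≤
        ENNReal.ofReal (A * expSum γ * Real.exp (-γ * |(j : ℝ)|)) := by
    rw [ENNReal.tsum_mul_left, mul_right_comm, ENNReal.ofReal_mul (p := A * _) (by positivity)]
    gcongr
    exact tsum_exp_neg_mul_nat_le hγ
  refine ContinuousLinearMap.opNorm_le_bound _ (by positivity) fun φ => ?_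
  refine norm_apply_le_of_schur _ (by positivity) (fun m => ?_) (fun n => ?_) φ
  · refine le_trans (ENNReal.tsum_le_tsum fun n => ?_) hsum
    rw [← ofReal_norm, ← ENNReal.ofReal_mul (by positivity)]
    refine ENNReal.ofReal_le_ofReal ((norm_kernel_rowDeriv_le hK j m n).trans ?_)
    exact mul_le_of_le_one_right (by positivity) (hexp m)
  · refine le_trans (ENNReal.tsum_le_tsum fun m => ?_) hsum
    rw [← ofReal_norm, ← ENNReal.ofReal_mul (by positivity)]
    refine ENNReal.ofReal_le_ofReal ((norm_kernel_rowDeriv_le hK j m n).trans ?_)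
    rw [mul_right_comm]
    exact mul_le_of_le_one_right (by positivity) (hexp n)

/-- Unlike the operator norm bound, this keeps the decay in the distance of the basis vector from
the edge, which is what gives trace class. -/
theorem norm_rowDeriv_basisVec_le (hγ : 0 < γ) (hA : 0 ≤ A) (hK : IsEdgeLocalized K γ A) (j : ℤ)
    (p : ℕ × Fin N) : ‖rowDeriv K j (basisVec p)‖ ≤
      A * expSum γ * Real.exp (-γ * p.1) * Real.exp (-γ * |(j : ℝ)|) := by
  have hE := expSum_nonneg γ
  have h : ‖rowDeriv K j (basisVec p)‖ₑ ≤ ENNReal.ofReal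
      (A * expSum γ * Real.exp (-γ * p.1) * Real.exp (-γ * |(j : ℝ)|)) := by
    refine (enorm_le_l1norm _).trans ?_
    calc l1norm (rowDeriv K j (basisVec p)) ≤ ∑' m : ℕ,
          ENNReal.ofReal (A * Real.exp (-γ * |(j : ℝ)|) * Real.exp (-γ * p.1)) *
            ENNReal.ofReal (Real.exp (-γ * m)) := by
          refine ENNReal.tsum_le_tsum fun m => ?_
          rw [← ofReal_norm, ← ENNReal.ofReal_mul (by positivity)]
          refine ENNReal.ofReal_le_ofReal (le_trans ?_ (norm_kernel_rowDeriv_le hK j m p.1))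
          refine ((kernel (rowDeriv K j) m p.1).le_opNorm _).trans (le_of_eq ?_)
          rw [PiLp.norm_single, norm_one, mul_one]
      _ ≤ _ := by
          rw [ENNReal.tsum_mul_left]
          refine (mul_le_mul_right (tsum_exp_neg_mul_nat_le hγ) _).trans ?_
          rw [← ENNReal.ofReal_mul (by positivity)]
          exact le_of_eq (congrArg _ (by ring))
  rw [← ofReal_norm] at h
  exact (ENNReal.ofReal_le_ofReal_iff (by positivity)).1 h

theorem summable_norm_rowDeriv (hγ : 0 < γ) (hA : 0 ≤ A) (hK : IsEdgeLocalized K γ A) :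
    Summable fun j => ‖rowDeriv K j‖ :=
  Summable.of_nonneg_of_le (fun _ => norm_nonneg _) (norm_rowDeriv_le hγ hA hK)
    ((summable_exp_neg_mul_abs_int hγ).mul_left _)

/-- For j ≠ 0 the factor |j| is at least 1, so the derivative terms dominate. The term j = 0, on
which the weighted bound says nothing, is a single bounded operator. -/
theorem summable_norm_rowBlock (hγ : 0 < γ) (hA : 0 ≤ A) (hK : IsEdgeLocalized K γ A) :
    Summable fun j => ‖rowBlock K j‖ := by
  refine Summable.of_nonneg_of_le (fun _ => norm_nonneg _) (fun j => ?_)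
    ((summable_norm_rowDeriv hγ hA hK).add
      (hasSum_ite_eq (0 : ℤ) ‖rowBlock K 0‖).summable)
  by_cases hj : j = 0
  · subst hj
    rw [if_pos rfl]
    exact le_add_of_nonneg_left (norm_nonneg _)
  · rw [if_neg hj, add_zero]
    refine le_of_le_of_eq (le_mul_of_one_le_left (norm_nonneg _) ?_)
      (norm_neg_I_mul_smul (E := Op ℕ N) (j : ℝ) (rowBlock K j)).symm
    exact_mod_cast Int.one_le_abs hj

theorem edgeFourierTerm_eq (K : Op (ℕ × ℤ) N) (k : ℝ) (j : ℤ) :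
    edgeFourierTerm K k j = phase (k * j) • rowBlock K j := by
  rw [edgeFourierTerm, phase]
  push_cast
  rfl

theorem summable_edgeFourierTerm (hγ : 0 < γ) (hA : 0 ≤ A) (hK : IsEdgeLocalized K γ A) (k : ℝ) :
    Summable (edgeFourierTerm K k) := by
  refine Summable.of_norm ((summable_norm_rowBlock hγ hA hK).congr fun j => ?_)
  rw [edgeFourierTerm_eq]
  exact (norm_phase_smul (E := Op ℕ N) _ _).symm

theorem edgeFourier_eq (K : Op (ℕ × ℤ) N) (k : ℝ) :
    edgeFourier K k = ∑' j : ℤ, phase (k * j) • rowBlock K j :=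
  tsum_congr fun j => edgeFourierTerm_eq K k j

theorem hasDerivAt_edgeFourier (hγ : 0 < γ) (hA : 0 ≤ A) (hK : IsEdgeLocalized K γ A) (k : ℝ) :
    HasDerivAt (fun k => edgeFourier K k) (∑' j : ℤ, phase (k * j) • rowDeriv K j) k := by
  simp_rw [edgeFourier_eq]
  refine hasDerivAt_tsum_phase (ω := fun j : ℤ => (j : ℝ)) (summable_norm_rowBlock hγ hA hK) ?_ k
  refine (summable_norm_rowDeriv hγ hA hK).congr fun j => ?_
  exact norm_neg_I_mul_smul (E := Op ℕ N) (j : ℝ) (rowBlock K j)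

theorem edgeWindingOp_eq (hγ : 0 < γ) (hA : 0 ≤ A) (hK : IsEdgeLocalized K γ A) (k : ℝ) :
    edgeWindingOp K k = star (∑' j : ℤ, phase (k * j) • rowBlock K j) *
      ∑' j : ℤ, phase (k * j) • rowDeriv K j := by
  rw [edgeWindingOp, (hasDerivAt_edgeFourier hγ hA hK k).deriv, edgeFourier_eq]

theorem tsum_phase_smul_apply {a : ℤ → Op ℕ N} (ha : Summable fun j => ‖a j‖) (k : ℝ)
    (φ : Hil ℕ N) : (∑' j : ℤ, phase (k * j) • a j) φ = ∑' j : ℤ, phase (k * j) • a j φ :=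
  (ContinuousLinearMap.apply ℂ (Hil ℕ N) φ).map_tsum
    ((ha.congr fun _ => (norm_phase_smul _ _).symm).of_norm)

theorem norm_tsum_phase_smul_le {E : Type*} [NormedAddCommGroup E] [NormedSpace ℂ E] {a : ℤ → E}
    {u : ℤ → ℝ} (hu : Summable u) (ha : ∀ j, ‖a j‖ ≤ u j) (k : ℝ) :
    ‖∑' j : ℤ, phase (k * j) • a j‖ ≤ ∑' j, u j :=
  tsum_of_norm_bounded hu.hasSum fun j => (norm_phase_smul _ _).trans_le (ha j)

/-- The adjoint factor is merely bounded; all decay in p comes from the derivative. The bound is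
uniform in k, hence serves also for continuity and for exchanging trace and integral. -/
theorem norm_edgeWindingOp_basisVec_le (hγ : 0 < γ) (hA : 0 ≤ A) (hK : IsEdgeLocalized K γ A)
    (k : ℝ) (p : ℕ × Fin N) : ‖edgeWindingOp K k (basisVec p)‖ ≤
      (∑' j, ‖rowBlock K j‖) * ((A * expSum γ * ∑' j : ℤ, Real.exp (-γ * |(j : ℝ)|)) *
        Real.exp (-γ * p.1)) := by
  rw [edgeWindingOp_eq hγ hA hK, mul_apply_eq_comp]
  refine (ContinuousLinearMap.le_opNorm _ _).trans ?_
  refine mul_le_mul ((norm_star (E := Op ℕ N) _).trans_le <|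
    norm_tsum_phase_smul_le (summable_norm_rowBlock hγ hA hK) (fun _ => le_rfl) k) ?_
    (norm_nonneg _) (tsum_nonneg fun _ => norm_nonneg _)
  rw [tsum_phase_smul_apply (summable_norm_rowDeriv hγ hA hK)]
  refine (norm_tsum_phase_smul_le ((summable_exp_neg_mul_abs_int hγ).mul_left _)
    (fun j => norm_rowDeriv_basisVec_le hγ hA hK j p) k).trans (le_of_eq ?_)
  rw [tsum_mul_left]
  ring

theorem summable_exp_neg_mul_fst (hγ : 0 < γ) :
    Summable fun p : ℕ × Fin N => Real.exp (-γ * p.1) := by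
  have h : Summable fun n : ℕ => Real.exp (-γ * n) := by
    have := (summable_exp_neg_mul_abs_int hγ).comp_injective Nat.cast_injective
    simpa [Function.comp_def] using this
  have h2 := h.mul_of_nonneg (Summable.of_finite (f := fun _ : Fin N => (1 : ℝ)))
    (fun _ => Real.exp_nonneg _) (fun _ => zero_le_one)
  simpa using h2

theorem summable_norm_edgeWindingOp (hγ : 0 < γ) (hA : 0 ≤ A) (hK : IsEdgeLocalized K γ A)
    (k : ℝ) : Summable fun p => ‖edgeWindingOp K k (basisVec p)‖ :=
  Summable.of_nonneg_of_le (fun _ => norm_nonneg _) (norm_edgeWindingOp_basisVec_le hγ hA hK k)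
    (((summable_exp_neg_mul_fst hγ).mul_left _).mul_left _)

theorem continuous_edgeWindingOp (hγ : 0 < γ) (hA : 0 ≤ A) (hK : IsEdgeLocalized K γ A) :
    Continuous (edgeWindingOp K) := by
  have h : edgeWindingOp K = fun k => star (∑' j : ℤ, phase (k * j) • rowBlock K j) *
      ∑' j : ℤ, phase (k * j) • rowDeriv K j := funext fun k => edgeWindingOp_eq hγ hA hK k
  rw [h]
  exact (continuous_tsum_phase (summable_norm_rowBlock hγ hA hK)).star.mul
    (continuous_tsum_phase (summable_norm_rowDeriv hγ hA hK))

theorem norm_inner_basisVec_le {X : Type} [DecidableEq X] (A : Op X N) (p : X × Fin N) :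
    ‖inner ℂ (basisVec p) (A (basisVec p))‖ ≤ ‖A (basisVec p)‖ := by
  refine (norm_inner_le_norm _ _).trans ?_
  rw [norm_basisVec, one_mul]

theorem continuous_trace_edgeWindingOp (hγ : 0 < γ) (hA : 0 ≤ A) (hK : IsEdgeLocalized K γ A) :
    Continuous fun k => trace (edgeWindingOp K k) :=
  continuous_tsum (fun _ => continuous_const.inner
      ((continuous_edgeWindingOp hγ hA hK).clm_apply continuous_const))
    (((summable_exp_neg_mul_fst hγ).mul_left _).mul_left _)
    fun p k => (norm_inner_basisVec_le _ p).trans (norm_edgeWindingOp_basisVec_le hγ hA hK k p)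

/-- Dominated convergence exchanges trace and integral, and Parseval is applied to each basis
vector. -/
theorem integral_trace_edgeWindingOp (hγ : 0 < γ) (hA : 0 ≤ A) (hK : IsEdgeLocalized K γ A) :
    ∫ k in (0 : ℝ)..(2 * Real.pi), trace (edgeWindingOp K k) =
      ∑' p : ℕ × Fin N, 2 * Real.pi *
        ∑' j, inner ℂ (rowBlock K j (basisVec p)) (rowDeriv K j (basisVec p)) := by
  have h := hasSum_intervalIntegral
    (F := fun (p : ℕ × Fin N) k => inner ℂ (basisVec p) (edgeWindingOp K k (basisVec p)))
    (fun _ => continuous_const.inner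
      ((continuous_edgeWindingOp hγ hA hK).clm_apply continuous_const))
    (((summable_exp_neg_mul_fst hγ).mul_left _).mul_left _)
    (fun p k => (norm_inner_basisVec_le _ p).trans (norm_edgeWindingOp_basisVec_le hγ hA hK k p))
    0 (2 * Real.pi)
  refine h.tsum_eq.symm.trans (tsum_congr fun p => ?_)
  have hb : ∀ a : ℤ → Op ℕ N, (Summable fun j => ‖a j‖) →
      Summable fun j => ‖a j (basisVec p)‖ := fun a ha => by
    refine Summable.of_nonneg_of_le (fun _ => norm_nonneg _) (fun j => ?_) ha
    refine ((a j).le_opNorm _).trans ?_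
    rw [norm_basisVec, mul_one]
  have h2 := integral_inner_tsum_phase (hb _ (summable_norm_rowBlock hγ hA hK))
    (hb _ (summable_norm_rowDeriv hγ hA hK))
  rw [← tsum_mul_left, h2.tsum_eq]
  refine intervalIntegral.integral_congr (E := ℂ) fun k _ => ?_
  rw [edgeWindingOp_eq hγ hA hK, mul_apply_eq_comp, ContinuousLinearMap.star_eq_adjoint,
    ContinuousLinearMap.adjoint_inner_right,
    tsum_phase_smul_apply (summable_norm_rowBlock hγ hA hK),
    tsum_phase_smul_apply (summable_norm_rowDeriv hγ hA hK)]

end Edge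

end

section

/-! ### The edge index -/

variable {X : Type} {N : ℕ} [DecidableEq X]

theorem tsum_mul_enorm_single (f : X → ℝ≥0∞) (x : X) (v : Fiber N) :
    ∑' y, f y * ‖(lp.single 2 x v : Hil X N) y‖ₑ = f x * ‖v‖ₑ := by
  rw [tsum_eq_single x, lp.single_apply_self]
  intro y hy
  rw [lp.single_apply_ne _ _ _ hy, enorm_zero, mul_zero]

theorem tsum_mul_enorm_basisVec (f : X → ℝ≥0∞) (p : X × Fin N) :
    ∑' y, f y * ‖(basisVec p : Hil X N) y‖ₑ = f p.1 := by
  rw [basisVec, tsum_mul_enorm_single, ← ofReal_norm, PiLp.norm_single, norm_one,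
    ENNReal.ofReal_one, mul_one]

/-- Translation by `s` along the edge. -/
def edgeShift (s : ℤ) : (ℕ × ℤ) ≃ (ℕ × ℤ) := (Equiv.refl ℕ).prodCongr (Equiv.subRight s)

theorem shiftOp_edgeShift_basisVec (n : ℕ) (s : ℤ) (i : Fin N) :
    shiftOp (edgeShift s) (basisVec ((n, 0), i)) = basisVec ((n, s), i) := by
  have h : edgeShift s (n, s) = (n, 0) := Prod.ext rfl (sub_self s)
  rw [basisVec, basisVec, ← shiftOp_single (edgeShift s) (n, s), h]

/-- Reordering of the labels of the basis vectors of the edge space. -/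
def edgeLabel (N : ℕ) : (ℕ × Fin N) × ℤ ≃ (ℕ × ℤ) × Fin N where
  toFun q := ((q.1.1, q.2), q.1.2)
  invFun p := ((p.1.1, p.2), p.1.2)
  left_inv _ := rfl
  right_inv _ := rfl

theorem edgeSwitch₂_eq (Λ : ℤ → ℝ) (h : IsSwitch Λ) :
    (edgeSwitch₂ Λ h : Op (ℕ × ℤ) N) = switchAt Prod.snd Λ h 0 := by
  ext1 φ
  apply lp.ext
  funext x
  change (Λ x.2 : ℂ) • φ x = (Λ (x.2 + 0) : ℂ) • φ x
  rw [add_zero]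

variable {U : Op (ℕ × ℤ) N} {γ A : ℝ}

/-- Every basis vector is a translate of one in row 0, and the translation is transferred to the
switch function. -/
theorem edgeIndexOp_basisVec (hinv : ∀ s, IsInvariant (edgeShift s) U) {Λ : ℤ → ℝ}
    (h : IsSwitch Λ) (q : (ℕ × Fin N) × ℤ) :
    edgeIndexOp U Λ h (basisVec (edgeLabel N q)) = star U (shiftOp (edgeShift q.2)
      (⁅(switchAt Prod.snd Λ h q.2 : Op (ℕ × ℤ) N), U⁆ (basisVec ((q.1.1, 0), q.1.2)))) := by
  have h1 := lie_switchAt_shiftOp (c := Prod.snd) h (σ := edgeShift q.2) (j := q.2)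
    (fun _ => rfl) 0 (hinv q.2) (basisVec ((q.1.1, 0), q.1.2))
  rw [zero_add] at h1
  rw [← h1, shiftOp_edgeShift_basisVec, edgeIndexOp, mul_apply_eq_comp, edgeSwitch₂_eq]
  rfl

theorem dispNorm_edge_le (hγ : 0 < γ) (hA : 0 ≤ A) (hU : IsEdgeLocalized U γ A) (n : ℕ) :
    dispNorm Prod.snd U (n, 0) ≤ ENNReal.ofReal (A * expSum γ * Real.exp (-γ * n)) := by
  have hterm : ∀ m : ℕ × ℤ, ‖((m.2 - 0 : ℤ) : ℝ)‖ₑ * ‖kernel U m (n, 0)‖ₑ ≤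
      ENNReal.ofReal (A * Real.exp (-γ * n)) *
        ENNReal.ofReal (Real.exp (-γ * dist1 (halfPlane m) 0)) := fun m => by
    rw [← ofReal_norm, ← ofReal_norm, ← ENNReal.ofReal_mul (norm_nonneg _),
      ← ENNReal.ofReal_mul (by positivity)]
    refine ENNReal.ofReal_le_ofReal ?_
    have h1 := hU m (n, 0)
    have h2 : dist1 (halfPlane m) 0 = (m.1 : ℝ) + |(m.2 : ℝ)| := by
      change |((m.1 : ℤ) : ℝ) - ((0 : ℤ) : ℝ)| + |(m.2 : ℝ) - ((0 : ℤ) : ℝ)| = _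
      rw [Int.cast_zero, sub_zero, sub_zero, Int.cast_natCast, Nat.abs_cast]
    rw [h2, mul_assoc, ← Real.exp_add, Real.norm_eq_abs]
    push_cast
    simp only [Int.cast_zero, sub_zero] at h1 ⊢
    refine h1.trans (le_of_eq ?_)
    ring_nf
  refine (ENNReal.tsum_le_tsum hterm).trans ?_
  rw [ENNReal.tsum_mul_left]
  refine (mul_le_mul_right (tsum_exp_dist1_le halfPlane.injective hγ _) _).trans ?_
  rw [← ENNReal.ofReal_mul (by positivity)]
  exact le_of_eq (congrArg _ (by ring))

theorem tsum_dispNorm_edge_ne_top (hγ : 0 < γ) (hA : 0 ≤ A) (hU : IsEdgeLocalized U γ A)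
    (p : ℕ × Fin N) :
    ∑' x, dispNorm Prod.snd U x * ‖(basisVec ((p.1, 0), p.2) : Hil (ℕ × ℤ) N) x‖ₑ ≠ ⊤ := by
  rw [tsum_mul_enorm_basisVec]
  exact ne_top_of_le_ne_top ENNReal.ofReal_ne_top (dispNorm_edge_le hγ hA hU p.1)

/-- For fixed p the sum over rows is a sum over translates of Λ, controlled by the first moment of
the column of U; edge localization makes these moments summable in p. -/
theorem summable_norm_edgeIndexOp (hγ : 0 < γ) (hA : 0 ≤ A) (hU : IsEdgeLocalized U γ A)
    (hinv : ∀ s, IsInvariant (edgeShift s) U) {Λ : ℤ → ℝ} (h : IsSwitch Λ) :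
    Summable fun p => ‖edgeIndexOp U Λ h (basisVec p)‖ := by
  obtain ⟨C, hC, hle⟩ := exists_tsum_l1norm_lie_le (X := ℕ × ℤ) (N := N) Prod.snd h
  rw [← (edgeLabel N).summable_iff]
  refine Summable.of_nonneg_of_le (fun _ => norm_nonneg _) (fun q => ?_)
    (Summable.mul_left ‖star U‖ (f := fun q : (ℕ × Fin N) × ℤ =>
      ‖⁅(switchAt Prod.snd Λ h q.2 : Op (ℕ × ℤ) N), U⁆ (basisVec ((q.1.1, 0), q.1.2))‖) ?_)
  · rw [Function.comp_apply, edgeIndexOp_basisVec hinv]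
    exact (ContinuousLinearMap.le_opNorm _ _).trans_eq (by rw [norm_shiftOp])
  refine summable_norm_iff_tsum_enorm_ne_top.2 ?_
  rw [ENNReal.tsum_prod (f := fun (p : ℕ × Fin N) (s : ℤ) =>
    ‖⁅(switchAt Prod.snd Λ h s : Op (ℕ × ℤ) N), U⁆ (basisVec ((p.1, 0), p.2))‖ₑ)]
  have hsum : Summable fun p : ℕ × Fin N => A * expSum γ * Real.exp (-γ * p.1) :=
    (summable_exp_neg_mul_fst hγ).mul_left _
  have hE := expSum_nonneg γ
  refine ne_top_of_le_ne_top (ENNReal.mul_ne_top hC hsum.tsum_ofReal_ne_top) ?_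
  rw [← ENNReal.tsum_mul_left]
  refine ENNReal.tsum_le_tsum fun p => ?_
  refine (ENNReal.tsum_le_tsum fun s => enorm_le_l1norm _).trans ((hle U _).trans ?_)
  rw [tsum_mul_enorm_basisVec]
  gcongr
  exact dispNorm_edge_le hγ hA hU p.1

/-- The position commutator applied to a vector in row 0 multiplies its image under U by m₂; the
inner product is then split into rows. -/
theorem tsum_inner_lie_edge (hγ : 0 < γ) (hA : 0 ≤ A) (hU : IsEdgeLocalized U γ A)
    {Λ : ℤ → ℝ} (h : IsSwitch Λ) (p : ℕ × Fin N) :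
    ∑' s : ℤ, inner ℂ (U (basisVec ((p.1, 0), p.2)))
      (⁅(switchAt Prod.snd Λ h s : Op (ℕ × ℤ) N), U⁆ (basisVec ((p.1, 0), p.2))) =
      ∑' j : ℤ, (j : ℂ) *
        inner ℂ (rowBlock U j (basisVec p)) (rowBlock U j (basisVec p)) := by
  have hfin := tsum_dispNorm_edge_ne_top hγ hA hU p
  set φ : Hil (ℕ × ℤ) N := basisVec ((p.1, 0), p.2) with hφ
  have hsum := (summable_norm_lie_switchAt Prod.snd h U φ hfin).of_norm
  have happ := tsum_lie_switchAt_apply Prod.snd h U φ hfin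
  set ψ : Hil (ℕ × ℤ) N := ∑' s, ⁅(switchAt Prod.snd Λ h s : Op (ℕ × ℤ) N), U⁆ φ with hψ
  have h1 : ∑' s : ℤ, inner ℂ (U φ) (⁅(switchAt Prod.snd Λ h s : Op (ℕ × ℤ) N), U⁆ φ) =
      inner ℂ (U φ) ψ := ((innerSL ℂ (U φ)).map_tsum hsum).symm
  have h2 : ∀ m : ℕ × ℤ, ψ m = ((m.2 : ℝ) : ℂ) • (U φ) m := fun m => by
    rw [happ m, tsum_eq_single (p.1, 0)]
    · rw [hφ, basisVec, lp.single_apply_self]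
      simp only [sub_zero]
      push_cast
      rfl
    · intro y hy
      rw [hφ, basisVec, lp.single_apply_ne _ _ _ hy, map_zero, smul_zero]
  have hs := lp.summable_inner (𝕜 := ℂ) (U φ) ψ
  rw [h1, lp.inner_eq_tsum, ← (Equiv.prodComm ℤ ℕ).tsum_eq]
  rw [← (Equiv.prodComm ℤ ℕ).summable_iff] at hs
  refine hs.tsum_prod.trans (tsum_congr fun j => ?_)
  rw [lp.inner_eq_tsum, ← tsum_mul_left]
  refine tsum_congr fun m => ?_
  change inner ℂ ((U φ) (m, j)) (ψ (m, j)) = _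
  have h3 : (rowBlock U j (basisVec p)) m = (U φ) (m, j) := rowBlock_single_apply U j p.1 m _
  rw [h2, inner_smul_right, h3]
  push_cast
  rfl

theorem edgeIndex_eq (hγ : 0 < γ) (hA : 0 ≤ A) (hU : IsEdgeLocalized U γ A)
    (hinv : ∀ s, IsInvariant (edgeShift s) U) {Λ : ℤ → ℝ} (h : IsSwitch Λ) :
    edgeIndex U Λ h = Complex.I / (2 * Real.pi) *
      ∫ k in (0 : ℝ)..(2 * Real.pi), trace (edgeWindingOp U k) := by
  have hsum := summable_trace (summable_norm_edgeIndexOp hγ hA hU hinv h)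
  rw [integral_trace_edgeWindingOp hγ hA hU, ← tsum_mul_left, edgeIndex, trace,
    ← (edgeLabel N).tsum_eq]
  rw [← (edgeLabel N).summable_iff] at hsum
  refine hsum.tsum_prod.trans (tsum_congr fun p => ?_)
  have hpi : (Real.pi : ℂ) ≠ 0 := by exact_mod_cast Real.pi_ne_zero
  calc _ = ∑' s : ℤ, inner ℂ (U (basisVec ((p.1, 0), p.2)))
          (⁅(switchAt Prod.snd Λ h s : Op (ℕ × ℤ) N), U⁆ (basisVec ((p.1, 0), p.2))) := by
        refine tsum_congr fun s => ?_
        rw [Function.comp_apply, edgeIndexOp_basisVec hinv, ContinuousLinearMap.star_eq_adjoint,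
          ContinuousLinearMap.adjoint_inner_right]
        change inner ℂ (U (basisVec ((p.1, s), p.2))) _ = _
        -- After U* is moved to the left vector, both arguments carry the same translation, which
        -- cancels.
        rw [← shiftOp_edgeShift_basisVec, (hinv s).shiftOp_comm, inner_shiftOp]
    _ = _ := by
        rw [tsum_inner_lie_edge hγ hA hU h p, ← tsum_mul_left, ← tsum_mul_left]
        refine tsum_congr fun j => ?_
        have h1 : rowDeriv U j (basisVec p) =
          (-Complex.I * (j : ℝ) : ℂ) • rowBlock U j (basisVec p) := rfl
        rw [h1, inner_smul_right]
        field_simp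
        push_cast
        -- The factor −i of the derivative meets the prefactor i/(2π) · 2π.
        linear_combination ((j : ℂ) *
          inner ℂ (rowBlock U j (basisVec p)) (rowBlock U j (basisVec p))) * Complex.I_sq

theorem isInvariant_edgeHamiltonian {H : ℝ → Op (ℤ × ℤ) N} (hinv : IsTranslationInvariant H)
    (t : ℝ) (j : ℤ) : IsInvariant (edgeShift j) (edgeHamiltonian H t) := fun m n => by
  rw [edgeHamiltonian, kernel_edge, kernel_edge, hinv t (halfPlane (edgeShift j m)),
    hinv t (halfPlane m)]
  congr 1
  refine Prod.ext rfl ?_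
  change n.2 - j - (m.2 - j) = n.2 - m.2
  ring

end

section

/-! ### Translation invariant operators with summable kernel -/

variable {N : ℕ}

/-- Translation by `s` on the lattice. -/
def bulkShift (s : ℤ × ℤ) : (ℤ × ℤ) ≃ (ℤ × ℤ) := Equiv.subRight s

/-- Translation invariant operators on the bulk space with absolutely summable kernel. -/
structure IsWiener (K : Op (ℤ × ℤ) N) : Prop where
  inv : ∀ s, IsInvariant (bulkShift s) K
  summable : Summable fun n => ‖kernel K n 0‖

namespace IsWiener

variable {K L : Op (ℤ × ℤ) N}

theorem kernel_eq (hK : IsWiener K) (m n : ℤ × ℤ) : kernel K m n = kernel K (m - n) 0 := by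
  rw [← hK.inv n m n]
  exact congrArg (kernel K (m - n)) (sub_self n)

theorem star (hK : IsWiener K) : IsWiener (star K) where
  inv s := (hK.inv s).star
  summable := by
    have h := (Equiv.neg (ℤ × ℤ)).summable_iff.2 hK.summable
    refine h.congr fun n => ?_
    rw [norm_kernel_star, hK.kernel_eq 0 n, zero_sub]
    rfl

theorem smul (c : ℂ) (hK : IsWiener K) : IsWiener (c • K) where
  inv s m n := by rw [kernel_smul, kernel_smul, hK.inv s]
  summable := (hK.summable.mul_left ‖c‖).congr fun n => (norm_smul c (kernel K n 0)).symm

/-- The bijection `(n, x) ↦ (n - x, x)`. -/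
def convEquiv : (ℤ × ℤ) × (ℤ × ℤ) ≃ (ℤ × ℤ) × (ℤ × ℤ) where
  toFun p := (p.1 - p.2, p.2)
  invFun p := (p.1 + p.2, p.2)
  left_inv p := by simp
  right_inv p := by simp

theorem summable_norm_conv (hK : IsWiener K) (hL : IsWiener L) :
    Summable fun p : (ℤ × ℤ) × (ℤ × ℤ) => ‖kernel K (p.1 - p.2) 0 * kernel L p.2 0‖ := by
  have h := hK.summable.mul_norm hL.summable
  exact (convEquiv.summable_iff (f := fun p : (ℤ × ℤ) × (ℤ × ℤ) =>
    ‖kernel K p.1 0 * kernel L p.2 0‖)).2 h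

theorem hasSum_conv (hK : IsWiener K) (hL : IsWiener L) (n : ℤ × ℤ) :
    HasSum (fun x => kernel K (n - x) 0 * kernel L x 0) (kernel (K * L) n 0) := by
  have hs : Summable fun x => kernel K (n - x) 0 * kernel L x 0 :=
    ((summable_norm_conv hK hL).of_norm).prod_factor n
  convert hs.hasSum
  ext1 v
  have h1 := hs.hasSum.mapL (ContinuousLinearMap.apply ℂ (Fiber N) v)
  refine (hasSum_kernel_mul K L n 0 v).unique ?_
  refine h1.congr_fun fun x => ?_
  rw [hK.kernel_eq n x]
  rfl

theorem mul (hK : IsWiener K) (hL : IsWiener L) : IsWiener (K * L) where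
  inv s := (hK.inv s).mul (hL.inv s)
  summable := by
    refine Summable.of_nonneg_of_le (fun _ => norm_nonneg _) (fun n => ?_)
      (summable_norm_conv hK hL).prod
    rw [← (hasSum_conv hK hL n).tsum_eq]
    exact norm_tsum_le_tsum_norm ((summable_norm_conv hK hL).prod_factor n)

end IsWiener

/-! ### The bulk Fourier transform -/

/-- The character `exp (-i k·n)`. -/
noncomputable def phase₂ (k₁ k₂ : ℝ) (n : ℤ × ℤ) : ℂ := phase (k₁ * n.1 + k₂ * n.2)

theorem phase₂_add (k₁ k₂ : ℝ) (m n : ℤ × ℤ) :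
    phase₂ k₁ k₂ (m + n) = phase₂ k₁ k₂ m * phase₂ k₁ k₂ n := by
  rw [phase₂, phase₂, phase₂, ← phase_add]
  congr 1
  simp only [Prod.fst_add, Prod.snd_add]
  push_cast
  ring

theorem bulkFourierTerm_eq (K : Op (ℤ × ℤ) N) (k₁ k₂ : ℝ) (n : ℤ × ℤ) :
    bulkFourierTerm K k₁ k₂ n = phase₂ k₁ k₂ n • kernel K n 0 := by
  rw [bulkFourierTerm, phase₂, phase]
  push_cast
  rfl

theorem norm_bulkFourierTerm (K : Op (ℤ × ℤ) N) (k₁ k₂ : ℝ) (n : ℤ × ℤ) :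
    ‖bulkFourierTerm K k₁ k₂ n‖ = ‖kernel K n 0‖ := by
  rw [bulkFourierTerm_eq]
  exact norm_phase_smul (E := Fiber N →L[ℂ] Fiber N) _ _

namespace IsWiener

variable {K L : Op (ℤ × ℤ) N}

theorem summable_norm_bulkFourierTerm (hK : IsWiener K) (k₁ k₂ : ℝ) :
    Summable fun n => ‖bulkFourierTerm K k₁ k₂ n‖ := by
  simp_rw [norm_bulkFourierTerm]
  exact hK.summable

theorem bulkFourier_mul (hK : IsWiener K) (hL : IsWiener L) (k₁ k₂ : ℝ) :
    bulkFourier (K * L) k₁ k₂ = bulkFourier K k₁ k₂ * bulkFourier L k₁ k₂ := by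
  have hKs := hK.summable_norm_bulkFourierTerm k₁ k₂
  have hLs := hL.summable_norm_bulkFourierTerm k₁ k₂
  have hs := (convEquiv.summable_iff (f := fun p : (ℤ × ℤ) × (ℤ × ℤ) =>
    bulkFourierTerm K k₁ k₂ p.1 * bulkFourierTerm L k₁ k₂ p.2)).2 (hKs.mul_norm hLs).of_norm
  rw [bulkFourier, bulkFourier, bulkFourier, tsum_mul_tsum_of_summable_norm hKs hLs,
    ← convEquiv.tsum_eq]
  refine Eq.trans (tsum_congr fun n => ?_) hs.tsum_prod.symm
  rw [bulkFourierTerm_eq, ← (hasSum_conv hK hL n).tsum_eq,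
    ← ((hasSum_conv hK hL n).summable).tsum_const_smul]
  refine tsum_congr fun x => ?_
  change _ = bulkFourierTerm K k₁ k₂ (n - x) * bulkFourierTerm L k₁ k₂ x
  rw [bulkFourierTerm_eq, bulkFourierTerm_eq, smul_mul_smul_comm, ← phase₂_add, sub_add_cancel]

theorem bulkFourier_star (hK : IsWiener K) (k₁ k₂ : ℝ) :
    bulkFourier (Star.star K) k₁ k₂ = Star.star (bulkFourier K k₁ k₂) := by
  have h : Star.star (bulkFourier K k₁ k₂) = ∑' n, Star.star (bulkFourierTerm K k₁ k₂ n) :=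
    (((hK.summable_norm_bulkFourierTerm k₁ k₂).of_norm.hasSum).map
      (ContinuousLinearMap.adjoint (𝕜 := ℂ) (E := Fiber N) (F := Fiber N))
      (LinearIsometryEquiv.continuous _)).tsum_eq.symm
  rw [h, bulkFourier, ← (Equiv.neg (ℤ × ℤ)).tsum_eq fun n => Star.star (bulkFourierTerm K k₁ k₂ n)]
  refine tsum_congr fun n => ?_
  rw [bulkFourierTerm_eq, bulkFourierTerm_eq, kernel_star, star_smul, Equiv.neg_apply,
    hK.kernel_eq 0 n, zero_sub]
  congr 1
  rw [phase₂, phase₂, star_phase]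
  congr 1
  simp only [Prod.fst_neg, Prod.snd_neg]
  push_cast
  ring

end IsWiener

/-! ### Commutators with position operators -/

/-- `W` is the commutator of `V` with the position operator of the coordinate `c`. -/
def IsPositionCommutator (c : ℤ × ℤ → ℤ) (V W : Op (ℤ × ℤ) N) : Prop :=
  ∀ m n, kernel W m n = (((c m - c n : ℤ) : ℝ) : ℂ) • kernel V m n

/-- The weight c m − c n depends only on m − n because c is additive, so the weighted kernel is
again translation invariant and passes the Schur test. -/
theorem IsWiener.exists_positionCommutator (c : ℤ × ℤ →+ ℤ) {V : Op (ℤ × ℤ) N} (hV : IsWiener V)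
    (hs : Summable fun n => |(c n : ℝ)| * ‖kernel V n 0‖) :
    ∃ W, IsWiener W ∧ IsPositionCommutator c V W := by
  let w : ℤ × ℤ → Fiber N →L[ℂ] Fiber N := fun n => ((c n : ℝ) : ℂ) • kernel V n 0
  have hw : ∀ n, ‖w n‖ = |(c n : ℝ)| * ‖kernel V n 0‖ := fun n => by
    refine (norm_smul ((c n : ℝ) : ℂ) (kernel V n 0)).trans ?_
    rw [Complex.norm_real, Real.norm_eq_abs]
  have hws : Summable fun n => ‖w n‖ := hs.congr fun n => (hw n).symm
  have hk : ∀ m n, w (m - n) = (((c m - c n : ℤ) : ℝ) : ℂ) • kernel V m n := fun m n => by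
    change ((c (m - n) : ℝ) : ℂ) • kernel V (m - n) 0 = _
    rw [map_sub, ← hV.kernel_eq]
  obtain ⟨W, hW⟩ := exists_op_of_schur (fun m n => w (m - n))
    (summable_norm_iff_tsum_enorm_ne_top.1 hws)
    (fun m => ((Equiv.subLeft m).tsum_eq (fun a => ‖w a‖ₑ)).le)
    (fun n => ((Equiv.subRight n).tsum_eq (fun a => ‖w a‖ₑ)).le)
  refine ⟨W, ⟨fun s m n => ?_, ?_⟩, fun m n => by rw [hW, hk]⟩
  · rw [hW, hW]
    exact congrArg w (sub_sub_sub_cancel_right m n s)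
  · refine hws.congr fun n => ?_
    rw [hW, sub_zero]

theorem hasDerivAt_bulkFourier_fst {V W : Op (ℤ × ℤ) N} (hV : IsWiener V) (hW : IsWiener W)
    (h : IsPositionCommutator Prod.fst V W) (k₁ k₂ : ℝ) :
    HasDerivAt (fun k => bulkFourier V k k₂) (-Complex.I • bulkFourier W k₁ k₂) k₁ := by
  -- The phase in the frozen momentum is absorbed into the coefficients.
  let a : ℤ × ℤ → Fiber N →L[ℂ] Fiber N := fun n => phase (k₂ * n.2) • kernel V n 0
  have hW0 : ∀ n, kernel W n 0 = ((n.1 : ℝ) : ℂ) • kernel V n 0 := fun n => by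
    rw [h, Prod.fst_zero, sub_zero]
  have ha : ∀ n, ‖a n‖ = ‖kernel V n 0‖ := fun n =>
    norm_phase_smul (E := Fiber N →L[ℂ] Fiber N) _ _
  have h1 := hasDerivAt_tsum_phase (ω := fun n : ℤ × ℤ => (n.1 : ℝ)) (a := a)
    (hV.summable.congr fun n => (ha n).symm) (hW.summable.congr fun n => by
      rw [ha, hW0]
      refine (norm_smul ((n.1 : ℝ) : ℂ) (kernel V n 0)).trans ?_
      rw [Complex.norm_real, Real.norm_eq_abs]) k₁
  have h2 : (fun k => bulkFourier V k k₂) = fun k => ∑' n, phase (k * (n.1 : ℝ)) • a n := by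
    funext k
    refine tsum_congr fun n => ?_
    rw [bulkFourierTerm_eq, phase₂, phase_add, mul_smul]
  rw [h2]
  refine h1.congr_deriv ?_
  rw [bulkFourier, ← tsum_const_smul'']
  refine tsum_congr fun n => ?_
  rw [bulkFourierTerm_eq, phase₂, phase_add, hW0]
  simp only [a, smul_smul]
  congr 1
  ring

theorem hasDerivAt_bulkFourier_snd {V W : Op (ℤ × ℤ) N} (hV : IsWiener V) (hW : IsWiener W)
    (h : IsPositionCommutator Prod.snd V W) (k₁ k₂ : ℝ) :
    HasDerivAt (fun k => bulkFourier V k₁ k) (-Complex.I • bulkFourier W k₁ k₂) k₂ := by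
  let a : ℤ × ℤ → Fiber N →L[ℂ] Fiber N := fun n => phase (k₁ * n.1) • kernel V n 0
  have hW0 : ∀ n, kernel W n 0 = ((n.2 : ℝ) : ℂ) • kernel V n 0 := fun n => by
    rw [h, Prod.snd_zero, sub_zero]
  have ha : ∀ n, ‖a n‖ = ‖kernel V n 0‖ := fun n =>
    norm_phase_smul (E := Fiber N →L[ℂ] Fiber N) _ _
  have h1 := hasDerivAt_tsum_phase (ω := fun n : ℤ × ℤ => (n.2 : ℝ)) (a := a)
    (hV.summable.congr fun n => (ha n).symm) (hW.summable.congr fun n => by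
      rw [ha, hW0]
      refine (norm_smul ((n.2 : ℝ) : ℂ) (kernel V n 0)).trans ?_
      rw [Complex.norm_real, Real.norm_eq_abs]) k₂
  have h2 : (fun k => bulkFourier V k₁ k) = fun k => ∑' n, phase (k * (n.2 : ℝ)) • a n := by
    funext k
    refine tsum_congr fun n => ?_
    rw [bulkFourierTerm_eq, phase₂, add_comm, phase_add, mul_smul]
  rw [h2]
  refine h1.congr_deriv ?_
  rw [bulkFourier, ← tsum_const_smul'']
  refine tsum_congr fun n => ?_
  rw [bulkFourierTerm_eq, phase₂, phase_add, hW0]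
  simp only [a, smul_smul]
  congr 1
  ring

/-! ### Integration over the Brillouin zone -/

/-- The Brillouin zone. -/
def brillouin : Set (ℝ × ℝ) := Set.Icc 0 (2 * Real.pi) ×ˢ Set.Icc 0 (2 * Real.pi)

/-- The matrix trace as a continuous linear form. -/
noncomputable def trCLM (N : ℕ) : (Fiber N →L[ℂ] Fiber N) →L[ℂ] ℂ :=
  LinearMap.toContinuousLinearMap
    ((LinearMap.trace ℂ (Fiber N)).comp (ContinuousLinearMap.coeLM ℂ))

theorem setIntegral_phase (n : ℤ) : ∫ k in Set.Icc 0 (2 * Real.pi), phase (k * n) =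
    if n = 0 then (2 * Real.pi : ℂ) else 0 := by
  rw [MeasureTheory.integral_Icc_eq_integral_Ioc,
    ← intervalIntegral.integral_of_le (by positivity), integral_phase]

theorem integral_phase₂ (n : ℤ × ℤ) : ∫ k in brillouin, phase₂ k.1 k.2 n =
    if n = 0 then (4 * Real.pi ^ 2 : ℂ) else 0 := by
  have h1 : ∀ k : ℝ × ℝ, phase₂ k.1 k.2 n = phase (k.1 * n.1) * phase (k.2 * n.2) := fun k =>
    phase_add _ _
  simp_rw [h1]
  rw [brillouin, MeasureTheory.Measure.volume_eq_prod,
    MeasureTheory.setIntegral_prod_mul (fun k : ℝ => phase (k * n.1)) (fun k => phase (k * n.2)),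
    setIntegral_phase, setIntegral_phase]
  by_cases h : n = 0
  · subst h
    simp
    ring
  · rw [if_neg h]
    by_cases h1 : n.1 = 0
    · rw [if_neg (fun h2 : n.2 = 0 => h (Prod.ext h1 h2)), mul_zero]
    · rw [if_neg h1, zero_mul]

theorem isFiniteMeasure_brillouin :
    MeasureTheory.IsFiniteMeasure (MeasureTheory.volume.restrict brillouin) :=
  ⟨by
    rw [MeasureTheory.Measure.restrict_apply_univ]
    exact (isCompact_Icc.prod isCompact_Icc).measure_lt_top⟩

/-- Only the zero mode survives integration; this carries the kernel entry at the origin back to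
momentum space. -/
theorem IsWiener.integral_tr_bulkFourier {K : Op (ℤ × ℤ) N} (hK : IsWiener K) :
    ∫ k in brillouin, tr (bulkFourier K k.1 k.2) = 4 * Real.pi ^ 2 * tr (kernel K 0 0) := by
  have hfin := isFiniteMeasure_brillouin
  have hterm : ∀ (k : ℝ × ℝ) n, trCLM N (bulkFourierTerm K k.1 k.2 n) =
      phase₂ k.1 k.2 n * tr (kernel K n 0) := fun k n => by
    rw [bulkFourierTerm_eq, map_smul]
    rfl
  have h := MeasureTheory.hasSum_integral_of_dominated_convergence
    (μ := MeasureTheory.volume.restrict brillouin)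
    (F := fun n (k : ℝ × ℝ) => phase₂ k.1 k.2 n * tr (kernel K n 0))
    (f := fun k => tr (bulkFourier K k.1 k.2))
    (fun n _ => ‖trCLM N‖ * ‖kernel K n 0‖)
    (fun n => by
      refine Continuous.aestronglyMeasurable ?_
      unfold phase₂
      fun_prop)
    (fun n => .of_forall fun k => by
      rw [norm_mul, phase₂, norm_phase, one_mul]
      exact (trCLM N).le_opNorm (kernel K n 0))
    (.of_forall fun _ => hK.summable.mul_left _)
    (MeasureTheory.integrable_const _)
    (.of_forall fun k => by
      simp_rw [← hterm]
      exact ((hK.summable_norm_bulkFourierTerm k.1 k.2).of_norm.hasSum).mapL (trCLM N))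
  rw [← h.tsum_eq, tsum_eq_single 0]
  · rw [MeasureTheory.integral_mul_const, integral_phase₂, if_pos rfl]
  · intro n hn
    rw [MeasureTheory.integral_mul_const, integral_phase₂, if_neg hn, zero_mul]

end

section

/-! ### Traces of products of two commutators -/

variable {N : ℕ}

theorem switch₁_eq (Λ : ℤ → ℝ) (h : IsSwitch Λ) :
    (switch₁ Λ h : Op (ℤ × ℤ) N) = switchAt Prod.fst Λ h 0 := by
  ext1 φ
  apply lp.ext
  funext x
  change (Λ x.1 : ℂ) • φ x = (Λ (x.1 + 0) : ℂ) • φ x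
  rw [add_zero]

theorem switch₂_eq (Λ : ℤ → ℝ) (h : IsSwitch Λ) :
    (switch₂ Λ h : Op (ℤ × ℤ) N) = switchAt Prod.snd Λ h 0 := by
  ext1 φ
  apply lp.ext
  funext x
  change (Λ x.2 : ℂ) • φ x = (Λ (x.2 + 0) : ℂ) • φ x
  rw [add_zero]

theorem shiftOp_bulkShift_basisVec (s : ℤ × ℤ) (i : Fin N) :
    shiftOp (bulkShift s) (basisVec (0, i)) = basisVec (s, i) := by
  have h : bulkShift s s = 0 := sub_self s
  rw [basisVec, basisVec, ← shiftOp_single (bulkShift s) s, h]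

theorem IsWiener.tsum_enorm_kernel {K : Op (ℤ × ℤ) N} (hK : IsWiener K) (x : ℤ × ℤ) :
    ∑' m, ‖kernel K m x‖ₑ = ∑' n, ‖kernel K n 0‖ₑ := by
  simp_rw [hK.kernel_eq _ x]
  exact (Equiv.subRight x).tsum_eq (fun n => ‖kernel K n 0‖ₑ)

theorem IsPositionCommutator.dispNorm_eq {c : ℤ × ℤ → ℤ} {V W : Op (ℤ × ℤ) N}
    (h : IsPositionCommutator c V W) (hW : IsWiener W) (x : ℤ × ℤ) :
    dispNorm c V x = ∑' n, ‖kernel W n 0‖ₑ := by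
  rw [← hW.tsum_enorm_kernel x]
  refine tsum_congr fun m => ?_
  rw [h]
  exact (enorm_ofReal_smul (E := Fiber N →L[ℂ] Fiber N) _ _).symm

theorem IsWiener.tsum_ne_top {K : Op (ℤ × ℤ) N} (hK : IsWiener K) :
    ∑' n, ‖kernel K n 0‖ₑ ≠ ⊤ := summable_norm_iff_tsum_enorm_ne_top.1 hK.summable

theorem IsWiener.l1norm_apply_le {K : Op (ℤ × ℤ) N} (hK : IsWiener K) (φ : Hil (ℤ × ℤ) N) :
    l1norm (K φ) ≤ (∑' n, ‖kernel K n 0‖ₑ) * l1norm φ := by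
  refine (l1norm_op_apply_le K φ).trans (le_of_eq ?_)
  simp_rw [hK.tsum_enorm_kernel]
  rw [ENNReal.tsum_mul_left]
  rfl

section Trace

variable {c c' : ℤ × ℤ → ℤ} {Λ Λ' : ℤ → ℝ} {V V' W Z Z' : Op (ℤ × ℤ) N}

/-- A pair of coordinates of the lattice that are translated independently. -/
structure IsCoordinatePair (c c' : ℤ × ℤ → ℤ) : Prop where
  sub_left : ∀ s x, c (bulkShift s x) = c x - c s
  sub_right : ∀ s x, c' (bulkShift s x) = c' x - c' s
  bijective : Function.Bijective fun x => (c' x, c x)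

theorem isCoordinatePair_fst_snd : IsCoordinatePair Prod.fst Prod.snd :=
  ⟨fun _ _ => rfl, fun _ _ => rfl, Prod.swap_bijective⟩

theorem isCoordinatePair_snd_fst : IsCoordinatePair Prod.snd Prod.fst :=
  ⟨fun _ _ => rfl, fun _ _ => rfl, Function.bijective_id⟩

/-- The vector `[Λ^s, V] W [Λ'^{s'}, Z] φ`. -/
noncomputable def commVec (c c' : ℤ × ℤ → ℤ) (Λ Λ' : ℤ → ℝ) (h : IsSwitch Λ) (h' : IsSwitch Λ')
    (V W Z : Op (ℤ × ℤ) N) (φ : Hil (ℤ × ℤ) N) (s s' : ℤ) : Hil (ℤ × ℤ) N :=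
  ⁅(switchAt c Λ h s : Op (ℤ × ℤ) N), V⁆ (W (⁅(switchAt c' Λ' h' s' : Op (ℤ × ℤ) N), Z⁆ φ))

theorem comm_mul_comm_shiftOp (hc : IsCoordinatePair c c') (h : IsSwitch Λ) (h' : IsSwitch Λ')
    (hV : IsWiener V) (hW : IsWiener W) (hZ : IsWiener Z) (φ : Hil (ℤ × ℤ) N) (s : ℤ × ℤ) :
    (⁅(switchAt c Λ h 0 : Op (ℤ × ℤ) N), V⁆ * (W * ⁅(switchAt c' Λ' h' 0 : Op (ℤ × ℤ) N), Z⁆))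
      (shiftOp (bulkShift s) φ) =
      shiftOp (bulkShift s) (commVec c c' Λ Λ' h h' V W Z φ (c s) (c' s)) := by
  rw [mul_apply_eq_comp, mul_apply_eq_comp,
    lie_switchAt_shiftOp h' (hc.sub_right s) 0 (hZ.inv s), (hW.inv s).shiftOp_comm,
    lie_switchAt_shiftOp h (hc.sub_left s) 0 (hV.inv s), zero_add, zero_add]
  rfl

/-- The ℓ¹ estimate is applied twice: over s to the vector W [Λ'^{s'}, Z] φ, then over s' to
[Λ'^{s'}, Z] φ. -/
theorem summable_norm_commVec (h : IsSwitch Λ) (h' : IsSwitch Λ') (hV' : IsWiener V')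
    (hVc : IsPositionCommutator c V V') (hW : IsWiener W) (hZ' : IsWiener Z')
    (hZc : IsPositionCommutator c' Z Z') {φ : Hil (ℤ × ℤ) N} (hφ : l1norm φ ≠ ⊤) :
    Summable fun p : ℤ × ℤ => ‖commVec c c' Λ Λ' h h' V W Z φ p.2 p.1‖ := by
  obtain ⟨C, hC, hle⟩ := exists_tsum_l1norm_lie_le (N := N) c h
  obtain ⟨C', hC', hle'⟩ := exists_tsum_l1norm_lie_le (N := N) c' h'
  have hle1 : ∀ ψ, ∑' s, l1norm (⁅(switchAt c Λ h s : Op (ℤ × ℤ) N), V⁆ ψ) ≤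
      C * ((∑' n, ‖kernel V' n 0‖ₑ) * l1norm ψ) := fun ψ => by
    refine (hle V ψ).trans (le_of_eq ?_)
    simp_rw [hVc.dispNorm_eq hV', ENNReal.tsum_mul_left]
    rfl
  have hle2 : ∑' s, l1norm (⁅(switchAt c' Λ' h' s : Op (ℤ × ℤ) N), Z⁆ φ) ≤
      C' * ((∑' n, ‖kernel Z' n 0‖ₑ) * l1norm φ) := by
    refine (hle' Z φ).trans (le_of_eq ?_)
    simp_rw [hZc.dispNorm_eq hZ', ENNReal.tsum_mul_left]
    rfl
  refine summable_norm_iff_tsum_enorm_ne_top.2 ?_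
  rw [ENNReal.tsum_prod (f := fun s' s => ‖commVec c c' Λ Λ' h h' V W Z φ s s'‖ₑ)]
  have hV1 := hV'.tsum_ne_top
  have hW1 := hW.tsum_ne_top
  have hZ1 := hZ'.tsum_ne_top
  set v := ∑' n, ‖kernel V' n 0‖ₑ
  set w := ∑' n, ‖kernel W n 0‖ₑ
  set z := ∑' n, ‖kernel Z' n 0‖ₑ
  refine ne_top_of_le_ne_top (b := C * (v * (w * (C' * (z * l1norm φ))))) (by finiteness) ?_
  calc _ ≤ ∑' s', C * (v * (w * l1norm (⁅(switchAt c' Λ' h' s' : Op (ℤ × ℤ) N), Z⁆ φ))) := by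
        refine ENNReal.tsum_le_tsum fun s' => ?_
        refine (ENNReal.tsum_le_tsum fun s => enorm_le_l1norm _).trans ((hle1 _).trans ?_)
        gcongr
        exact hW.l1norm_apply_le _
    _ ≤ _ := by
        simp_rw [ENNReal.tsum_mul_left]
        gcongr

theorem l1norm_basisVec (p : (ℤ × ℤ) × Fin N) : l1norm (basisVec p : Hil (ℤ × ℤ) N) = 1 := by
  refine Eq.trans (tsum_congr fun x => ?_)
    (tsum_mul_enorm_basisVec (N := N) (fun _ : ℤ × ℤ => (1 : ℝ≥0∞)) p)
  rw [one_mul]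

/-- Summing over s for fixed s' replaces [Λ, V] by V', and continuity of V'W then lets the sum over
s' replace [Λ', Z] by Z'. Absolute convergence identifies the iterated sum with the sum over the
lattice. -/
theorem hasSum_commVec (h : IsSwitch Λ) (h' : IsSwitch Λ') (hV' : IsWiener V')
    (hVc : IsPositionCommutator c V V') (hW : IsWiener W) (hZ' : IsWiener Z')
    (hZc : IsPositionCommutator c' Z Z') {φ : Hil (ℤ × ℤ) N} (hφ : l1norm φ ≠ ⊤) :
    HasSum (fun p : ℤ × ℤ => commVec c c' Λ Λ' h h' V W Z φ p.2 p.1) (V' (W (Z' φ))) := by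
  have key : ∀ {c : ℤ × ℤ → ℤ} {Λ : ℤ → ℝ} (h : IsSwitch Λ) {V V' : Op (ℤ × ℤ) N},
      IsWiener V' → IsPositionCommutator c V V' → ∀ ψ : Hil (ℤ × ℤ) N, l1norm ψ ≠ ⊤ →
      HasSum (fun s => ⁅(switchAt c Λ h s : Op (ℤ × ℤ) N), V⁆ ψ) (V' ψ) := by
    intro c Λ h V V' hV' hVc ψ hψ
    refine hasSum_lie_switchAt c h V ψ _ ?_ fun m => ?_
    · simp_rw [hVc.dispNorm_eq hV', ENNReal.tsum_mul_left]
      exact ENNReal.mul_ne_top hV'.tsum_ne_top hψ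
    · rw [← (hasSum_kernel V' ψ m).tsum_eq]
      refine tsum_congr fun x => ?_
      rw [hVc]
      rfl
  have hs := (summable_norm_commVec h h' hV' hVc hW hZ' hZc hφ).of_norm
  obtain ⟨C', hC', hle'⟩ := exists_tsum_l1norm_lie_le (N := N) c' h'
  have hfin : ∀ s', l1norm (⁅(switchAt c' Λ' h' s' : Op (ℤ × ℤ) N), Z⁆ φ) ≠ ⊤ := fun s' => by
    refine ne_top_of_le_ne_top ?_ ((ENNReal.le_tsum s').trans (hle' Z φ))
    simp_rw [hZc.dispNorm_eq hZ', ENNReal.tsum_mul_left]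
    exact ENNReal.mul_ne_top hC' (ENNReal.mul_ne_top hZ'.tsum_ne_top hφ)
  have h1 : ∀ s', HasSum (fun s => commVec c c' Λ Λ' h h' V W Z φ s s')
      (V' (W (⁅(switchAt c' Λ' h' s' : Op (ℤ × ℤ) N), Z⁆ φ))) := fun s' =>
    key h hV' hVc _ (ne_top_of_le_ne_top (ENNReal.mul_ne_top hW.tsum_ne_top (hfin s'))
      (hW.l1norm_apply_le _))
  have h2 := hs.hasSum.prod_fiberwise h1
  have h3 := ((key h' hZ' hZc φ hφ).mapL W).mapL V'
  rw [← h2.unique h3]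
  exact hs.hasSum

/-- Lattice sites, relabelled by the coordinates `(c', c)`. -/
noncomputable def IsCoordinatePair.equiv (hc : IsCoordinatePair c c') : ℤ × ℤ ≃ ℤ × ℤ :=
  Equiv.ofBijective _ hc.bijective

/-- Only boundedness of B is used, so trace class holds with whatever bounded operator stands for
the time derivative, also at jump times. -/
theorem summable_norm_mul_comm_mul_comm (hc : IsCoordinatePair c c') (h : IsSwitch Λ)
    (h' : IsSwitch Λ') (B : Op (ℤ × ℤ) N) (hV : IsWiener V) (hV' : IsWiener V')
    (hVc : IsPositionCommutator c V V') (hW : IsWiener W) (hZ : IsWiener Z) (hZ' : IsWiener Z')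
    (hZc : IsPositionCommutator c' Z Z') :
    Summable fun p : (ℤ × ℤ) × Fin N => ‖(B * (⁅(switchAt c Λ h 0 : Op (ℤ × ℤ) N), V⁆ *
      (W * ⁅(switchAt c' Λ' h' 0 : Op (ℤ × ℤ) N), Z⁆))) (basisVec p)‖ := by
  have h1 : ∀ i : Fin N, Summable fun s : ℤ × ℤ =>
      ‖commVec c c' Λ Λ' h h' V W Z (basisVec (0, i)) (c s) (c' s)‖ := fun i =>
    (hc.equiv.summable_iff (f := fun p : ℤ × ℤ =>
      ‖commVec c c' Λ Λ' h h' V W Z (basisVec (0, i)) p.2 p.1‖)).2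
      (summable_norm_commVec h h' hV' hVc hW hZ' hZc (by rw [l1norm_basisVec]; simp))
  have h2 : Summable fun p : Fin N × (ℤ × ℤ) =>
      ‖commVec c c' Λ Λ' h h' V W Z (basisVec (0, p.1)) (c p.2) (c' p.2)‖ :=
    (summable_prod_of_nonneg fun _ => norm_nonneg _).2 ⟨h1, Summable.of_finite⟩
  refine Summable.of_nonneg_of_le (fun _ => norm_nonneg _) (fun p => ?_)
    (h2.prod_symm.mul_left ‖B‖)
  rw [mul_apply_eq_comp, ← shiftOp_bulkShift_basisVec, comm_mul_comm_shiftOp hc h h' hV hW hZ]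
  exact (B.le_opNorm _).trans_eq (by rw [norm_shiftOp]; rfl)

theorem tr_eq_sum_inner (A : Fiber N →L[ℂ] Fiber N) :
    tr A = ∑ i, inner ℂ (EuclideanSpace.single i (1 : ℂ)) (A (EuclideanSpace.single i 1)) := by
  have h := LinearMap.trace_eq_sum_inner (A : Fiber N →ₗ[ℂ] Fiber N)
    (EuclideanSpace.basisFun (Fin N) ℂ)
  simp only [EuclideanSpace.basisFun_apply] at h
  exact h

theorem tr_kernel_eq_sum_inner (K : Op (ℤ × ℤ) N) (n : ℤ × ℤ) :
    tr (kernel K n n) = ∑ i, inner ℂ (basisVec (n, i)) (K (basisVec (n, i))) := by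
  rw [tr_eq_sum_inner]
  refine Finset.sum_congr rfl fun i _ => ?_
  exact (lp.inner_single_left (𝕜 := ℂ) (G := fun _ : ℤ × ℤ => Fiber N) n
    (EuclideanSpace.single i (1 : ℂ)) _).symm

/-- Here B must be translation invariant: the translation then passes through to the left and
cancels in the inner product, so summing over sites sums over both translates. -/
theorem trace_mul_comm_mul_comm (hc : IsCoordinatePair c c') (h : IsSwitch Λ)
    (h' : IsSwitch Λ') {B : Op (ℤ × ℤ) N} (hB : IsWiener B) (hV : IsWiener V) (hV' : IsWiener V')
    (hVc : IsPositionCommutator c V V') (hW : IsWiener W) (hZ : IsWiener Z) (hZ' : IsWiener Z')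
    (hZc : IsPositionCommutator c' Z Z') :
    trace (B * (⁅(switchAt c Λ h 0 : Op (ℤ × ℤ) N), V⁆ *
      (W * ⁅(switchAt c' Λ' h' 0 : Op (ℤ × ℤ) N), Z⁆))) =
      tr (kernel (B * (V' * (W * Z'))) 0 0) := by
  have hs := summable_trace (summable_norm_mul_comm_mul_comm hc h h' B hV hV' hVc hW hZ hZ' hZc)
  rw [← (Equiv.prodComm (Fin N) (ℤ × ℤ)).summable_iff] at hs
  rw [trace, ← (Equiv.prodComm (Fin N) (ℤ × ℤ)).tsum_eq, tr_kernel_eq_sum_inner]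
  refine hs.tsum_prod.trans ((tsum_fintype _).trans (Finset.sum_congr rfl fun i _ => ?_))
  have h1 := hasSum_commVec (φ := basisVec (0, i)) h h' hV' hVc hW hZ' hZc
    (by rw [l1norm_basisVec]; simp)
  have h2 := ((hc.equiv.hasSum_iff.2 h1).mapL B).mapL (innerSL ℂ (basisVec (0, i)))
  refine Eq.trans (tsum_congr fun s => ?_) h2.tsum_eq
  change inner ℂ (basisVec (s, i)) ((B * _) (basisVec (s, i))) = _
  rw [mul_apply_eq_comp, ← shiftOp_bulkShift_basisVec, comm_mul_comm_shiftOp hc h h' hV hW hZ,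
    (hB.inv s).shiftOp_comm, inner_shiftOp]
  rfl

end Trace

end

section

/-! ### Regularity of the bulk propagator -/

variable {N : ℕ}

/-- On the finite-dimensional fiber this reduces norm continuity and norm differentiability to the
strong versions. -/
theorem clm_eq_sum (A : Fiber N →L[ℂ] Fiber N) :
    A = ∑ i, ContinuousLinearMap.smulRightL ℂ (Fiber N) (Fiber N) (EuclideanSpace.proj i)
      (A (EuclideanSpace.single i 1)) := by
  ext1 v
  rw [sum_apply]
  have h := (EuclideanSpace.basisFun (Fin N) ℂ).sum_repr v
  conv_lhs => rw [← h]
  rw [map_sum]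
  refine Finset.sum_congr rfl fun i _ => ?_
  rw [map_smul]
  simp

theorem continuousAt_clm_of_apply {Y : Type*} [TopologicalSpace Y]
    {f : Y → Fiber N →L[ℂ] Fiber N} {y : Y} (h : ∀ v, ContinuousAt (fun r => f r v) y) :
    ContinuousAt f y := by
  have h1 : f = fun r => ∑ i, ContinuousLinearMap.smulRightL ℂ (Fiber N) (Fiber N)
      (EuclideanSpace.proj i) (f r (EuclideanSpace.single i 1)) := funext fun r => clm_eq_sum _
  rw [h1]
  exact tendsto_finsetSum _ fun i _ =>
    (ContinuousLinearMap.continuous _).continuousAt.comp (h (EuclideanSpace.single i 1))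

theorem hasDerivAt_clm_of_apply {f : ℝ → Fiber N →L[ℂ] Fiber N} {D : Fiber N →L[ℂ] Fiber N}
    {t : ℝ} (h : ∀ v, HasDerivAt (fun r => f r v) (D v) t) : HasDerivAt f D t := by
  have h1 : f = fun r => ∑ i, ContinuousLinearMap.smulRightL ℂ (Fiber N) (Fiber N)
      (EuclideanSpace.proj i) (f r (EuclideanSpace.single i 1)) := funext fun r => clm_eq_sum _
  rw [h1, clm_eq_sum D]
  refine HasDerivAt.fun_sum fun i _ => ?_
  exact (((ContinuousLinearMap.smulRightL ℂ (Fiber N) (Fiber N)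
    (EuclideanSpace.proj i)).restrictScalars ℝ).hasFDerivAt).comp_hasDerivAt t
      (h (EuclideanSpace.single i 1))

theorem IsTranslationInvariant.isInvariant {H : ℝ → Op (ℤ × ℤ) N} (h : IsTranslationInvariant H)
    (t : ℝ) (s : ℤ × ℤ) : IsInvariant (bulkShift s) (H t) := fun m n => by
  rw [h, h t m]
  exact congrArg (kernel (H t) 0) (sub_sub_sub_cancel_right n m s)

section Propagator

variable {H : ℝ → Op (ℤ × ℤ) N} {μ C : ℝ} {S : Set ℝ} {U : ℝ → ℝ → Op (ℤ × ℤ) N}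

theorem isWiener_of_exp_bound {K : Op (ℤ × ℤ) N} (hinv : ∀ s, IsInvariant (bulkShift s) K)
    {a A : ℝ} (ha : 0 < a) (hK : ∀ n, ‖kernel K n 0‖ ≤ A * Real.exp (-a * dist1 n 0)) :
    IsWiener K :=
  ⟨hinv, Summable.of_nonneg_of_le (fun _ => norm_nonneg _) hK ((summable_exp_dist1 ha).mul_left A)⟩

theorem IsLocalHamiltonian.isWiener (h : IsLocalHamiltonian id H μ C S)
    (hinv : IsTranslationInvariant H) (t : ℝ) : IsWiener (H t) :=
  isWiener_of_exp_bound (hinv.isInvariant t) h.rate_pos fun n => h.bound t n 0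

theorem IsPropagator.isWiener (h : IsLocalHamiltonian id H μ C S) (hinv : IsTranslationInvariant H)
    (hU : IsPropagator H U) (t s : ℝ) : IsWiener (U t s) :=
  isWiener_of_exp_bound (fun j => hU.isInvariant h (fun t => hinv.isInvariant t j) t s)
    (half_pos h.rate_pos) fun n => hU.norm_kernel_le h s t n 0

/-- The larger rate of K is split by the triangle inequality, half for decay in n and half for the
sum over intermediate sites. -/
theorem norm_kernel_mul_le {a A B : ℝ} (ha : 0 < a) (hA : 0 ≤ A) (hB : 0 ≤ B)
    {K L : Op (ℤ × ℤ) N}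
    (hK : ∀ m n, ‖kernel K m n‖ ≤ A * Real.exp (-a * dist1 m n))
    (hL : ∀ n, ‖kernel L n 0‖ ≤ B * Real.exp (-(a / 2) * dist1 n 0)) (n : ℤ × ℤ) :
    ‖kernel (K * L) n 0‖ ≤ A * B * expSum (a / 2) * Real.exp (-(a / 2) * dist1 n 0) := by
  have hE := expSum_nonneg (a / 2)
  refine ContinuousLinearMap.opNorm_le_bound _ (by positivity) fun v => ?_
  have hterm : ∀ x, ‖kernel K n x‖ₑ * ‖kernel L x 0 v‖ₑ ≤
      ENNReal.ofReal (A * B * Real.exp (-(a / 2) * dist1 n 0) * ‖v‖) *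
        ENNReal.ofReal (Real.exp (-(a / 2) * dist1 x n)) := fun x => by
    rw [← ofReal_norm, ← ofReal_norm, ← ENNReal.ofReal_mul (norm_nonneg _),
      ← ENNReal.ofReal_mul (by positivity)]
    refine ENNReal.ofReal_le_ofReal ?_
    have h1 : ‖kernel L x 0 v‖ ≤ B * Real.exp (-(a / 2) * dist1 x 0) * ‖v‖ :=
      ((kernel L x 0).le_opNorm v).trans (mul_le_mul_of_nonneg_right (hL x) (norm_nonneg v))
    have h2 : Real.exp (-a * dist1 n x) * Real.exp (-(a / 2) * dist1 x 0) ≤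
        Real.exp (-(a / 2) * dist1 n 0) * Real.exp (-(a / 2) * dist1 x n) := by
      rw [← Real.exp_add, ← Real.exp_add, dist1_comm x n]
      refine Real.exp_le_exp.2 ?_
      nlinarith [dist1_triangle n x 0]
    calc _ ≤ (A * Real.exp (-a * dist1 n x)) * (B * Real.exp (-(a / 2) * dist1 x 0) * ‖v‖) :=
          mul_le_mul (hK n x) h1 (norm_nonneg _) (by positivity)
      _ = A * B * ‖v‖ * (Real.exp (-a * dist1 n x) * Real.exp (-(a / 2) * dist1 x 0)) := by ring
      _ ≤ A * B * ‖v‖ * _ := mul_le_mul_of_nonneg_left h2 (by positivity)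
      _ = _ := by ring
  have h3 : ‖kernel (K * L) n 0 v‖ₑ ≤ ENNReal.ofReal
      (A * B * expSum (a / 2) * Real.exp (-(a / 2) * dist1 n 0) * ‖v‖) := by
    refine (enorm_op_apply_le K (L (lp.single 2 0 v)) n).trans
      ((ENNReal.tsum_le_tsum hterm).trans ?_)
    rw [ENNReal.tsum_mul_left, tsum_exp_dist1 (by positivity),
      ← ENNReal.ofReal_mul (by positivity)]
    exact le_of_eq (congrArg _ (by ring))
  rw [← ofReal_norm] at h3
  exact (ENNReal.ofReal_le_ofReal_iff (by positivity)).1 h3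

/-- One majorant, uniform on bounded time intervals, for all kernels entering the winding density;
every dominated convergence in the bulk uses it. -/
theorem IsPropagator.exists_summable_bound (h : IsLocalHamiltonian id H μ C S)
    (hU : IsPropagator H U) (R : ℝ) : ∃ u : ℤ × ℤ → ℝ, Summable u ∧ ∀ t, |t| ≤ R → ∀ n,
      ‖kernel (U t 0) n 0‖ ≤ u n ∧ ‖kernel (H t * U t 0) n 0‖ ≤ u n ∧
      |(n.1 : ℝ)| * ‖kernel (U t 0) n 0‖ ≤ u n ∧ |(n.2 : ℝ)| * ‖kernel (U t 0) n 0‖ ≤ u n := by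
  have hμ := h.rate_pos
  have hC := h.const_nonneg
  have hG := h.growth_nonneg
  have hE := expSum_nonneg (μ / 2)
  set M := Real.exp (growth μ C * R) with hM
  have hM0 : 0 < M := Real.exp_pos _
  have hle : ∀ n : ℤ × ℤ, Real.exp (-(μ / 2) * dist1 n 0) ≤ Real.exp (-(μ / 4) * dist1 n 0) :=
    fun n => Real.exp_le_exp.2 (by nlinarith [dist1_nonneg n 0])
  refine ⟨fun n => (M + C * M * expSum (μ / 2) + M * (4 / μ)) * Real.exp (-(μ / 4) * dist1 n 0),
    (summable_exp_dist1 (by positivity)).mul_left _, fun t ht n => ?_⟩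
  have hUb : ∀ n, ‖kernel (U t 0) n 0‖ ≤ M * Real.exp (-(μ / 2) * dist1 n 0) := fun n => by
    refine (hU.norm_kernel_le h 0 t n 0).trans ?_
    rw [sub_zero]
    exact mul_le_mul_of_nonneg_right (Real.exp_le_exp.2 (mul_le_mul_of_nonneg_left ht hG))
      (Real.exp_nonneg _)
  have hx : ∀ x : ℝ, |x| ≤ dist1 n 0 → |x| * ‖kernel (U t 0) n 0‖ ≤
      M * (4 / μ) * Real.exp (-(μ / 4) * dist1 n 0) := fun x hx => by
    have h1 := abs_mul_exp_neg_le (half_pos hμ) (dist1 n 0)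
    rw [abs_of_nonneg (dist1_nonneg n 0)] at h1
    calc _ ≤ dist1 n 0 * (M * Real.exp (-(μ / 2) * dist1 n 0)) :=
          mul_le_mul hx (hUb n) (norm_nonneg _) (dist1_nonneg n 0)
      _ = M * (dist1 n 0 * Real.exp (-(μ / 2) * dist1 n 0)) := by ring
      _ ≤ M * (2 / (μ / 2) * Real.exp (-(μ / 2 / 2) * dist1 n 0)) :=
          mul_le_mul_of_nonneg_left h1 hM0.le
      _ = _ := by
          rw [show μ / 2 / 2 = μ / 4 by ring, show 2 / (μ / 2) = 4 / μ by field_simp; norm_num]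
          ring
  have hE4 := Real.exp_nonneg (-(μ / 4) * dist1 n 0)
  have hp1 : 0 ≤ C * M * expSum (μ / 2) * Real.exp (-(μ / 4) * dist1 n 0) := by positivity
  have hp2 : 0 ≤ M * (4 / μ) * Real.exp (-(μ / 4) * dist1 n 0) := by positivity
  have hp3 : 0 ≤ M * Real.exp (-(μ / 4) * dist1 n 0) := by positivity
  have hd1 : |(n.1 : ℝ)| ≤ dist1 n 0 := by
    simp only [dist1, Prod.fst_zero, Prod.snd_zero, Int.cast_zero, sub_zero]
    linarith [abs_nonneg (n.2 : ℝ)]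
  have hd2 : |(n.2 : ℝ)| ≤ dist1 n 0 := by
    simp only [dist1, Prod.fst_zero, Prod.snd_zero, Int.cast_zero, sub_zero]
    linarith [abs_nonneg (n.1 : ℝ)]
  beta_reduce
  rw [add_mul, add_mul]
  refine ⟨?_, ?_, ?_, ?_⟩
  · have := (hUb n).trans (mul_le_mul_of_nonneg_left (hle n) hM0.le)
    linarith
  · have := (norm_kernel_mul_le hμ hC hM0.le (h.bound t) hUb n).trans
      (mul_le_mul_of_nonneg_left (hle n) (by positivity))
    linarith
  · linarith [hx _ hd1]
  · linarith [hx _ hd2]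

theorem IsPropagator.continuous_apply (hU : IsPropagator H U) (s : ℝ) (ψ : Hil (ℤ × ℤ) N) :
    Continuous fun r => U r s ψ :=
  (hU.stronglyContinuous ψ).comp (continuous_id.prodMk continuous_const)

/-- Products of strongly continuous families are strongly continuous here because ‖H r‖ is bounded
uniformly in r. -/
theorem StronglyContinuousAt.mul (h : IsLocalHamiltonian id H μ C S) {V : ℝ → Op (ℤ × ℤ) N}
    {t : ℝ} (hH : StronglyContinuousAt H t) (hV : StronglyContinuousAt V t) :
    StronglyContinuousAt (fun r => H r * V r) t := by
  intro ψ
  have h1 : Filter.Tendsto (fun r => growth μ C * ‖V r ψ - V t ψ‖ + ‖H r (V t ψ) - H t (V t ψ)‖)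
      (𝓝 t) (𝓝 0) := by
    have h2 := ((hV ψ).tendsto.sub_const (V t ψ)).norm.const_mul (growth μ C)
    have h3 := ((hH (V t ψ)).tendsto.sub_const (H t (V t ψ))).norm
    simpa using h2.add h3
  refine tendsto_iff_norm_sub_tendsto_zero.2
    (squeeze_zero (fun _ => norm_nonneg _) (fun r => ?_) h1)
  change ‖H r (V r ψ) - H t (V t ψ)‖ ≤ _
  calc ‖H r (V r ψ) - H t (V t ψ)‖ = ‖H r (V r ψ - V t ψ) + (H r (V t ψ) - H t (V t ψ))‖ := by
        rw [map_sub]; congr 1; abel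
    _ ≤ _ := (norm_add_le _ _).trans (add_le_add (h.norm_apply_le r _) le_rfl)

theorem IsPropagator.hasDerivAt_apply (hU : IsPropagator H U) {t : ℝ}
    (ht : StronglyContinuousAt H t) (ψ : Hil (ℤ × ℤ) N) :
    HasDerivAt (fun r => U r 0 ψ) ((-Complex.I • (H t * U t 0)) ψ) t :=
  hU.schrodinger 0 ψ t ht

theorem IsPropagator.strongDeriv_eq (hU : IsPropagator H U) {t : ℝ}
    (ht : StronglyContinuousAt H t) :
    strongDeriv (fun r => U r 0) t = -Complex.I • (H t * U t 0) := by
  have hex : ∃ D : Op (ℤ × ℤ) N, ∀ ψ, HasDerivAt (fun r => U r 0 ψ) (D ψ) t :=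
    ⟨_, hU.hasDerivAt_apply ht⟩
  rw [strongDeriv, dif_pos hex]
  ext1 ψ
  exact (hex.choose_spec ψ).unique (hU.hasDerivAt_apply ht ψ)

theorem IsPropagator.hasDerivAt_kernel (hU : IsPropagator H U) {t : ℝ}
    (ht : StronglyContinuousAt H t) (m n : ℤ × ℤ) :
    HasDerivAt (fun r => kernel (U r 0) m n) (kernel (-Complex.I • (H t * U t 0)) m n) t :=
  hasDerivAt_clm_of_apply fun v =>
    (((lp.evalCLM ℂ (fun _ : ℤ × ℤ => Fiber N) 2 m).restrictScalars ℝ).hasFDerivAt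
      ).comp_hasDerivAt t (hU.hasDerivAt_apply ht (lp.single 2 n v))

theorem IsLocalHamiltonian.eventually_notMem (h : IsLocalHamiltonian id H μ C S) (t : ℝ) :
    ∀ᶠ r in 𝓝[≠] t, r ∉ S := by
  have hfin : ((S ∩ Set.Icc (t - 1) (t + 1)) \ {t}).Finite := (h.finite _ _).sdiff
  have h1 := hfin.isClosed.isOpen_compl.mem_nhds
    (fun h2 : t ∈ (S ∩ Set.Icc (t - 1) (t + 1)) \ {t} => h2.2 rfl)
  have h2 : Set.Icc (t - 1) (t + 1) ∈ 𝓝 t := Icc_mem_nhds (by linarith) (by linarith)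
  refine eventually_nhdsWithin_iff.2 ?_
  filter_upwards [h1, h2] with r h3 h4 h5 h6
  exact h3 ⟨⟨h6, h4⟩, h5⟩

/-- The series is differentiated term by term on a ball around t on which H is strongly continuous
throughout. -/
theorem IsPropagator.hasDerivAt_bulkFourier (h : IsLocalHamiltonian id H μ C S)
    (hU : IsPropagator H U) {t : ℝ} (ht : StronglyContinuousAt H t) (k₁ k₂ : ℝ) :
    HasDerivAt (fun r => bulkFourier (U r 0) k₁ k₂)
      (bulkFourier (-Complex.I • (H t * U t 0)) k₁ k₂) t := by
  obtain ⟨u, hu, hb⟩ := hU.exists_summable_bound h (|t| + 1)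
  -- Local finiteness of S covers the punctured neighbourhood; t itself may lie in S and is covered
  -- by hypothesis.
  have hev : ∀ᶠ r in 𝓝 t, StronglyContinuousAt H r := by
    refine eventually_nhdsWithin_iff.1 (h.eventually_notMem t) |>.mono fun r hr => ?_
    by_cases hrt : r = t
    · exact hrt ▸ ht
    · exact h.continuousAt r (hr hrt)
  obtain ⟨δ, hδ, hball⟩ := Metric.eventually_nhds_iff_ball.1 hev
  set ε := min δ 1 with hε
  have hε0 : 0 < ε := lt_min hδ one_pos
  have habs : ∀ r ∈ Metric.ball t ε, |r| ≤ |t| + 1 := fun r hr => by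
    have h1 : |r - t| < 1 := (Metric.mem_ball.1 hr).trans_le (min_le_right _ _)
    have h2 := abs_sub_abs_le_abs_sub r t
    linarith
  have ht0 : t ∈ Metric.ball t ε := Metric.mem_ball_self hε0
  simp only [bulkFourier, bulkFourierTerm_eq]
  refine hasDerivAt_tsum_of_isPreconnected (𝕜 := ℝ) (F := Fiber N →L[ℂ] Fiber N) (y₀ := t)
    (g := fun n r => phase₂ k₁ k₂ n • kernel (U r 0) n 0)
    (g' := fun n r => phase₂ k₁ k₂ n • kernel (-Complex.I • (H r * U r 0)) n 0)
    hu Metric.isOpen_ball (convex_ball t ε).isPreconnected (fun n r hr => ?_) (fun n r hr => ?_)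
    ht0 ?_ ht0
  · have h1 := hU.hasDerivAt_kernel (hball r (Metric.ball_subset_ball (min_le_left _ _) hr)) n 0
    exact h1.const_smul (phase₂ k₁ k₂ n)
  · refine (norm_phase_smul (E := Fiber N →L[ℂ] Fiber N) _ _).trans_le ?_
    refine (norm_smul (-Complex.I) (kernel (H r * U r 0) n 0)).trans_le ?_
    rw [norm_neg, Complex.norm_I, one_mul]
    exact (hb r (habs r hr) n).2.1
  · refine Summable.of_norm_bounded hu fun n => ?_
    exact (norm_phase_smul (E := Fiber N →L[ℂ] Fiber N) _ _).trans_le (hb t (by linarith) n).1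

theorem continuousAt_bulkFourier {K : ℝ → Op (ℤ × ℤ) N} {t : ℝ} {u : ℤ × ℤ → ℝ} (hu : Summable u)
    (hK : ∀ᶠ r in 𝓝 t, ∀ n, ‖kernel (K r) n 0‖ ≤ u n)
    (hc : ∀ n, ContinuousAt (fun r => kernel (K r) n 0) t) (k₁ k₂ : ℝ) :
    ContinuousAt (fun p : ℝ × ℝ × ℝ => bulkFourier (K p.1) p.2.1 p.2.2) (t, k₁, k₂) := by
  simp only [bulkFourier, bulkFourierTerm_eq]
  refine tendsto_tsum_of_dominated_convergence hu (fun n => ?_) ?_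
  · have h1 : Continuous fun p : ℝ × ℝ × ℝ => phase₂ p.2.1 p.2.2 n := by
      unfold phase₂
      fun_prop
    have h2 : ContinuousAt (fun p : ℝ × ℝ × ℝ => kernel (K p.1) n 0) (t, k₁, k₂) :=
      ContinuousAt.comp (g := fun r => kernel (K r) n 0) (f := fun p : ℝ × ℝ × ℝ => p.1)
        (x := (t, k₁, k₂)) (hc n) continuousAt_fst
    exact h1.continuousAt.smul h2
  · filter_upwards [continuousAt_fst.eventually hK] with p hp n
    exact (norm_phase_smul (E := Fiber N →L[ℂ] Fiber N) _ _).trans_le (hp n)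

theorem continuousAt_kernel {K : ℝ → Op (ℤ × ℤ) N} {t : ℝ} (hK : StronglyContinuousAt K t)
    (m n : ℤ × ℤ) : ContinuousAt (fun r => kernel (K r) m n) t :=
  continuousAt_clm_of_apply fun v =>
    (lp.evalCLM ℂ (fun _ : ℤ × ℤ => Fiber N) 2 m).continuous.continuousAt.comp
      (hK (lp.single 2 n v))

theorem norm_bulkFourier_le {K : Op (ℤ × ℤ) N} {u : ℤ × ℤ → ℝ} (hu : Summable u)
    (hK : ∀ n, ‖kernel K n 0‖ ≤ u n) (k₁ k₂ : ℝ) : ‖bulkFourier K k₁ k₂‖ ≤ ∑' n, u n :=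
  tsum_of_norm_bounded hu.hasSum fun n => (norm_bulkFourierTerm K k₁ k₂ n).trans_le (hK n)

end Propagator

end

section

/-! ### The bulk winding number -/

section Ring

/-- Regroups the index operator as a left factor u d u times products of two commutators, the shape
treated by the trace lemmas. -/
theorem mul_lie_mul {R : Type*} [Ring R] (u d a b : R) :
    u * d * ⁅u * a, u * b⁆ = u * d * u * (a * (u * b)) - u * d * u * (b * (u * a)) := by
  rw [Ring.lie_def]
  noncomm_ring

/-- The momentum derivatives contribute (−i)² = −1, the source of the minus sign in the bulk
formula. -/
theorem mul_lie_mul_smul {R : Type*} [Ring R] [Algebra ℂ R] (u d a b : R) :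
    u * d * ⁅u * (-Complex.I • a), u * (-Complex.I • b)⁆ =
      -(u * d * u * (a * (u * b)) - u * d * u * (b * (u * a))) := by
  have h : -Complex.I * -Complex.I = -1 := by rw [neg_mul_neg, Complex.I_mul_I]
  rw [mul_lie_mul]
  simp only [mul_smul_comm, smul_mul_assoc, smul_smul, h]
  simp only [neg_smul, one_smul]
  abel

theorem norm_mul_lie_mul_le {R : Type*} [NormedRing R] {u d a b : R} {σ : ℝ}
    (hu : ‖u‖ ≤ σ) (hd : ‖d‖ ≤ σ) (ha : ‖a‖ ≤ σ) (hb : ‖b‖ ≤ σ) :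
    ‖u * d * u * (a * (u * b))‖ ≤ σ ^ 6 := by
  have hσ : 0 ≤ σ := (norm_nonneg u).trans hu
  calc ‖u * d * u * (a * (u * b))‖ ≤ ‖u‖ * ‖d‖ * ‖u‖ * (‖a‖ * (‖u‖ * ‖b‖)) := by
        refine (norm_mul_le _ _).trans ?_
        gcongr
        · exact (norm_mul_le _ _).trans (by gcongr; exact norm_mul_le _ _)
        · exact (norm_mul_le _ _).trans (by gcongr; exact norm_mul_le _ _)
    _ ≤ σ * σ * σ * (σ * (σ * σ)) := by gcongr
    _ = σ ^ 6 := by ring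

end Ring

variable {N : ℕ}

theorem tr_sub (A B : Fiber N →L[ℂ] Fiber N) : tr (A - B) = tr A - tr B :=
  map_sub (trCLM N) A B

theorem IsWiener.sub {K L : Op (ℤ × ℤ) N} (hK : IsWiener K) (hL : IsWiener L) :
    IsWiener (K - L) where
  inv s m n := by rw [kernel_sub, kernel_sub, hK.inv s, hL.inv s]
  summable := Summable.of_nonneg_of_le (fun _ => norm_nonneg _)
    (fun n => norm_sub_le (kernel K n 0) (kernel L n 0)) (hK.summable.add hL.summable)

theorem IsWiener.bulkFourier_sub {K L : Op (ℤ × ℤ) N} (hK : IsWiener K) (hL : IsWiener L)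
    (k₁ k₂ : ℝ) : bulkFourier (K - L) k₁ k₂ = bulkFourier K k₁ k₂ - bulkFourier L k₁ k₂ := by
  rw [bulkFourier, bulkFourier, bulkFourier,
    ← (hK.summable_norm_bulkFourierTerm k₁ k₂).of_norm.tsum_sub
      (hL.summable_norm_bulkFourierTerm k₁ k₂).of_norm]
  refine tsum_congr fun n => ?_
  rw [bulkFourierTerm_eq, bulkFourierTerm_eq, bulkFourierTerm_eq, kernel_sub]
  exact smul_sub _ _ _

/-- `V` is a Wiener operator with position commutators `W₁` and `W₂` in the two directions. -/
structure HasPositionCommutators (V W₁ W₂ : Op (ℤ × ℤ) N) : Prop where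
  wiener : IsWiener V
  wiener_fst : IsWiener W₁
  wiener_snd : IsWiener W₂
  fst : IsPositionCommutator Prod.fst V W₁
  snd : IsPositionCommutator Prod.snd V W₂

/-- The operator `V^* D [V^* W₁, V^* W₂]`, expanded. -/
noncomputable def windingOp (V D W₁ W₂ : Op (ℤ × ℤ) N) : Op (ℤ × ℤ) N :=
  star V * D * star V * (W₁ * (star V * W₂)) - star V * D * star V * (W₂ * (star V * W₁))

namespace HasPositionCommutators

variable {V W₁ W₂ D : Op (ℤ × ℤ) N}

theorem isWiener_windingOp (h : HasPositionCommutators V W₁ W₂) (hD : IsWiener D) :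
    IsWiener (windingOp V D W₁ W₂) := by
  have hV := h.wiener.star
  have hB := (hV.mul hD).mul hV
  exact (hB.mul (h.wiener_fst.mul (hV.mul h.wiener_snd))).sub
    (hB.mul (h.wiener_snd.mul (hV.mul h.wiener_fst)))

theorem bulkFourier_windingOp (h : HasPositionCommutators V W₁ W₂) (hD : IsWiener D) (k₁ k₂ : ℝ) :
    bulkFourier (windingOp V D W₁ W₂) k₁ k₂ =
      star (bulkFourier V k₁ k₂) * bulkFourier D k₁ k₂ * star (bulkFourier V k₁ k₂) *
        (bulkFourier W₁ k₁ k₂ * (star (bulkFourier V k₁ k₂) * bulkFourier W₂ k₁ k₂)) -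
      star (bulkFourier V k₁ k₂) * bulkFourier D k₁ k₂ * star (bulkFourier V k₁ k₂) *
        (bulkFourier W₂ k₁ k₂ * (star (bulkFourier V k₁ k₂) * bulkFourier W₁ k₁ k₂)) := by
  have hV := h.wiener.star
  have h1 := h.wiener_fst
  have h2 := h.wiener_snd
  have hVD := hV.mul hD
  have hB := hVD.mul hV
  have h3 := hV.mul h2
  have h4 := hV.mul h1
  have h5 := h1.mul h3
  have h6 := h2.mul h4
  rw [windingOp, (hB.mul h5).bulkFourier_sub (hB.mul h6), hB.bulkFourier_mul h5,
    hB.bulkFourier_mul h6, hVD.bulkFourier_mul hV, hV.bulkFourier_mul hD, h1.bulkFourier_mul h3,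
    h2.bulkFourier_mul h4, hV.bulkFourier_mul h1, hV.bulkFourier_mul h2, h.wiener.bulkFourier_star]

variable {Λ Λ' : ℤ → ℝ}

theorem summable_norm_lie (h : HasPositionCommutators V W₁ W₂) (B : Op (ℤ × ℤ) N)
    (hΛ : IsSwitch Λ) (hΛ' : IsSwitch Λ') :
    (Summable fun p : (ℤ × ℤ) × Fin N => ‖(B * (⁅(switch₁ Λ hΛ : Op (ℤ × ℤ) N), V⁆ *
      (star V * ⁅(switch₂ Λ' hΛ' : Op (ℤ × ℤ) N), V⁆))) (basisVec p)‖) ∧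
    Summable fun p : (ℤ × ℤ) × Fin N => ‖(B * (⁅(switch₂ Λ' hΛ' : Op (ℤ × ℤ) N), V⁆ *
      (star V * ⁅(switch₁ Λ hΛ : Op (ℤ × ℤ) N), V⁆))) (basisVec p)‖ := by
  rw [switch₁_eq, switch₂_eq]
  exact ⟨summable_norm_mul_comm_mul_comm isCoordinatePair_fst_snd hΛ hΛ' B h.wiener h.wiener_fst
      h.fst h.wiener.star h.wiener h.wiener_snd h.snd,
    summable_norm_mul_comm_mul_comm isCoordinatePair_snd_fst hΛ' hΛ B h.wiener h.wiener_snd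
      h.snd h.wiener.star h.wiener h.wiener_fst h.fst⟩

theorem summable_norm_mul_lie (h : HasPositionCommutators V W₁ W₂) (D : Op (ℤ × ℤ) N)
    (hΛ : IsSwitch Λ) (hΛ' : IsSwitch Λ') :
    Summable fun p : (ℤ × ℤ) × Fin N =>
      ‖(star V * D * ⁅star V * ⁅(switch₁ Λ hΛ : Op (ℤ × ℤ) N), V⁆,
        star V * ⁅(switch₂ Λ' hΛ' : Op (ℤ × ℤ) N), V⁆⁆) (basisVec p)‖ := by
  rw [mul_lie_mul]
  obtain ⟨h1, h2⟩ := h.summable_norm_lie (star V * D * star V) hΛ hΛ'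
  exact Summable.of_nonneg_of_le (fun _ => norm_nonneg _) (fun p => norm_sub_le _ _) (h1.add h2)

theorem trace_mul_lie (h : HasPositionCommutators V W₁ W₂) (hD : IsWiener D)
    (hΛ : IsSwitch Λ) (hΛ' : IsSwitch Λ') :
    trace (star V * D * ⁅star V * ⁅(switch₁ Λ hΛ : Op (ℤ × ℤ) N), V⁆,
        star V * ⁅(switch₂ Λ' hΛ' : Op (ℤ × ℤ) N), V⁆⁆) =
      tr (kernel (windingOp V D W₁ W₂) 0 0) := by
  rw [mul_lie_mul]
  obtain ⟨h1, h2⟩ := h.summable_norm_lie (star V * D * star V) hΛ hΛ'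
  have hB := (h.wiener.star.mul hD).mul h.wiener.star
  have h3 := (summable_trace h1).tsum_sub (summable_trace h2)
  refine (Eq.trans (tsum_congr fun p => ?_) h3).trans ?_
  · rw [sub_apply, inner_sub_right]
  · change trace _ - trace _ = _
    rw [switch₁_eq, switch₂_eq, trace_mul_comm_mul_comm isCoordinatePair_fst_snd hΛ hΛ' hB h.wiener
      h.wiener_fst h.fst h.wiener.star h.wiener h.wiener_snd h.snd,
      trace_mul_comm_mul_comm isCoordinatePair_snd_fst hΛ' hΛ hB h.wiener h.wiener_snd
      h.snd h.wiener.star h.wiener h.wiener_fst h.fst, windingOp, kernel_sub]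
    exact (tr_sub _ _).symm

end HasPositionCommutators

/-! ### Bulk index versus winding density -/

section Propagator

variable {H : ℝ → Op (ℤ × ℤ) N} {μ C : ℝ} {S : Set ℝ} {U : ℝ → ℝ → Op (ℤ × ℤ) N}

theorem IsPropagator.exists_hasPositionCommutators (h : IsLocalHamiltonian id H μ C S)
    (hinv : IsTranslationInvariant H) (hU : IsPropagator H U) :
    ∃ W₁ W₂ : ℝ → Op (ℤ × ℤ) N, ∀ t, HasPositionCommutators (U t 0) (W₁ t) (W₂ t) := by
  have h1 : ∀ t, ∃ W₁ W₂ : Op (ℤ × ℤ) N, HasPositionCommutators (U t 0) W₁ W₂ := fun t => by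
    obtain ⟨u, hu, hb⟩ := hU.exists_summable_bound h |t|
    have hV := hU.isWiener h hinv t 0
    obtain ⟨W₁, hW₁, hc₁⟩ := hV.exists_positionCommutator (AddMonoidHom.fst ℤ ℤ)
      (Summable.of_nonneg_of_le (fun _ => by positivity) (fun n => (hb t le_rfl n).2.2.1) hu)
    obtain ⟨W₂, hW₂, hc₂⟩ := hV.exists_positionCommutator (AddMonoidHom.snd ℤ ℤ)
      (Summable.of_nonneg_of_le (fun _ => by positivity) (fun n => (hb t le_rfl n).2.2.2) hu)
    exact ⟨W₁, W₂, hV, hW₁, hW₂, hc₁, hc₂⟩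
  choose W₁ W₂ hW using h1
  exact ⟨W₁, W₂, hW⟩

variable {W₁ W₂ : ℝ → Op (ℤ × ℤ) N}

theorem IsPropagator.bulkWindingDensity_eq (h : IsLocalHamiltonian id H μ C S)
    (hU : IsPropagator H U) (hW : ∀ t, HasPositionCommutators (U t 0) (W₁ t) (W₂ t)) {t : ℝ}
    (ht : StronglyContinuousAt H t) (k₁ k₂ : ℝ) :
    bulkWindingDensity (fun r => U r 0) (t, k₁, k₂) =
      -tr (star (bulkFourier (U t 0) k₁ k₂) * bulkFourier (-Complex.I • (H t * U t 0)) k₁ k₂ *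
          star (bulkFourier (U t 0) k₁ k₂) * (bulkFourier (W₁ t) k₁ k₂ *
            (star (bulkFourier (U t 0) k₁ k₂) * bulkFourier (W₂ t) k₁ k₂)) -
        star (bulkFourier (U t 0) k₁ k₂) * bulkFourier (-Complex.I • (H t * U t 0)) k₁ k₂ *
          star (bulkFourier (U t 0) k₁ k₂) * (bulkFourier (W₂ t) k₁ k₂ *
            (star (bulkFourier (U t 0) k₁ k₂) * bulkFourier (W₁ t) k₁ k₂))) := by
  have h0 := (hU.hasDerivAt_bulkFourier h ht k₁ k₂).deriv
  have h1 := (hasDerivAt_bulkFourier_fst (hW t).wiener (hW t).wiener_fst (hW t).fst k₁ k₂).deriv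
  have h2 := (hasDerivAt_bulkFourier_snd (hW t).wiener (hW t).wiener_snd (hW t).snd k₁ k₂).deriv
  rw [bulkWindingDensity]
  simp only
  rw [h0, h1, h2, mul_lie_mul_smul]
  exact map_neg (trCLM N) _

/-- Both sides are the same kernel entry at the origin: the left by summing over translates of the
switch functions, the right by integrating out the momenta, with 4π² the area of the Brillouin zone.
-/
theorem IsPropagator.trace_bulkIndexOp (h : IsLocalHamiltonian id H μ C S)
    (hinv : IsTranslationInvariant H) (hU : IsPropagator H U)
    (hW : ∀ t, HasPositionCommutators (U t 0) (W₁ t) (W₂ t)) {t : ℝ}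
    (ht : StronglyContinuousAt H t) {Λ Λ' : ℤ → ℝ} (hΛ : IsSwitch Λ) (hΛ' : IsSwitch Λ') :
    trace (bulkIndexOp (fun r => U r 0) Λ Λ' hΛ hΛ' t) =
      -(1 / (4 * (Real.pi : ℂ) ^ 2)) *
        ∫ k in brillouin, bulkWindingDensity (fun r => U r 0) (t, k) := by
  have hD : IsWiener (-Complex.I • (H t * U t 0)) :=
    ((h.isWiener hinv t).mul (hW t).wiener).smul _
  have h1 : ∀ k : ℝ × ℝ, bulkWindingDensity (fun r => U r 0) (t, k) =
      -tr (bulkFourier (windingOp (U t 0) (-Complex.I • (H t * U t 0)) (W₁ t) (W₂ t)) k.1 k.2) :=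
    fun k => by
      rw [(hW t).bulkFourier_windingOp hD]
      exact hU.bulkWindingDensity_eq h hW ht k.1 k.2
  simp_rw [h1]
  rw [MeasureTheory.integral_neg, ((hW t).isWiener_windingOp hD).integral_tr_bulkFourier,
    bulkIndexOp, hU.strongDeriv_eq ht, (hW t).trace_mul_lie hD]
  have hπ : (Real.pi : ℂ) ≠ 0 := Complex.ofReal_ne_zero.2 Real.pi_ne_zero
  field_simp

/-- Continuity is proved for the explicit expression in Fourier transforms, which agrees with the
winding density at the times where H is strongly continuous. -/
theorem IsPropagator.continuousAt_bulkWindingDensity (h : IsLocalHamiltonian id H μ C S)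
    (hU : IsPropagator H U) (hW : ∀ t, HasPositionCommutators (U t 0) (W₁ t) (W₂ t)) {t : ℝ}
    (ht : StronglyContinuousAt H t) (k₁ k₂ : ℝ) :
    ContinuousAt (fun p : ℝ × ℝ × ℝ => -tr (star (bulkFourier (U p.1 0) p.2.1 p.2.2) *
          bulkFourier (-Complex.I • (H p.1 * U p.1 0)) p.2.1 p.2.2 *
          star (bulkFourier (U p.1 0) p.2.1 p.2.2) * (bulkFourier (W₁ p.1) p.2.1 p.2.2 *
            (star (bulkFourier (U p.1 0) p.2.1 p.2.2) * bulkFourier (W₂ p.1) p.2.1 p.2.2)) -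
        star (bulkFourier (U p.1 0) p.2.1 p.2.2) *
          bulkFourier (-Complex.I • (H p.1 * U p.1 0)) p.2.1 p.2.2 *
          star (bulkFourier (U p.1 0) p.2.1 p.2.2) * (bulkFourier (W₂ p.1) p.2.1 p.2.2 *
            (star (bulkFourier (U p.1 0) p.2.1 p.2.2) * bulkFourier (W₁ p.1) p.2.1 p.2.2))))
      (t, k₁, k₂) := by
  obtain ⟨u, hu, hb⟩ := hU.exists_summable_bound h (|t| + 1)
  have hev : ∀ᶠ r in 𝓝 t, |r| ≤ |t| + 1 :=
    (continuous_abs.continuousAt.eventually_lt continuousAt_const (lt_add_one |t|)).mono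
      fun _ hr => hr.le
  have hUc : StronglyContinuousAt (fun r => U r 0) t := fun ψ =>
    (hU.continuous_apply 0 ψ).continuousAt
  have cU := continuousAt_bulkFourier (K := fun r => U r 0) hu
    (hev.mono fun r hr n => (hb r hr n).1) (continuousAt_kernel hUc · 0) k₁ k₂
  have cD := continuousAt_bulkFourier (K := fun r => -Complex.I • (H r * U r 0)) hu
    (hev.mono fun r hr n => by
      refine (norm_smul (-Complex.I) (kernel (H r * U r 0) n 0)).trans_le ?_
      rw [norm_neg, Complex.norm_I, one_mul]
      exact (hb r hr n).2.1)
    (fun n => (continuousAt_kernel (ht.mul h hUc) n 0).const_smul (-Complex.I)) k₁ k₂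
  have hn₁ : ∀ r n, kernel (W₁ r) n 0 = ((n.1 : ℝ) : ℂ) • kernel (U r 0) n 0 := fun r n => by
    rw [(hW r).fst, Prod.fst_zero, sub_zero]
  have hn₂ : ∀ r n, kernel (W₂ r) n 0 = ((n.2 : ℝ) : ℂ) • kernel (U r 0) n 0 := fun r n => by
    rw [(hW r).snd, Prod.snd_zero, sub_zero]
  have c₁ := continuousAt_bulkFourier (K := W₁) hu
    (hev.mono fun r hr n => by
      rw [hn₁]
      refine (norm_smul ((n.1 : ℝ) : ℂ) (kernel (U r 0) n 0)).trans_le ?_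
      rw [Complex.norm_real]
      exact (hb r hr n).2.2.1)
    (fun n => by
      simp_rw [hn₁]
      exact (continuousAt_kernel hUc n 0).const_smul ((n.1 : ℝ) : ℂ)) k₁ k₂
  have c₂ := continuousAt_bulkFourier (K := W₂) hu
    (hev.mono fun r hr n => by
      rw [hn₂]
      refine (norm_smul ((n.2 : ℝ) : ℂ) (kernel (U r 0) n 0)).trans_le ?_
      rw [Complex.norm_real]
      exact (hb r hr n).2.2.2)
    (fun n => by
      simp_rw [hn₂]
      exact (continuousAt_kernel hUc n 0).const_smul ((n.2 : ℝ) : ℂ)) k₁ k₂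
  have cS : ContinuousAt (fun p : ℝ × ℝ × ℝ => star (bulkFourier (U p.1 0) p.2.1 p.2.2))
      (t, k₁, k₂) :=
    (LinearIsometryEquiv.continuous (ContinuousLinearMap.adjoint (𝕜 := ℂ) (E := Fiber N)
      (F := Fiber N))).continuousAt.comp cU
  have cB := (cS.mul cD).mul cS
  exact ((trCLM N).continuous.continuousAt.comp
    ((cB.mul (c₁.mul (cS.mul c₂))).sub (cB.mul (c₂.mul (cS.mul c₁))))).neg

theorem IsPropagator.exists_norm_bulkWindingDensity_le (h : IsLocalHamiltonian id H μ C S)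
    (hU : IsPropagator H U) (hW : ∀ t, HasPositionCommutators (U t 0) (W₁ t) (W₂ t)) (R : ℝ) :
    ∃ M, ∀ t, |t| ≤ R → StronglyContinuousAt H t → ∀ k : ℝ × ℝ,
      ‖bulkWindingDensity (fun r => U r 0) (t, k)‖ ≤ M := by
  obtain ⟨u, hu, hb⟩ := hU.exists_summable_bound h R
  set σ := ∑' n, u n with hσ
  refine ⟨‖trCLM N‖ * (σ ^ 6 + σ ^ 6), fun t ht hc k => ?_⟩
  have bU : ‖star (bulkFourier (U t 0) k.1 k.2)‖ ≤ σ :=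
    (norm_star (E := Fiber N →L[ℂ] Fiber N) _).trans_le
      (norm_bulkFourier_le hu (fun n => (hb t ht n).1) _ _)
  have bD : ‖bulkFourier (-Complex.I • (H t * U t 0)) k.1 k.2‖ ≤ σ :=
    norm_bulkFourier_le hu (fun n => by
      refine (norm_smul (-Complex.I) (kernel (H t * U t 0) n 0)).trans_le ?_
      rw [norm_neg, Complex.norm_I, one_mul]
      exact (hb t ht n).2.1) _ _
  have b₁ : ‖bulkFourier (W₁ t) k.1 k.2‖ ≤ σ :=
    norm_bulkFourier_le hu (fun n => by
      rw [(hW t).fst, Prod.fst_zero, sub_zero]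
      refine (norm_smul ((n.1 : ℝ) : ℂ) (kernel (U t 0) n 0)).trans_le ?_
      rw [Complex.norm_real]
      exact (hb t ht n).2.2.1) _ _
  have b₂ : ‖bulkFourier (W₂ t) k.1 k.2‖ ≤ σ :=
    norm_bulkFourier_le hu (fun n => by
      rw [(hW t).snd, Prod.snd_zero, sub_zero]
      refine (norm_smul ((n.2 : ℝ) : ℂ) (kernel (U t 0) n 0)).trans_le ?_
      rw [Complex.norm_real]
      exact (hb t ht n).2.2.2) _ _
  refine (congrArg norm (hU.bulkWindingDensity_eq h hW hc k.1 k.2)).trans_le ?_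
  rw [norm_neg]
  exact ((trCLM N).le_opNorm _).trans (mul_le_mul_of_nonneg_left
    ((norm_sub_le _ _).trans (add_le_add
      (norm_mul_lie_mul_le (R := Fiber N →L[ℂ] Fiber N) bU bD b₁ b₂)
      (norm_mul_lie_mul_le (R := Fiber N →L[ℂ] Fiber N) bU bD b₂ b₁))) (norm_nonneg _))

/-- Off finitely many time slices, a null set, the density is bounded and coincides with a
continuous function. -/
theorem IsPropagator.integrableOn_bulkWindingDensity (h : IsLocalHamiltonian id H μ C S)
    (hU : IsPropagator H U) (hW : ∀ t, HasPositionCommutators (U t 0) (W₁ t) (W₂ t)) (T : ℝ) :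
    MeasureTheory.IntegrableOn (bulkWindingDensity fun t => U t 0) (torus T) := by
  have hfin := h.finite 0 T
  have htorus : IsCompact (torus T) := isCompact_Icc.prod (isCompact_Icc.prod isCompact_Icc)
  set E : Set (ℝ × ℝ × ℝ) := (S ∩ Set.Icc 0 T) ×ˢ Set.univ with hE
  have hEm : MeasurableSet E := hfin.measurableSet.prod MeasurableSet.univ
  have hE0 : MeasureTheory.volume E = 0 := by
    rw [hE, MeasureTheory.Measure.volume_eq_prod, MeasureTheory.Measure.prod_prod,
      hfin.measure_zero, zero_mul]
  have hgood : ∀ p ∈ torus T \ E, StronglyContinuousAt H p.1 := fun p hp =>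
    h.continuousAt p.1 fun hS => hp.2 ⟨⟨hS, hp.1.1⟩, trivial⟩
  obtain ⟨M, hM⟩ := hU.exists_norm_bulkWindingDensity_le h hW |T|
  have hint : MeasureTheory.IntegrableOn (bulkWindingDensity fun t => U t 0) (torus T \ E) := by
    have hmeas : MeasurableSet (torus T \ E) := htorus.measurableSet.diff hEm
    have hlt : MeasureTheory.volume (torus T \ E) < ⊤ :=
      (MeasureTheory.measure_mono Set.sdiff_subset).trans_lt htorus.measure_lt_top
    refine MeasureTheory.IntegrableOn.of_bound hlt ?_ M ?_
    · have hc : ContinuousOn _ (torus T \ E) := fun p hp =>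
        (hU.continuousAt_bulkWindingDensity h hW (hgood p hp) p.2.1 p.2.2).continuousWithinAt
      refine (hc.congr fun p hp => ?_).aestronglyMeasurable hmeas
      exact hU.bulkWindingDensity_eq h hW (hgood p hp) p.2.1 p.2.2
    · refine MeasureTheory.ae_restrict_of_forall_mem hmeas fun p hp => ?_
      refine hM p.1 ?_ (hgood p hp) p.2
      rw [abs_of_nonneg hp.1.1.1]
      exact hp.1.1.2.trans (le_abs_self T)
  exact hint.congr_set_ae (MeasureTheory.sdiff_null_ae_eq_self hE0).symm

/-- The pointwise identity holds at almost every time; Fubini assembles the integral, and ½ ·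
1/(4π²) is the constant. -/
theorem IsPropagator.bulkIndex_eq (h : IsLocalHamiltonian id H μ C S)
    (hinv : IsTranslationInvariant H) (hU : IsPropagator H U)
    (hW : ∀ t, HasPositionCommutators (U t 0) (W₁ t) (W₂ t)) {T : ℝ} (hT : 0 ≤ T)
    {Λ Λ' : ℤ → ℝ} (hΛ : IsSwitch Λ) (hΛ' : IsSwitch Λ') :
    IntervalIntegrable (fun t => trace (bulkIndexOp (fun r => U r 0) Λ Λ' hΛ hΛ' t))
        MeasureTheory.volume 0 T ∧
      bulkIndex T (fun r => U r 0) Λ Λ' hΛ hΛ' = -(1 / (8 * (Real.pi : ℂ) ^ 2)) *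
        ∫ p in torus T, bulkWindingDensity (fun r => U r 0) p := by
  have hint := hU.integrableOn_bulkWindingDensity h hW T
  have hae : ∀ᵐ t ∂MeasureTheory.volume.restrict (Set.Icc 0 T),
      trace (bulkIndexOp (fun r => U r 0) Λ Λ' hΛ hΛ' t) = -(1 / (4 * (Real.pi : ℂ) ^ 2)) *
        ∫ k in brillouin, bulkWindingDensity (fun r => U r 0) (t, k) := by
    have h0 : MeasureTheory.volume (S ∩ Set.Icc 0 T) = 0 := (h.finite 0 T).measure_zero _
    refine (MeasureTheory.ae_restrict_iff' measurableSet_Icc).2 ?_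
    filter_upwards [MeasureTheory.compl_mem_ae_iff.2 h0] with t ht htT
    exact hU.trace_bulkIndexOp h hinv hW (h.continuousAt t fun hS => ht ⟨hS, htT⟩) hΛ hΛ'
  have hprod : MeasureTheory.IntegrableOn (bulkWindingDensity fun t => U t 0)
      (Set.Icc 0 T ×ˢ brillouin) (MeasureTheory.volume.prod MeasureTheory.volume) := hint
  have hI : MeasureTheory.IntegrableOn (fun t => ∫ k in brillouin,
      bulkWindingDensity (fun r => U r 0) (t, k)) (Set.Icc 0 T) := by
    rw [MeasureTheory.IntegrableOn, ← MeasureTheory.Measure.prod_restrict] at hprod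
    exact hprod.integral_prod_left
  have htr : MeasureTheory.IntegrableOn
      (fun t => trace (bulkIndexOp (fun r => U r 0) Λ Λ' hΛ hΛ' t)) (Set.Icc 0 T) :=
    (hI.const_mul _).congr (hae.mono fun t ht => ht.symm)
  refine ⟨(intervalIntegrable_iff_integrableOn_Icc_of_le hT).2 htr, ?_⟩
  rw [bulkIndex, intervalIntegral.integral_of_le hT, ← MeasureTheory.integral_Icc_eq_integral_Ioc,
    MeasureTheory.integral_congr_ae hae, MeasureTheory.integral_const_mul,
    ← MeasureTheory.setIntegral_prod _ hprod]
  rw [← mul_assoc]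
  congr 1
  ring

end Propagator

end

end Floquet

/-! ### Assembly of the edge and bulk statements -/

theorem mainTheorem8 {N : ℕ} {T : ℝ} (hT : 0 < T)
    (H : ℝ → Op (ℤ × ℤ) N) (hH : IsBulkHamiltonian T H) (hinv : IsTranslationInvariant H)
    (UB : ℝ → ℝ → Op (ℤ × ℤ) N) (hUB : IsPropagator H UB) (hper : UB T 0 = 1)
    (UE : ℝ → ℝ → Op (ℕ × ℤ) N) (hUE : IsPropagator (edgeHamiltonian H) UE) :
    -- the edge index is the winding number of the edge propagator along `k₂`
    ((∀ k₂ : ℝ, Summable (edgeFourierTerm (UE T 0) k₂)) ∧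
      Differentiable ℝ (fun k₂ : ℝ => edgeFourier (UE T 0) k₂) ∧
      (∀ k₂ : ℝ, IsTraceClass (edgeWindingOp (UE T 0) k₂)) ∧
      IntervalIntegrable (fun k₂ : ℝ => trace (edgeWindingOp (UE T 0) k₂)) MeasureTheory.volume
        0 (2 * Real.pi) ∧
      ∀ (Λ₂ : ℤ → ℝ) (h₂ : IsSwitch Λ₂),
        IsTraceClass (edgeIndexOp (UE T 0) Λ₂ h₂) ∧
        edgeIndex (UE T 0) Λ₂ h₂ =
          Complex.I / (2 * Real.pi) *
            ∫ k₂ in (0 : ℝ)..(2 * Real.pi), trace (edgeWindingOp (UE T 0) k₂)) ∧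
    -- the bulk index is the 3d winding number of the bulk propagator
    ((∀ t k₁ k₂ : ℝ, Summable (bulkFourierTerm (UB t 0) k₁ k₂)) ∧
      (∀ t k₂ : ℝ, Differentiable ℝ (fun k₁ : ℝ => bulkFourier (UB t 0) k₁ k₂)) ∧
      (∀ t k₁ : ℝ, Differentiable ℝ (fun k₂ : ℝ => bulkFourier (UB t 0) k₁ k₂)) ∧
      (∀ t k₁ k₂ : ℝ, StronglyContinuousAt H t →
        DifferentiableAt ℝ (fun r : ℝ => bulkFourier (UB r 0) k₁ k₂) t) ∧
      MeasureTheory.IntegrableOn (bulkWindingDensity (fun t => UB t 0)) (torus T) ∧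
      ∀ (Λ₁ Λ₂ : ℤ → ℝ) (h₁ : IsSwitch Λ₁) (h₂ : IsSwitch Λ₂),
        (∀ t : ℝ, IsTraceClass (bulkIndexOp (fun t => UB t 0) Λ₁ Λ₂ h₁ h₂ t)) ∧
        IntervalIntegrable (fun t : ℝ => trace (bulkIndexOp (fun t => UB t 0) Λ₁ Λ₂ h₁ h₂ t))
          MeasureTheory.volume 0 T ∧
        bulkIndex T (fun t => UB t 0) Λ₁ Λ₂ h₁ h₂ =
          -(1 / (8 * (Real.pi : ℂ) ^ 2)) *
            ∫ p in torus T, bulkWindingDensity (fun t => UB t 0) p) := by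
  obtain ⟨μ, C, S, h⟩ := hH.exists_isLocalHamiltonian hT
  obtain ⟨W₁, W₂, hW⟩ := hUB.exists_hasPositionCommutators h hinv
  obtain ⟨γ, hγ, A, hA, hK⟩ := exists_abs_mul_norm_kernel_edge_le h hUB hUE hT.le hper
  have hE : ∀ s, IsInvariant (edgeShift s) (UE T 0) := fun s =>
    hUE.isInvariant h.edge (fun t => isInvariant_edgeHamiltonian hinv t s) T 0
  refine ⟨⟨summable_edgeFourierTerm hγ hA hK,
      fun k => (hasDerivAt_edgeFourier hγ hA hK k).differentiableAt,
      fun k => isTraceClass_of_summable_norm (summable_norm_edgeWindingOp hγ hA hK k),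
      (continuous_trace_edgeWindingOp hγ hA hK).intervalIntegrable _ _,
      fun Λ₂ h₂ => ⟨isTraceClass_of_summable_norm (summable_norm_edgeIndexOp hγ hA hK hE h₂),
        edgeIndex_eq hγ hA hK hE h₂⟩⟩,
    fun t k₁ k₂ => ((hW t).wiener.summable_norm_bulkFourierTerm k₁ k₂).of_norm,
    fun t k₂ k₁ => (hasDerivAt_bulkFourier_fst (hW t).wiener (hW t).wiener_fst (hW t).fst
      k₁ k₂).differentiableAt,
    fun t k₁ k₂ => (hasDerivAt_bulkFourier_snd (hW t).wiener (hW t).wiener_snd (hW t).snd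
      k₁ k₂).differentiableAt,
    fun t k₁ k₂ ht => (hUB.hasDerivAt_bulkFourier h ht k₁ k₂).differentiableAt,
    hUB.integrableOn_bulkWindingDensity h hW T,
    fun Λ₁ Λ₂ h₁ h₂ => ⟨fun t => isTraceClass_of_summable_norm
        ((hW t).summable_norm_mul_lie _ h₁ h₂), hUB.bulkIndex_eq h hinv hW hT.le h₁ h₂⟩⟩
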